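/- Let $n\ge 3$. A twisted $n$-gon is a sequence $(v_i)_{i\in\mathbb Z}$ of points of $\mathbb{RP}^2$ such that $v_{i+n}=Mv_i$ for all $i$ and some monodromy $M\in \mathrm{PGL}(3,\mathbb R)$, with $v_{i-1},v_i,v_{i+1}$ in general position for all $i$. Let $\mathcal P_n$ be the space of twisted $n$-gons modulo projective transformations, and $\mathcal P_n^\circ\subset\mathcal P_n$ its generic part, where any three among four consecutive vertices are in general position. The pentagram map $T$ sends $(v_i)$ to the polygon with vertices $v_{i-1}v_{i+1}\cap v_iv_{i+2}$; it is regarded as a map from $D=\{p\in\mathcal P_n^\circ: T(p) \text{ is defined and lies in } \mathcal P_n^\circ\}$ to $\mathcal P_n^\circ$. For collinear points with affine parameters $t_1,\dots,t_4$ put $[t_1,t_2,t_3,t_4]=\frac{(t_1-t_2)(t_3-t_4)}{(t_1-t_3)(t_2-t_4)}$. With $P_i=v_{i-2}v_{i-1}\cap v_iv_{i+1}$ and $Q_i=v_{i-2}v_{i-1}\cap v_{i+1}v_{i+2}$, the corner invariants are the $n$-periodic sequences $$x_i=[v_{i-2},v_{i-1},P_i,Q_i],\qquad y_i=[Q_i,P_{i+1},v_{i+1},v_{i+2}].$$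 Indices of $x,y$ are taken modulo $n$. Set $O_n=\prod_i x_i$, $E_n=\prod_i y_i$ and, for $1\le k\le\lfloor n/2\rfloor$, let $O_k$ be the sum of $(-1)^t X_{i_1}\cdots X_{i_s}x_{j_1}\cdots x_{j_t}$ over all admissible choices with $s+t=k$, where $X_i=x_iy_ix_{i+1}$ and a choice is admissible if no two chosen factors are consecutive: $X_i,X_j$ are consecutive if $j\in\{i-2,\dots,i+2\}$, $X_i,x_j$ if $j\in\{i-1,i,i+1,i+2\}$, and $x_i,x_{i+1}$ are consecutive. Define $E_k$ in the same way with $y_i$ in place of $x_i$ and $Y_i=y_ix_{i+1}y_{i+1}$ in place of $X_i$. Let $\{\cdot,\cdot\}$ be the bracket on $C^\infty(\mathcal P_n^\circ)$ (smooth in the corner invariants) that is a derivation in each argument, with $\{x_i,x_{i\pm1}\}=\mp x_ix_{i\pm1}$, $\{y_i,y_{i\pm1}\}=\pm y_iy_{i\pm1}$, and all other brackets of coordinates zero. Then: 1. The corner invariants map $\mathcal P_n^\circ$ bijectively onto $(\mathbb R\setminus\{0\})^{2n}$ and $D$ onto the subset where $x_iy_i\ne1$ for all $i$, and on $D$ $$T^*x_i=x_i\frac{1-x_{i-1}y_{i-1}}{1-x_{i+1}y_{i+1}},\qquad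 T^*y_i=y_{i+1}\frac{1-x_{i+2}y_{i+2}}{1-x_iy_i}.$$ 2. The bracket is a Poisson bracket, and it is preserved by $T$: $\{f\circ T,g\circ T\}=\{f,g\}\circ T$ on $D$. 3. The bracket has corank $2$ if $n$ is odd and $4$ if $n$ is even (the codimension of the span of the Hamiltonian vector fields, that is, of the tangent spaces of the symplectic leaves, at every point of $\mathcal P_n^\circ$). 4. $O_n$ and $E_n$ are Casimirs; if $n$ is even, $O_{n/2}=(-1)^{n/2}\bigl(\prod_{i\text{ even}}x_i+\prod_{i\text{ odd}}x_i\bigr)$ and $E_{n/2}=(-1)^{n/2}\bigl(\prod_{i\text{ even}}y_i+\prod_{i\text{ odd}}y_i\bigr)$ are Casimirs as well. 5. The $O_k,E_k$ are the weighted homogeneous parts coming from the monodromy: for every lift $M\in \mathrm{GL}_3(\mathbb R)$ of the monodromy of a generic twisted $n$-gon, $$O_n^2E_n\frac{\operatorname{tr}^3(M^{-1})}{\det(M^{-1})}=\Bigl(1+\sum_{k=1}^{\lfloor n/2\rfloor}O_k\Bigr)^3,\qquad O_nE_n^2\frac{\operatorname{tr}^3(M)}{\det(M)}=\Bigl(1+\sum_{k=1}^{\lfloor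 n/2\rfloor}E_k\Bigr)^3,$$ and $O_k$, $E_k$ have weights $k$, $-k$ under $(x_i,y_i)\mapsto(tx_i,t^{-1}y_i)$, $t\neq 0$ (also for $k=n$). 6. The functions $O_k,E_k$, $k\in\{1,\dots,\lfloor n/2\rfloor\}\cup\{n\}$, are $T$-invariant, pairwise Poisson-commute and are algebraically independent over $\mathbb R$. 7. Consequently $T$ is integrable in the sense of Arnold–Liouville: with $c$ the corank, these $T$-invariant Poisson-commuting functions have linearly independent differentials on an open dense subset of $\mathcal P_n^\circ$, exactly $c$ of them are Casimirs, and the remaining ones are $(2n-c)/2$ in number, half the dimension of the symplectic leaves. -/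

import Mathlib

open scoped LinearAlgebra.Projectivization MatrixGroups ContDiff Matrix

noncomputable section

namespace Pentagram

/-! ### The real projective plane -/

/-- The real projective plane. -/
abbrev Plane : Type := ℙ ℝ (Fin 3 → ℝ)

/-- Three points of the projective plane are in general position (not collinear). -/
def GeneralPosition (p q r : Plane) : Prop :=
  Projectivization.Independent ![p, q, r]

/-- The intersection point of the lines `pq` and `rs` (for `p ≠ q`, `r ≠ s` and distinct lines):
in homogeneous coordinates it is `(p × q) × (r × s)`. -/
def meet (p q r s : Plane) : Plane :=
  Projectivization.cross (Projectivization.cross p q) (Projectivization.cross r s)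

/-- The cross-ratio in terms of homogeneous coordinates of four collinear points. -/
def vecCrossRatio (a b c d : Fin 3 → ℝ) : ℝ :=
  ((a ⨯₃ b) ⬝ᵥ (c ⨯₃ d)) / ((a ⨯₃ c) ⬝ᵥ (b ⨯₃ d))

/-- The cross-ratio of four collinear points of the projective plane. If the points have affine
parameters `t₁, t₂, t₃, t₄` on their line, it equals
`(t₁ - t₂) (t₃ - t₄) / ((t₁ - t₃) (t₂ - t₄))`, see `crossRatio_affine`. -/
def crossRatio (a b c d : Plane) : ℝ :=
  vecCrossRatio a.rep b.rep c.rep d.rep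

theorem rep_mk (v : Fin 3 → ℝ) (hv : v ≠ 0) :
    ∃ a : ℝ, a ≠ 0 ∧ (Projectivization.mk ℝ v hv).rep = a • v := by
  obtain ⟨a, ha⟩ := Projectivization.exists_smul_eq_mk_rep ℝ v hv
  exact ⟨a, a.ne_zero, ha.symm⟩

theorem vecCrossRatio_smul (a b c d : Fin 3 → ℝ) {k l m o : ℝ}
    (hk : k ≠ 0) (hl : l ≠ 0) (hm : m ≠ 0) (ho : o ≠ 0) :
    vecCrossRatio (k • a) (l • b) (m • c) (o • d) = vecCrossRatio a b c d := by
  have h : k * l * m * o ≠ 0 := by positivity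
  simp only [vecCrossRatio, map_smul, LinearMap.smul_apply, smul_dotProduct, dotProduct_smul,
    smul_eq_mul]
  rw [← mul_div_mul_left (a ⨯₃ b ⬝ᵥ c ⨯₃ d) (a ⨯₃ c ⬝ᵥ b ⨯₃ d) h]
  congr 1 <;> ring

theorem crossRatio_mk {a b c d : Fin 3 → ℝ} (ha : a ≠ 0) (hb : b ≠ 0) (hc : c ≠ 0) (hd : d ≠ 0) :
    crossRatio (.mk ℝ a ha) (.mk ℝ b hb) (.mk ℝ c hc) (.mk ℝ d hd) = vecCrossRatio a b c d := by
  obtain ⟨k, hk, hk'⟩ := rep_mk a ha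
  obtain ⟨l, hl, hl'⟩ := rep_mk b hb
  obtain ⟨m, hm, hm'⟩ := rep_mk c hc
  obtain ⟨o, ho, ho'⟩ := rep_mk d hd
  rw [crossRatio, hk', hl', hm', ho', vecCrossRatio_smul _ _ _ _ hk hl hm ho]

theorem crossRatio_affine {u w : Fin 3 → ℝ} (h : LinearIndependent ℝ ![u, w]) (t : Fin 4 → ℝ)
    (ht : ∀ i, u + t i • w ≠ 0) :
    crossRatio (.mk ℝ _ (ht 0)) (.mk ℝ _ (ht 1)) (.mk ℝ _ (ht 2)) (.mk ℝ _ (ht 3)) =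
      ((t 0 - t 1) * (t 2 - t 3)) / ((t 0 - t 2) * (t 1 - t 3)) := by
  have hN : u ⨯₃ w ≠ 0 := crossProduct_ne_zero_iff_linearIndependent.2 h
  have hN' : (u ⨯₃ w) ⬝ᵥ (u ⨯₃ w) ≠ 0 := fun h0 => hN (dotProduct_self_eq_zero.1 h0)
  have key : ∀ s r : ℝ, (u + s • w) ⨯₃ (u + r • w) = (r - s) • (u ⨯₃ w) := by
    intro s r
    have : w ⨯₃ u = - (u ⨯₃ w) := (cross_anticomm u w).symm
    simp only [map_add, map_smul, LinearMap.add_apply, LinearMap.smul_apply, cross_self, this]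
    module
  rw [crossRatio_mk, vecCrossRatio]
  simp only [key, smul_dotProduct, dotProduct_smul, smul_eq_mul]
  rw [← mul_div_mul_right ((t 0 - t 1) * (t 2 - t 3)) _ hN']
  congr 1 <;> ring

/-! ### Behaviour under projective transformations -/

theorem cross_mulVec (M : Matrix (Fin 3) (Fin 3) ℝ) (u v : Fin 3 → ℝ) :
    (M *ᵥ u) ⨯₃ (M *ᵥ v) = M.adjugateᵀ *ᵥ (u ⨯₃ v) := by
  ext i
  fin_cases i <;>
    simp [crossProduct, Matrix.mulVec, dotProduct, Fin.sum_univ_three,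
      Matrix.adjugate_fin_three] <;> ring

theorem cross_cross_mulVec (M : Matrix (Fin 3) (Fin 3) ℝ) (a b c d : Fin 3 → ℝ) :
    ((M *ᵥ a) ⨯₃ (M *ᵥ b)) ⨯₃ ((M *ᵥ c) ⨯₃ (M *ᵥ d)) =
      M.det • M *ᵥ ((a ⨯₃ b) ⨯₃ (c ⨯₃ d)) := by
  rw [cross_mulVec, cross_mulVec, cross_mulVec, Matrix.adjugate_transpose,
    Matrix.transpose_transpose, Matrix.adjugate_adjugate _ (by simp), ← Matrix.smul_mulVec]
  simp

theorem exists_mk (p : Plane) : ∃ (v : Fin 3 → ℝ) (hv : v ≠ 0), p = .mk ℝ v hv :=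
  ⟨p.rep, p.rep_nonzero, p.mk_rep.symm⟩

theorem generalPosition_mk {u v w : Fin 3 → ℝ} (hu : u ≠ 0) (hv : v ≠ 0) (hw : w ≠ 0) :
    GeneralPosition (.mk ℝ u hu) (.mk ℝ v hv) (.mk ℝ w hw) ↔ u ⬝ᵥ (v ⨯₃ w) ≠ 0 := by
  have key : ∀ a b c : Fin 3 → ℝ,
      LinearIndependent ℝ ![a, b, c] ↔ a ⬝ᵥ (b ⨯₃ c) ≠ 0 := by
    intro a b c
    rw [triple_product_eq_det, ← isUnit_iff_ne_zero]
    exact Matrix.linearIndependent_rows_iff_isUnit.trans (Matrix.isUnit_iff_isUnit_det _)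
  obtain ⟨k, hk, hk'⟩ := rep_mk u hu
  obtain ⟨l, hl, hl'⟩ := rep_mk v hv
  obtain ⟨m, hm, hm'⟩ := rep_mk w hw
  have : (Projectivization.rep ∘ ![Projectivization.mk ℝ u hu, .mk ℝ v hv, .mk ℝ w hw]) =
      ![k • u, l • v, m • w] := by
    ext i j
    fin_cases i <;> simp [hk', hl', hm']
  rw [GeneralPosition, Projectivization.independent_iff, this, key]
  simp [hk, hl, hm]

theorem mulVec_ne_zero (g : GL (Fin 3) ℝ) {v : Fin 3 → ℝ} (hv : v ≠ 0) :
    (g : Matrix (Fin 3) (Fin 3) ℝ) *ᵥ v ≠ 0 :=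
  (smul_ne_zero_iff_ne g).2 hv

theorem mk_smul_mk (g : GL (Fin 3) ℝ) {v : Fin 3 → ℝ} (hv : v ≠ 0) :
    (Matrix.ProjGenLinGroup.mk g : PGL(3, ℝ)) • Projectivization.mk ℝ v hv =
      .mk ℝ ((g : Matrix (Fin 3) (Fin 3) ℝ) *ᵥ v) (mulVec_ne_zero g hv) := rfl

theorem det_ne_zero (g : GL (Fin 3) ℝ) : (g : Matrix (Fin 3) (Fin 3) ℝ).det ≠ 0 :=
  (Matrix.isUnit_iff_isUnit_det _).1 g.isUnit |>.ne_zero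

theorem generalPosition_smul (g : PGL(3, ℝ)) (p q r : Plane) :
    GeneralPosition (g • p) (g • q) (g • r) ↔ GeneralPosition p q r := by
  induction g using Matrix.ProjGenLinGroup.induction_on with | mk g => ?_
  obtain ⟨u, hu, rfl⟩ := exists_mk p
  obtain ⟨v, hv, rfl⟩ := exists_mk q
  obtain ⟨w, hw, rfl⟩ := exists_mk r
  rw [mk_smul_mk, mk_smul_mk, mk_smul_mk, generalPosition_mk, generalPosition_mk, cross_mulVec,
    Matrix.mulVec_transpose, dotProduct_comm, ← Matrix.dotProduct_mulVec, Matrix.mulVec_mulVec,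
    Matrix.adjugate_mul, Matrix.smul_mulVec, Matrix.one_mulVec, dotProduct_smul, smul_eq_mul,
    mul_ne_zero_iff, dotProduct_comm]
  simp [det_ne_zero g]

theorem cross_mk_ne_zero {u v w : Fin 3 → ℝ} (h : u ⬝ᵥ (v ⨯₃ w) ≠ 0) : u ⨯₃ v ≠ 0 := by
  intro h0
  apply h
  rw [triple_product_permutation, triple_product_permutation, h0, dotProduct_zero]

theorem meet_mk {a b c d : Fin 3 → ℝ} (ha : a ≠ 0) (hb : b ≠ 0) (hc : c ≠ 0) (hd : d ≠ 0)
    (hab : a ⨯₃ b ≠ 0) (hcd : c ⨯₃ d ≠ 0) (h : (a ⨯₃ b) ⨯₃ (c ⨯₃ d) ≠ 0) :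
    meet (.mk ℝ a ha) (.mk ℝ b hb) (.mk ℝ c hc) (.mk ℝ d hd) =
      .mk ℝ ((a ⨯₃ b) ⨯₃ (c ⨯₃ d)) h := by
  rw [meet, Projectivization.cross_mk_of_cross_ne_zero _ _ hab,
    Projectivization.cross_mk_of_cross_ne_zero _ _ hcd,
    Projectivization.cross_mk_of_cross_ne_zero _ _ h]

theorem cross_cross_ne_zero {a b c d : Fin 3 → ℝ} (hcd : c ⨯₃ d ≠ 0)
    (h : a ⬝ᵥ (b ⨯₃ c) ≠ 0) : (a ⨯₃ b) ⨯₃ (c ⨯₃ d) ≠ 0 := by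
  intro h0
  have h1 : (c ⬝ᵥ (a ⨯₃ b)) • (c ⨯₃ d) = -(c ⨯₃ ((a ⨯₃ b) ⨯₃ (c ⨯₃ d))) := by
    ext i
    fin_cases i <;> simp [crossProduct, dotProduct, Fin.sum_univ_three] <;> ring
  rw [h0, map_zero, neg_zero, smul_eq_zero, triple_product_permutation] at h1
  exact h1.elim h hcd

theorem ne_iff_cross {c d : Fin 3 → ℝ} (hc : c ≠ 0) (hd : d ≠ 0) :
    (Projectivization.mk ℝ c hc ≠ .mk ℝ d hd) ↔ c ⨯₃ d ≠ 0 :=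
  (Projectivization.mk_eq_mk_iff_crossProduct_eq_zero hc hd).not

theorem meet_smul (g : PGL(3, ℝ)) {p q r s : Plane} (h : GeneralPosition p q r) (hrs : r ≠ s) :
    meet (g • p) (g • q) (g • r) (g • s) = g • meet p q r s := by
  have h' := (generalPosition_smul g p q r).2 h
  have hrs' : g • r ≠ g • s := fun e => hrs (smul_left_cancel g e)
  induction g using Matrix.ProjGenLinGroup.induction_on with | mk g => ?_
  obtain ⟨a, ha, rfl⟩ := exists_mk p
  obtain ⟨b, hb, rfl⟩ := exists_mk q
  obtain ⟨c, hc, rfl⟩ := exists_mk r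
  obtain ⟨d, hd, rfl⟩ := exists_mk s
  simp only [mk_smul_mk, generalPosition_mk, ne_iff_cross] at h h' hrs hrs'
  rw [meet_mk ha hb hc hd (cross_mk_ne_zero h) hrs (cross_cross_ne_zero hrs h)]
  simp only [mk_smul_mk]
  rw [meet_mk _ _ _ _ (cross_mk_ne_zero h') hrs' (cross_cross_ne_zero hrs' h'),
    Projectivization.mk_eq_mk_iff]
  refine ⟨Units.mk0 _ (det_ne_zero g), ?_⟩
  rw [cross_cross_mulVec, Units.smul_def]
  rfl

theorem exists_smul_of_orthogonal {x y N : Fin 3 → ℝ} (hN : N ≠ 0) (hx : x ⬝ᵥ N = 0)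
    (hy : y ⬝ᵥ N = 0) : ∃ k : ℝ, x ⨯₃ y = k • N := by
  have h0 : (x ⨯₃ y) ⨯₃ N = 0 := by
    rw [cross_cross_eq_smul_sub_smul, hx, dotProduct_comm y N] at *
    simp_all [dotProduct_comm]
  by_cases hxy : x ⨯₃ y = 0
  · exact ⟨0, by simp [hxy]⟩
  · obtain ⟨k, hk⟩ := (Projectivization.mk_eq_mk_iff ℝ _ _ hxy hN).1
      ((Projectivization.mk_eq_mk_iff_crossProduct_eq_zero hxy hN).2 h0)
    exact ⟨k, hk.symm⟩

theorem crossRatio_smul (g : PGL(3, ℝ)) {p q r s l : Plane}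
    (hp : p.orthogonal l) (hq : q.orthogonal l) (hr : r.orthogonal l) (hs : s.orthogonal l) :
    crossRatio (g • p) (g • q) (g • r) (g • s) = crossRatio p q r s := by
  induction g using Matrix.ProjGenLinGroup.induction_on with | mk g => ?_
  obtain ⟨a, ha, rfl⟩ := exists_mk p
  obtain ⟨b, hb, rfl⟩ := exists_mk q
  obtain ⟨c, hc, rfl⟩ := exists_mk r
  obtain ⟨d, hd, rfl⟩ := exists_mk s
  obtain ⟨N, hN, rfl⟩ := exists_mk l
  rw [Projectivization.orthogonal_mk] at hp hq hr hs
  simp only [mk_smul_mk]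
  rw [crossRatio_mk, crossRatio_mk, vecCrossRatio, vecCrossRatio]
  obtain ⟨k₁, h₁⟩ := exists_smul_of_orthogonal hN hp hq
  obtain ⟨k₂, h₂⟩ := exists_smul_of_orthogonal hN hr hs
  obtain ⟨k₃, h₃⟩ := exists_smul_of_orthogonal hN hp hr
  obtain ⟨k₄, h₄⟩ := exists_smul_of_orthogonal hN hq hs
  set M : Matrix (Fin 3) (Fin 3) ℝ := g.val with hM
  have hCN : M.adjugateᵀ *ᵥ N ≠ 0 := by
    intro h0
    have := congrArg (fun v => Mᵀ *ᵥ v) h0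
    simp only [Matrix.mulVec_mulVec, Matrix.mulVec_zero, ← Matrix.transpose_mul,
      Matrix.adjugate_mul, Matrix.transpose_smul, Matrix.transpose_one, Matrix.smul_mulVec,
      Matrix.one_mulVec, smul_eq_zero] at this
    exact this.elim (det_ne_zero g) hN
  have e₁ : N ⬝ᵥ N ≠ 0 := fun h0 => hN (dotProduct_self_eq_zero.1 h0)
  have e₂ : (M.adjugateᵀ *ᵥ N) ⬝ᵥ (M.adjugateᵀ *ᵥ N) ≠ 0 :=
    fun h0 => hCN (dotProduct_self_eq_zero.1 h0)
  simp only [cross_mulVec, h₁, h₂, h₃, h₄, Matrix.mulVec_smul, smul_dotProduct, dotProduct_smul,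
    smul_eq_mul, ← mul_assoc]
  rw [mul_div_mul_right _ _ e₁, mul_div_mul_right _ _ e₂]

theorem GeneralPosition.rotate {p q r : Plane} (h : GeneralPosition p q r) :
    GeneralPosition q r p := by
  obtain ⟨a, ha, rfl⟩ := exists_mk p
  obtain ⟨b, hb, rfl⟩ := exists_mk q
  obtain ⟨c, hc, rfl⟩ := exists_mk r
  rw [generalPosition_mk] at h ⊢
  rwa [← triple_product_permutation]

theorem GeneralPosition.swap {p q r : Plane} (h : GeneralPosition p q r) :
    GeneralPosition p r q := by
  obtain ⟨a, ha, rfl⟩ := exists_mk p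
  obtain ⟨b, hb, rfl⟩ := exists_mk q
  obtain ⟨c, hc, rfl⟩ := exists_mk r
  rw [generalPosition_mk] at h ⊢
  rwa [← cross_anticomm, dotProduct_neg, neg_ne_zero]

theorem GeneralPosition.ne {p q r : Plane} (h : GeneralPosition p q r) : p ≠ q := by
  obtain ⟨a, ha, rfl⟩ := exists_mk p
  obtain ⟨b, hb, rfl⟩ := exists_mk q
  obtain ⟨c, hc, rfl⟩ := exists_mk r
  rw [generalPosition_mk] at h
  exact (ne_iff_cross _ _).2 (cross_mk_ne_zero h)

theorem meet_orthogonal {p q r s : Plane} (h : GeneralPosition p q r) (hrs : r ≠ s) :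
    (meet p q r s).orthogonal (Projectivization.cross p q) ∧
      (meet p q r s).orthogonal (Projectivization.cross r s) := by
  obtain ⟨a, ha, rfl⟩ := exists_mk p
  obtain ⟨b, hb, rfl⟩ := exists_mk q
  obtain ⟨c, hc, rfl⟩ := exists_mk r
  obtain ⟨d, hd, rfl⟩ := exists_mk s
  simp only [generalPosition_mk, ne_iff_cross] at h hrs
  rw [meet_mk ha hb hc hd (cross_mk_ne_zero h) hrs (cross_cross_ne_zero hrs h),
    Projectivization.cross_mk_of_cross_ne_zero _ _ (cross_mk_ne_zero h),
    Projectivization.cross_mk_of_cross_ne_zero _ _ hrs, Projectivization.orthogonal_mk,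
    Projectivization.orthogonal_mk]
  constructor
  · rw [dotProduct_comm, dot_self_cross]
  · rw [dotProduct_comm, dot_cross_self]

/-! ### Corner invariants and the pentagram map for sequences of points -/

/-- The left corner cross-ratio `x_i`. -/
def leftCorner (v : ℤ → Plane) (i : ℤ) : ℝ :=
  crossRatio (v (i - 2)) (v (i - 1))
    (meet (v (i - 2)) (v (i - 1)) (v i) (v (i + 1)))
    (meet (v (i - 2)) (v (i - 1)) (v (i + 1)) (v (i + 2)))

/-- The right corner cross-ratio `y_i`. -/
def rightCorner (v : ℤ → Plane) (i : ℤ) : ℝ :=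
  crossRatio
    (meet (v (i - 2)) (v (i - 1)) (v (i + 1)) (v (i + 2)))
    (meet (v (i - 1)) (v i) (v (i + 1)) (v (i + 2)))
    (v (i + 1)) (v (i + 2))

/-- The `i`-th vertex of the image under the pentagram map: the intersection of the two
consecutive short diagonals `v_{i-1} v_{i+1}` and `v_i v_{i+2}`. -/
def pentagramVertex (v : ℤ → Plane) (i : ℤ) : Plane :=
  meet (v (i - 1)) (v (i + 1)) (v i) (v (i + 2))

/-- Consecutive triples of points are in general position. -/
def IsPolygon (v : ℤ → Plane) : Prop :=
  ∀ i, GeneralPosition (v (i - 1)) (v i) (v (i + 1))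

/-- Genericity: any three among four consecutive points are in general position. -/
def IsGenericPolygon (v : ℤ → Plane) : Prop :=
  ∀ i, GeneralPosition (v i) (v (i + 1)) (v (i + 2)) ∧
    GeneralPosition (v i) (v (i + 1)) (v (i + 3)) ∧
    GeneralPosition (v i) (v (i + 2)) (v (i + 3)) ∧
    GeneralPosition (v (i + 1)) (v (i + 2)) (v (i + 3))

theorem IsPolygon.congr {v w : ℤ → Plane} {g : PGL(3, ℝ)} (h : ∀ k, w k = g • v k) :
    IsPolygon w ↔ IsPolygon v := by
  simp only [IsPolygon, h, generalPosition_smul]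

theorem IsGenericPolygon.congr {v w : ℤ → Plane} {g : PGL(3, ℝ)} (h : ∀ k, w k = g • v k) :
    IsGenericPolygon w ↔ IsGenericPolygon v := by
  simp only [IsGenericPolygon, h, generalPosition_smul]

theorem pentagramVertex_smul {v w : ℤ → Plane} {g : PGL(3, ℝ)} (h : ∀ k, w k = g • v k)
    (hv : IsPolygon v) (i : ℤ) : pentagramVertex w i = g • pentagramVertex v i := by
  simp only [pentagramVertex, h]
  have h1 := hv (i + 1)
  rw [show i + 1 - 1 = i by ring, show i + 1 + 1 = i + 2 by ring] at h1
  exact meet_smul g (hv i).swap (h1.swap.ne)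

theorem corner_smul {v w : ℤ → Plane} {g : PGL(3, ℝ)} (h : ∀ k, w k = g • v k)
    (hv : IsGenericPolygon v) (i : ℤ) :
    leftCorner w i = leftCorner v i ∧ rightCorner w i = rightCorner v i := by
  obtain ⟨a1, a2, -, a4⟩ := hv (i - 2)
  obtain ⟨-, b2, -, b4⟩ := hv (i - 1)
  rw [show i - 2 + 1 = i - 1 by ring, show i - 2 + 2 = i by ring,
    show i - 2 + 3 = i + 1 by ring] at *
  rw [show i - 1 + 1 = i by ring, show i - 1 + 2 = i + 1 by ring,
    show i - 1 + 3 = i + 2 by ring] at *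
  have n1 : v i ≠ v (i + 1) := b4.ne
  have n2 : v (i + 1) ≠ v (i + 2) := b4.rotate.ne
  have n3 : v (i - 2) ≠ v (i - 1) := a1.ne
  simp only [leftCorner, rightCorner, h]
  rw [meet_smul g a1 n1, meet_smul g a2 n2, meet_smul g a4 n2]
  exact ⟨crossRatio_smul g (Projectivization.orthogonal_cross_left n3)
      (Projectivization.orthogonal_cross_right n3) (meet_orthogonal a1 n1).1
      (meet_orthogonal a2 n2).1,
    crossRatio_smul g (meet_orthogonal a2 n2).2 (meet_orthogonal a4 n2).2
      (Projectivization.orthogonal_cross_left n2) (Projectivization.orthogonal_cross_right n2)⟩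

/-! ### The space of twisted polygons -/

/-- A twisted `n`-gon. -/
structure TwistedPolygon (n : ℕ) where
  vertex : ℤ → Plane
  exists_monodromy : ∃ M : PGL(3, ℝ), ∀ k : ℤ, vertex (k + n) = M • vertex k
  isPolygon : IsPolygon vertex

/-- `M` is a monodromy of the twisted polygon. -/
def TwistedPolygon.HasMonodromy {n : ℕ} (φ : TwistedPolygon n) (M : PGL(3, ℝ)) : Prop :=
  ∀ k : ℤ, φ.vertex (k + n) = M • φ.vertex k

/-- The corner invariants of a generic twisted `n`-gon are `n`-periodic sequences. -/
theorem TwistedPolygon.corner_periodic {n : ℕ} (φ : TwistedPolygon n)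
    (h : IsGenericPolygon φ.vertex) (i : ℤ) :
    leftCorner φ.vertex (i + n) = leftCorner φ.vertex i ∧
      rightCorner φ.vertex (i + n) = rightCorner φ.vertex i := by
  obtain ⟨M, hM⟩ := φ.exists_monodromy
  have := corner_smul (w := fun k => φ.vertex (k + n)) hM h i
  simp only [leftCorner, rightCorner, add_sub_right_comm, add_right_comm] at this ⊢
  exact this

/-- The twisted polygon whose vertices are the intersection points of consecutive short
diagonals, defined when these points form a twisted polygon. -/
def TwistedPolygon.pentagram {n : ℕ} (φ : TwistedPolygon n)
    (h : IsPolygon (pentagramVertex φ.vertex)) : TwistedPolygon n where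
  vertex := pentagramVertex φ.vertex
  exists_monodromy := by
    obtain ⟨M, hM⟩ := φ.exists_monodromy
    refine ⟨M, fun k => ?_⟩
    have := pentagramVertex_smul (w := fun k => φ.vertex (k + n)) hM φ.isPolygon k
    simp only [pentagramVertex, add_sub_right_comm, add_right_comm] at this ⊢
    exact this
  isPolygon := h

/-- Projective equivalence of twisted polygons. -/
def TwistedPolygon.ProjEquiv {n : ℕ} (φ ψ : TwistedPolygon n) : Prop :=
  ∃ g : PGL(3, ℝ), ∀ k, ψ.vertex k = g • φ.vertex k

instance TwistedPolygon.setoid (n : ℕ) : Setoid (TwistedPolygon n) where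
  r := TwistedPolygon.ProjEquiv
  iseqv := by
    refine ⟨fun _ => ⟨1, fun _ => (one_smul _ _).symm⟩, ?_, ?_⟩
    · rintro φ ψ ⟨g, hg⟩
      exact ⟨g⁻¹, fun k => by rw [hg, inv_smul_smul]⟩
    · rintro φ ψ χ ⟨g, hg⟩ ⟨h, hh⟩
      exact ⟨h * g, fun k => by rw [hh, hg, mul_smul]⟩

/-- The space `𝒫_n` of twisted `n`-gons modulo projective equivalence. -/
def PolygonSpace (n : ℕ) : Type := Quotient (TwistedPolygon.setoid n)

/-- The class of a twisted polygon. -/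
def TwistedPolygon.toSpace {n : ℕ} (φ : TwistedPolygon n) : PolygonSpace n := Quotient.mk _ φ

theorem pentagram_congr {n : ℕ} {φ ψ : TwistedPolygon n} (h : φ ≈ ψ) :
    IsPolygon (pentagramVertex φ.vertex) ↔ IsPolygon (pentagramVertex ψ.vertex) := by
  obtain ⟨g, hg⟩ := h
  exact (IsPolygon.congr (pentagramVertex_smul hg φ.isPolygon)).symm

/-- The generic part of `𝒫_n`. -/
def generic (n : ℕ) : Set (PolygonSpace n) :=
  {p | Quotient.lift (fun φ : TwistedPolygon n => IsGenericPolygon φ.vertex)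
    (by rintro φ ψ ⟨g, hg⟩; exact propext (IsGenericPolygon.congr hg).symm) p}

/-- The set of classes on which the pentagram map is defined. -/
def pentagramDefined (n : ℕ) : Set (PolygonSpace n) :=
  {p | Quotient.lift (fun φ : TwistedPolygon n => IsPolygon (pentagramVertex φ.vertex))
    (fun _ _ h => propext (pentagram_congr h)) p}

open Classical in
/-- The pentagram map `T` on `𝒫_n`; outside of `pentagramDefined n` it has a junk value. -/
def T (n : ℕ) : PolygonSpace n → PolygonSpace n :=
  Quotient.map
    (fun φ => if h : IsPolygon (pentagramVertex φ.vertex) then φ.pentagram h else φ)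
    (by
      intro φ ψ h
      by_cases hφ : IsPolygon (pentagramVertex φ.vertex)
      · have hψ := (pentagram_congr h).1 hφ
        obtain ⟨g, hg⟩ := h
        simp only [dif_pos hφ, dif_pos hψ]
        exact ⟨g, pentagramVertex_smul hg φ.isPolygon⟩
      · have hψ := fun hψ => hφ ((pentagram_congr h).2 hψ)
        simpa only [dif_neg hφ, dif_neg hψ] using h)

/-- The domain of the pentagram map as a partially defined self-map of the generic part. -/
def domT (n : ℕ) : Set (PolygonSpace n) :=
  {p | p ∈ generic n ∧ p ∈ pentagramDefined n ∧ T n p ∈ generic n}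

/-- Coordinates: `inl i` labels `x_i` and `inr i` labels `y_i`, with indices mod `n`. -/
abbrev Coord (n : ℕ) : Type := ZMod n ⊕ ZMod n → ℝ

open Classical in
/-- The corner invariants `(x_i, y_i)` of a class of twisted `n`-gons (with the junk value `0`
outside of the generic part). -/
def corner (n : ℕ) : PolygonSpace n → Coord n :=
  Quotient.lift
    (fun φ => if IsGenericPolygon φ.vertex then
      Sum.elim (fun i => leftCorner φ.vertex i.val) (fun i => rightCorner φ.vertex i.val) else 0)
    (by
      rintro φ ψ ⟨g, hg⟩
      by_cases hφ : IsGenericPolygon φ.vertex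
      · have hψ := (IsGenericPolygon.congr hg).2 hφ
        simp only [if_pos hφ, if_pos hψ]
        congr 1 <;> funext i
        · exact (corner_smul hg hφ _).1.symm
        · exact (corner_smul hg hφ _).2.symm
      · have hψ := fun hψ => hφ ((IsGenericPolygon.congr hg).1 hψ)
        simp only [if_neg hφ, if_neg hψ])

/-- The formula for the pentagram map in the corner invariants. -/
def pentagramCoord {n : ℕ} (z : Coord n) : Coord n :=
  let x : ZMod n → ℝ := fun i => z (.inl i)
  let y : ZMod n → ℝ := fun i => z (.inr i)
  Sum.elim
    (fun i => x i * (1 - x (i - 1) * y (i - 1)) / (1 - x (i + 1) * y (i + 1)))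
    (fun i => y (i + 1) * (1 - x (i + 2) * y (i + 2)) / (1 - x i * y i))

/-- The rescaling operation `R_t`. -/
def rescale {n : ℕ} (t : ℝ) (z : Coord n) : Coord n :=
  Sum.elim (fun i => t * z (.inl i)) (fun i => t⁻¹ * z (.inr i))

/-! ### The Poisson bracket -/

/-- The expression of a function on (the generic part of) `𝒫_n` in the corner invariants. -/
def coordRep {n : ℕ} (f : PolygonSpace n → ℝ) : Coord n → ℝ :=
  Function.extend (fun p : generic n => corner n p) (fun p : generic n => f p) 0

/-- Smooth functions on the generic part of `𝒫_n`. -/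
def IsSmooth {n : ℕ} [NeZero n] (f : PolygonSpace n → ℝ) : Prop :=
  ContDiffOn ℝ ∞ (coordRep f) (corner n '' generic n)

/-- The differential of a function at a point, in the corner invariants. -/
def differential {n : ℕ} [NeZero n] (f : PolygonSpace n → ℝ) (p : PolygonSpace n) :
    Coord n →L[ℝ] ℝ :=
  fderiv ℝ (coordRep f) (corner n p)

/-- The coefficients `c` of the bracket `{z_a, z_b} = c_{ab} z_a z_b` of coordinate functions:
`{x_i, x_{i±1}} = ∓ x_i x_{i±1}`, `{y_i, y_{i±1}} = ± y_i y_{i±1}`, all others zero. -/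
def bracketCoeff {n : ℕ} : ZMod n ⊕ ZMod n → ZMod n ⊕ ZMod n → ℝ
  | .inl i, .inl j => if j = i + 1 then -1 else if j = i - 1 then 1 else 0
  | .inr i, .inr j => if j = i + 1 then 1 else if j = i - 1 then -1 else 0
  | _, _ => 0

/-- The bracket `{f, g}`, the biderivation with the given values on coordinate functions. -/
def bracket {n : ℕ} [NeZero n] (f g : PolygonSpace n → ℝ) (p : PolygonSpace n) : ℝ :=
  ∑ a, ∑ b, bracketCoeff a b * corner n p a * corner n p b *
    differential f p (Pi.single a 1) * differential g p (Pi.single b 1)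

/-- The Poisson axioms for the bracket on smooth functions on the generic part. -/
structure IsPoissonBracket {n : ℕ} [NeZero n]
    (br : (PolygonSpace n → ℝ) → (PolygonSpace n → ℝ) → PolygonSpace n → ℝ) : Prop where
  smooth : ∀ f g, IsSmooth f → IsSmooth g → IsSmooth (br f g)
  add_left : ∀ f g h, IsSmooth f → IsSmooth g → IsSmooth h → ∀ p ∈ generic n,
    br (f + g) h p = br f h p + br g h p
  smul_left : ∀ (c : ℝ) f g, IsSmooth f → IsSmooth g → ∀ p ∈ generic n,
    br (c • f) g p = c * br f g p
  antisymm : ∀ f g, IsSmooth f → IsSmooth g → ∀ p ∈ generic n, br f g p = -br g f p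
  leibniz : ∀ f g h, IsSmooth f → IsSmooth g → IsSmooth h → ∀ p ∈ generic n,
    br (f * g) h p = f p * br g h p + g p * br f h p
  jacobi : ∀ f g h, IsSmooth f → IsSmooth g → IsSmooth h → ∀ p ∈ generic n,
    br f (br g h) p + br g (br h f) p + br h (br f g) p = 0

/-- Two functions Poisson commute. -/
def PoissonCommute {n : ℕ} [NeZero n] (f g : PolygonSpace n → ℝ) : Prop :=
  ∀ p ∈ generic n, bracket f g p = 0

/-- Casimir functions. -/
def IsCasimir {n : ℕ} [NeZero n] (f : PolygonSpace n → ℝ) : Prop :=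
  IsSmooth f ∧ ∀ g, IsSmooth g → PoissonCommute f g

/-- The tangent space at `p` to the symplectic leaf through `p`: the span of the values at `p`
of all Hamiltonian vector fields `{f, ·}`, in the corner invariants. -/
def leafTangent {n : ℕ} [NeZero n] (p : PolygonSpace n) : Submodule ℝ (Coord n) :=
  Submodule.span ℝ
    {w | ∃ f, IsSmooth f ∧ w = fun a => bracket f (fun q => corner n q a) p}

/-- The bracket has corank `c`: the symplectic leaves in the generic part have codimension `c`
in the `2n`-dimensional space. -/
def HasCorank (n : ℕ) [NeZero n] (c : ℕ) : Prop :=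
  ∀ p ∈ generic n, Module.finrank ℝ (leafTangent p) + c = 2 * n

/-- Invariance of a function under the pentagram map. -/
def IsInvariant {n : ℕ} (f : PolygonSpace n → ℝ) : Prop :=
  ∀ p ∈ domT n, f (T n p) = f p

/-- Arnold–Liouville integrability of the pentagram map by a family `F` of functions, for the
bracket of corank `c` on a space of dimension `2n`: the `F i` are smooth, `T`-invariant and
pairwise Poisson commuting, their differentials are linearly independent on an open dense subset,
exactly `c` of them are Casimirs, and the others are `(2n - c) / 2` in number, half the dimension
of the symplectic leaves. -/
structure IsArnoldLiouvilleIntegrable (n : ℕ) [NeZero n] (c : ℕ) {ι : Type}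
    (F : ι → PolygonSpace n → ℝ) : Prop where
  hasCorank : HasCorank n c
  smooth : ∀ i, IsSmooth (F i)
  invariant : ∀ i, IsInvariant (F i)
  commute : ∀ i j, PoissonCommute (F i) (F j)
  ncard_casimir : {i | IsCasimir (F i)}.ncard = c
  two_mul_ncard_add : 2 * {i | ¬ IsCasimir (F i)}.ncard + c = 2 * n
  isOpen_independent :
    IsOpen (corner n '' {p ∈ generic n | LinearIndependent ℝ fun i => differential (F i) p})
  dense_independent : corner n '' generic n ⊆
    closure (corner n '' {p ∈ generic n | LinearIndependent ℝ fun i => differential (F i) p})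

/-! ### The monodromy invariants -/

/-- Polynomials in the corner invariants. -/
abbrev CornerPoly (n : ℕ) : Type := MvPolynomial (ZMod n ⊕ ZMod n) ℝ

/-- The value of a polynomial in the corner invariants on classes of twisted polygons. -/
def CornerPoly.toFun {n : ℕ} (P : CornerPoly n) (p : PolygonSpace n) : ℝ :=
  MvPolynomial.eval (corner n p) P

/-- The coordinate polynomial `x_i`. -/
def xVar {n : ℕ} (i : ZMod n) : CornerPoly n := MvPolynomial.X (.inl i)

/-- The coordinate polynomial `y_i`. -/
def yVar {n : ℕ} (i : ZMod n) : CornerPoly n := MvPolynomial.X (.inr i)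

/-- The choice of the factors `X_i` (`i ∈ I`) and `x_j` (`j ∈ J`) is admissible: no two of the
chosen factors are consecutive. Here `X_i` and `X_j` are consecutive if
`j ∈ {i-2, i-1, i, i+1, i+2}`, `X_i` and `x_j` are consecutive if `j ∈ {i-1, i, i+1, i+2}`, and
`x_i` and `x_{i+1}` are consecutive, with indices mod `n`. -/
def Admissible {n : ℕ} (I J : Finset (ZMod n)) : Prop :=
  (∀ i ∈ I, ∀ j ∈ I, i ≠ j → j ≠ i - 2 ∧ j ≠ i - 1 ∧ j ≠ i + 1 ∧ j ≠ i + 2) ∧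
  (∀ i ∈ I, ∀ j ∈ J, j ≠ i - 1 ∧ j ≠ i ∧ j ≠ i + 1 ∧ j ≠ i + 2) ∧
  (∀ i ∈ J, i + 1 ∉ J)

open Classical in
/-- The sum of the signed admissible monomials `(-1)^t X_{i₁} ⋯ X_{iₛ} u_{j₁} ⋯ u_{jₜ}` of
weight `s + t = k`, for monomials `X_i` and variables `u_j`. -/
def admissibleSum {n : ℕ} [NeZero n] (X u : ZMod n → CornerPoly n) (k : ℕ) : CornerPoly n :=
  ∑ IJ : Finset (ZMod n) × Finset (ZMod n),
    if Admissible IJ.1 IJ.2 ∧ IJ.1.card + IJ.2.card = k then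
      (-1) ^ IJ.2.card * (∏ i ∈ IJ.1, X i) * ∏ j ∈ IJ.2, u j
    else 0

/-- The monodromy invariant `O_k`: for `k = n` the product of the `x_i`, otherwise the sum of
signed admissible monomials of weight `k` in `X_i = x_i y_i x_{i+1}` and `x_j`. -/
def O (n : ℕ) [NeZero n] (k : ℕ) : CornerPoly n :=
  if k = n then ∏ i, xVar i
  else admissibleSum (fun i => xVar i * yVar i * xVar (i + 1)) xVar k

/-- The monodromy invariant `E_k`: for `k = n` the product of the `y_i`, otherwise the sum of
signed admissible monomials of weight `k` in `Y_i = y_i x_{i+1} y_{i+1}` and `y_j`. -/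
def E (n : ℕ) [NeZero n] (k : ℕ) : CornerPoly n :=
  if k = n then ∏ i, yVar i
  else admissibleSum (fun i => yVar i * xVar (i + 1) * yVar (i + 1)) yVar k

/-- The indices `k ∈ {1, …, ⌊n/2⌋} ∪ {n}` of the monodromy invariants. -/
abbrev InvIndex (n : ℕ) : Type := {k : ℕ // (1 ≤ k ∧ k ≤ n / 2) ∨ k = n}

/-- The family of all monodromy invariants `O_k` and `E_k`. -/
def monodromyInvariant (n : ℕ) [NeZero n] : InvIndex n ⊕ InvIndex n → CornerPoly n :=
  Sum.elim (fun k => O n k) (fun k => E n k)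

end Pentagram

end

noncomputable section

namespace Pentagram

/-! ### Lifts of generic polygons to three-space -/

/-! Coordinates. The vertices of a generic polygon can be lifted to vectors with `V (i+2) = V (i+1)
- y_i V i + y_{i-1} x_i y_i V (i-1)`, and the parameters of this recurrence are the corner
invariants (`exists_normalized_lift`, `Normalized.corner`). A solution is determined by three
consecutive vectors, so equal parameters mean projectively equivalent polygons. If the parameters
are periodic, the shifted solution solves the same recurrence, and comparing the two gives a
monodromy. The vectors `V (i+1) + y_{i-1} x_i y_i V (i-1)` represent the pentagram image and satisfy
a recurrence of the same form (`Normalized.star`); this is the formula for `T`.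

Invariants. Up to scale and conjugation the monodromy is a product of `n` transfer matrices. Its
trace is a sum over closed walks on three states, and these walks are configurations of disjoint
arcs of length two and three on a cycle, that is, admissible choices (`trace_chain_transfer`). This
gives the `E_k`. Reversing the order of the vertices exchanges `x` with `y` and the monodromy with
its inverse, which gives the `O_k`. The map `T` keeps the monodromy and commutes with rescaling, and
rescaling separates the weights; so every single `O_k` and `E_k` is invariant.

Bracket. In logarithmic coordinates the bracket is a constant bilinear form. The Jacobi identity is
then symmetry of a Hessian, the kernel consists of 2-periodic sequences, and invariance under `T` is
a finite identity between logarithmic gradients (`logForm_pentagramLog`).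

Commutation. The substitution `x_i = P_i Q_{i+1}`, `y_i = P'_i Q'_{i+1}` makes the bracket
ultralocal: only variables at the same site interact. The generating functions of the `E_k` and of
the `O_k` become traces of products of matrices, each involving one site. An exchange relation at a
single site (`site_EE`, `site_EO`) passes to products, and a commutator has trace zero
(`IsBiderivation.commute_trace`).

Independence. The Gram determinant of the suitably normalized logarithmic gradients is a polynomial,
so it is enough to find one point where it does not vanish, and that point need not be generic. When
the coordinates of even index are set to zero, the cubic monomials disappear and the generating
functions become `∏ (1 - r x_i)` and `∏ (1 - r y_i)` over odd `i`; Lagrange interpolation settles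
this case. Independence on a dense open set, algebraic independence and the upper bound for the
number of Casimirs follow. -/

/-- A sequence of homogeneous vectors for a sequence of points. -/
def Represents (v : ℤ → Plane) (V : ℤ → Fin 3 → ℝ) : Prop :=
  ∀ i, ∃ h : V i ≠ 0, v i = .mk ℝ (V i) h

/-- Sequences of vectors satisfying the normalised recurrence with nonzero parameters `x`, `y`. -/
structure Normalized (V : ℤ → Fin 3 → ℝ) (x y : ℤ → ℝ) : Prop where
  x_ne : ∀ i, x i ≠ 0
  y_ne : ∀ i, y i ≠ 0
  recur : ∀ i, V (i + 2) = V (i + 1) - y i • V i + (y (i - 1) * x i * y i) • V (i - 1)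
  independent : ∀ i, V (i - 2) ⬝ᵥ (V (i - 1) ⨯₃ V i) ≠ 0

theorem meet_eq_mk {a b c d P : Fin 3 → ℝ} (ha : a ≠ 0) (hb : b ≠ 0) (hc : c ≠ 0) (hd : d ≠ 0)
    (hP : P ≠ 0) {k : ℝ} (hk : k ≠ 0) (h : (a ⨯₃ b) ⨯₃ (c ⨯₃ d) = k • P) :
    meet (.mk ℝ a ha) (.mk ℝ b hb) (.mk ℝ c hc) (.mk ℝ d hd) = .mk ℝ P hP := by
  have h0 : (a ⨯₃ b) ⨯₃ (c ⨯₃ d) ≠ 0 := by rw [h]; exact smul_ne_zero hk hP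
  rw [meet_mk ha hb hc hd (fun h1 => h0 (by simp [h1])) (fun h1 => h0 (by simp [h1])) h0,
    Projectivization.mk_eq_mk_iff]
  exact ⟨Units.mk0 k hk, by rw [h]; rfl⟩

theorem vecCrossRatio_comb {u w : Fin 3 → ℝ} (hN : u ⨯₃ w ≠ 0) (a b : Fin 4 → ℝ) :
    vecCrossRatio (a 0 • u + b 0 • w) (a 1 • u + b 1 • w) (a 2 • u + b 2 • w)
      (a 3 • u + b 3 • w) =
    ((a 0 * b 1 - b 0 * a 1) * (a 2 * b 3 - b 2 * a 3)) /
      ((a 0 * b 2 - b 0 * a 2) * (a 1 * b 3 - b 1 * a 3)) := by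
  have hN' : (u ⨯₃ w) ⬝ᵥ (u ⨯₃ w) ≠ 0 := fun h0 => hN (dotProduct_self_eq_zero.1 h0)
  have key : ∀ s r s' r' : ℝ,
      (s • u + r • w) ⨯₃ (s' • u + r' • w) = (s * r' - r * s') • (u ⨯₃ w) := by
    intro s r s' r'
    have : w ⨯₃ u = - (u ⨯₃ w) := (cross_anticomm u w).symm
    simp only [map_add, map_smul, LinearMap.add_apply, LinearMap.smul_apply, cross_self, this]
    module
  rw [vecCrossRatio]
  simp only [key, smul_dotProduct, dotProduct_smul, smul_eq_mul, ← mul_assoc]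
  rw [mul_div_mul_right _ _ hN']
  congr 1 <;> ring

theorem comb_ne_zero {u w : Fin 3 → ℝ} (hN : u ⨯₃ w ≠ 0) {a b : ℝ} (h : a ≠ 0 ∨ b ≠ 0) :
    a • u + b • w ≠ 0 := by
  have hl := crossProduct_ne_zero_iff_linearIndependent.1 hN
  rw [LinearIndependent.pair_iff] at hl
  intro h0
  have := hl a b h0
  tauto

/-- The basis is adapted to one of the two lines: eliminating `C` from the two vectors spanning the
other line leaves the intersection point, expressed on the line `AB`. -/
theorem cross_cross_comb (A B C : Fin 3 → ℝ) (p q r p' q' r' : ℝ) :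
    (A ⨯₃ B) ⨯₃ ((p • A + q • B + r • C) ⨯₃ (p' • A + q' • B + r' • C)) =
      (A ⬝ᵥ (B ⨯₃ C)) • ((r' * p - r * p') • A + (r' * q - r * q') • B) := by
  have hA : A ⬝ᵥ ((p • A + q • B + r • C) ⨯₃ (p' • A + q' • B + r' • C)) =
      (q * r' - r * q') * (A ⬝ᵥ (B ⨯₃ C)) := by
    simp [crossProduct, dotProduct, Fin.sum_univ_three]
    ring
  have hB : B ⬝ᵥ ((p • A + q • B + r • C) ⨯₃ (p' • A + q' • B + r' • C)) =
      - (p * r' - r * p') * (A ⬝ᵥ (B ⨯₃ C)) := by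
    simp [crossProduct, dotProduct, Fin.sum_univ_three]
    ring
  rw [cross_cross_eq_smul_sub_smul, hA, hB]
  module

theorem triple_left (A B C : Fin 3 → ℝ) (p q r : ℝ) :
    (A ⬝ᵥ (B ⨯₃ (p • A + q • B + r • C)) = r * (A ⬝ᵥ (B ⨯₃ C))) ∧
    (A ⬝ᵥ (C ⨯₃ (p • A + q • B + r • C)) = - q * (A ⬝ᵥ (B ⨯₃ C))) ∧
    (B ⬝ᵥ (C ⨯₃ (p • A + q • B + r • C)) = p * (A ⬝ᵥ (B ⨯₃ C))) := by
  refine ⟨?_, ?_, ?_⟩ <;> simp [crossProduct, dotProduct, Fin.sum_univ_three] <;> ring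

theorem cramer_three (A B C D : Fin 3 → ℝ) :
    (A ⬝ᵥ (B ⨯₃ C)) • D = (B ⬝ᵥ (C ⨯₃ D)) • A - (A ⬝ᵥ (C ⨯₃ D)) • B + (A ⬝ᵥ (B ⨯₃ D)) • C := by
  ext i
  fin_cases i <;> simp [crossProduct, dotProduct, Fin.sum_univ_three] <;> ring

/-- The recurrence makes every point explicit. On the line `AB` one has `P_i = Y A - y B` and `Q_i =
Y A - y (1 - x) B`; on the line `DE` one has `Q_i = (1 - 1/y') D + (1/y') E` and `P_{i+1} = E - D`.
The cross-ratios are read off from these coordinates. -/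
theorem leftCorner_of_vectors {v : ℤ → Plane} {i : ℤ} {A B C D E : Fin 3 → ℝ}
    {hA : A ≠ 0} {hB : B ≠ 0} {hC : C ≠ 0} {hD : D ≠ 0} {hE : E ≠ 0}
    (vA : v (i - 2) = .mk ℝ A hA) (vB : v (i - 1) = .mk ℝ B hB) (vC : v i = .mk ℝ C hC)
    (vD : v (i + 1) = .mk ℝ D hD) (vE : v (i + 2) = .mk ℝ E hE)
    {Y y x y' : ℝ} (hY : Y ≠ 0) (hy : y ≠ 0) (hy' : y' ≠ 0)
    (eD : D = C - y • B + Y • A) (eE : E = D - y' • C + (y * x * y') • B)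
    (h : A ⬝ᵥ (B ⨯₃ C) ≠ 0) :
    leftCorner v i = x ∧ rightCorner v i = y' := by
  have hAB : A ⨯₃ B ≠ 0 := cross_mk_ne_zero h
  have eC' : C = (0 : ℝ) • A + (0 : ℝ) • B + (1 : ℝ) • C := by module
  have eD' : D = Y • A + (-y) • B + (1 : ℝ) • C := by rw [eD]; module
  have eE' : E = Y • A + (-y + y * x * y') • B + (1 - y') • C := by rw [eE, eD]; module
  have hCD : (A ⨯₃ B) ⨯₃ (C ⨯₃ D) = (-(A ⬝ᵥ (B ⨯₃ C))) • (Y • A + (-y) • B) := by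
    rw [eD']
    conv_lhs => enter [2, 1, 2]; rw [eC']
    rw [cross_cross_comb]
    module
  have hDE' : (A ⨯₃ B) ⨯₃ (D ⨯₃ E) =
      (- y' * (A ⬝ᵥ (B ⨯₃ C))) • (Y • A + (-(y * (1 - x))) • B) := by
    rw [eE', eD', cross_cross_comb]
    module
  have hBC : (B ⨯₃ C) ⨯₃ (D ⨯₃ E) = (-Y * (A ⬝ᵥ (B ⨯₃ C))) • ((-1 : ℝ) • D + (1 : ℝ) • E) := by
    have e1 : D = (-y) • B + (1 : ℝ) • C + Y • A := by rw [eD']; module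
    have e2 : E = (-y + y * x * y') • B + (1 - y') • C + Y • A := by rw [eE']; module
    rw [e2, e1, cross_cross_comb, ← triple_product_permutation]
    module
  have hP : Y • A + (-y) • B ≠ 0 := comb_ne_zero hAB (.inl hY)
  have hQ : Y • A + (-(y * (1 - x))) • B ≠ 0 := comb_ne_zero hAB (.inl hY)
  have hDE : D ⨯₃ E ≠ 0 := by
    intro h0
    rw [h0, map_zero] at hDE'
    exact smul_ne_zero (mul_ne_zero (neg_ne_zero.2 hy') h) hQ hDE'.symm
  have mP : meet (v (i - 2)) (v (i - 1)) (v i) (v (i + 1)) = .mk ℝ _ hP := by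
    rw [vA, vB, vC, vD]
    exact meet_eq_mk _ _ _ _ hP (neg_ne_zero.2 h) hCD
  have mQ : meet (v (i - 2)) (v (i - 1)) (v (i + 1)) (v (i + 2)) = .mk ℝ _ hQ := by
    rw [vA, vB, vD, vE]
    exact meet_eq_mk _ _ _ _ hQ (mul_ne_zero (neg_ne_zero.2 hy') h) hDE'
  have hQ' : (1 - 1 / y') • D + (1 / y') • E ≠ 0 := comb_ne_zero hDE (.inr (by simp [hy']))
  -- The point `Q_i` lies on both lines; one vector representing it is expressed in either basis.
  have eQ : Y • A + (-(y * (1 - x))) • B = (1 - 1 / y') • D + (1 / y') • E := by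
    rw [eE, eD]
    match_scalars <;> field_simp <;> ring
  have hP' : (-1 : ℝ) • D + (1 : ℝ) • E ≠ 0 := comb_ne_zero hDE (.inr one_ne_zero)
  have mP' : meet (v (i - 1)) (v i) (v (i + 1)) (v (i + 2)) = .mk ℝ _ hP' := by
    rw [vB, vC, vD, vE]
    exact meet_eq_mk _ _ _ _ hP' (mul_ne_zero (neg_ne_zero.2 hY) h) hBC
  have kD : (1 : ℝ) • D + (0 : ℝ) • E = D := by simp
  have kE : (0 : ℝ) • D + (1 : ℝ) • E = E := by simp
  have kA : (1 : ℝ) • A + (0 : ℝ) • B = A := by simp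
  have kB : (0 : ℝ) • A + (1 : ℝ) • B = B := by simp
  constructor
  · rw [leftCorner, mP, mQ, vA, vB, crossRatio_mk]
    have := vecCrossRatio_comb hAB ![1, 0, Y, Y] ![0, 1, -y, -(y * (1 - x))]
    simp only [Matrix.cons_val, kA, kB] at this
    rw [this, div_eq_iff]
    · ring
    · simp [hy, hY]
  · have mQ2 : (Projectivization.mk ℝ _ hQ) = .mk ℝ _ hQ' := by congr 1
    rw [rightCorner, mP', mQ, mQ2, vD, vE, crossRatio_mk]
    have := vecCrossRatio_comb hDE ![1 - 1 / y', -1, 1, 0] ![1 / y', 1, 0, 1]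
    simp only [Matrix.cons_val, kD, kE] at this
    rw [this, div_eq_iff]
    · field_simp
      ring
    · simp [hy']

theorem Normalized.recur' {V : ℤ → Fin 3 → ℝ} {x y : ℤ → ℝ} (h : Normalized V x y) (i : ℤ) :
    V (i + 1) = V i - y (i - 1) • V (i - 1) + (y (i - 2) * x (i - 1) * y (i - 1)) • V (i - 2) := by
  have := h.recur (i - 1)
  rwa [show i - 1 + 2 = i + 1 by ring, show i - 1 + 1 = i by ring,
    show i - 1 - 1 = i - 2 by ring] at this

theorem Normalized.corner {V : ℤ → Fin 3 → ℝ} {x y : ℤ → ℝ} (h : Normalized V x y)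
    {v : ℤ → Plane} (hv : Represents v V) (i : ℤ) :
    leftCorner v i = x i ∧ rightCorner v i = y i := by
  obtain ⟨_, h1⟩ := hv (i - 2)
  obtain ⟨_, h2⟩ := hv (i - 1)
  obtain ⟨_, h3⟩ := hv i
  obtain ⟨_, h4⟩ := hv (i + 1)
  obtain ⟨_, h5⟩ := hv (i + 2)
  refine leftCorner_of_vectors h1 h2 h3 h4 h5 (Y := y (i - 2) * x (i - 1) * y (i - 1))
    (y := y (i - 1)) ?_ (h.y_ne _) (h.y_ne _) (h.recur' i) (h.recur i)
    (h.independent i)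
  simp [h.x_ne, h.y_ne]

theorem Normalized.ne_zero {V : ℤ → Fin 3 → ℝ} {x y : ℤ → ℝ} (h : Normalized V x y) (i : ℤ) :
    V i ≠ 0 := by
  have := h.independent i
  intro h0
  exact this (by simp [h0])

theorem Normalized.represents {V : ℤ → Fin 3 → ℝ} {x y : ℤ → ℝ} (h : Normalized V x y) :
    Represents (fun i => .mk ℝ (V i) (h.ne_zero i)) V :=
  fun i => ⟨h.ne_zero i, rfl⟩

theorem Represents.generalPosition {v : ℤ → Plane} {V : ℤ → Fin 3 → ℝ} (hv : Represents v V)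
    (i j k : ℤ) : GeneralPosition (v i) (v j) (v k) ↔ V i ⬝ᵥ (V j ⨯₃ V k) ≠ 0 := by
  obtain ⟨_, h1⟩ := hv i
  obtain ⟨_, h2⟩ := hv j
  obtain ⟨_, h3⟩ := hv k
  rw [h1, h2, h3, generalPosition_mk]

theorem Normalized.isGeneric {V : ℤ → Fin 3 → ℝ} {x y : ℤ → ℝ} (h : Normalized V x y)
    {v : ℤ → Plane} (hv : Represents v V) : IsGenericPolygon v := by
  intro i
  simp only [hv.generalPosition]
  have h1 := h.independent (i + 2)
  have h2 := h.recur' (i + 2)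
  rw [show i + 2 - 2 = i by ring, show i + 2 - 1 = i + 1 by ring] at h1 h2
  rw [show i + 2 + 1 = i + 3 by ring] at h2
  obtain ⟨t1, t2, t3⟩ := triple_left (V i) (V (i + 1)) (V (i + 2)) (y i * x (i + 1) * y (i + 1))
    (-y (i + 1)) 1
  have e : V (i + 3) = (y i * x (i + 1) * y (i + 1)) • V i + (-y (i + 1)) • V (i + 1) +
    (1 : ℝ) • V (i + 2) := by rw [h2]; module
  rw [← e] at t1 t2 t3
  rw [t1, t2, t3]
  simp [h1, h.x_ne, h.y_ne]

theorem Normalized.isPolygon {V : ℤ → Fin 3 → ℝ} {x y : ℤ → ℝ} (h : Normalized V x y)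
    {v : ℤ → Plane} (hv : Represents v V) : IsPolygon v := by
  intro i
  have := (h.isGeneric hv (i - 1)).1
  rwa [show i - 1 + 1 = i by ring, show i - 1 + 2 = i + 1 by ring] at this

/-- A two-sided sequence in a group with prescribed quotients of consecutive terms. -/
theorem exists_int_seq {G : Type*} [Group G] (g : ℤ → G) :
    ∃ W : ℤ → G, W 0 = 1 ∧ ∀ i, W (i + 1) = W i * g i := by
  let a : ℕ → G := fun k => Nat.rec 1 (fun j w => w * g j) k
  let b : ℕ → G := fun k => Nat.rec 1 (fun j w => w * (g (-(j + 1 : ℕ)))⁻¹) k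
  refine ⟨fun i => match i with
    | .ofNat k => a k
    | .negSucc k => b (k + 1), rfl, ?_⟩
  intro i
  match i with
  | .ofNat k => rfl
  | .negSucc 0 =>
    change (1 : G) = 1 * (g (-(0 + 1 : ℕ)))⁻¹ * g (Int.negSucc 0)
    simp
  | .negSucc (k + 1) =>
    change b (k + 1) = b (k + 1) * (g (-(k + 1 + 1 : ℕ)))⁻¹ * g (Int.negSucc (k + 1))
    have : (Int.negSucc (k + 1)) = (-(k + 1 + 1 : ℕ)) := rfl
    rw [this, inv_mul_cancel_right]

/-- Genericity makes all three coefficients of a vector in terms of its three predecessors nonzero.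
The free scale at each vertex is spent on turning the leading coefficient into `1`; the two
remaining coefficients define `y` and then `x`. No periodicity enters. -/
theorem exists_normalized_lift {v : ℤ → Plane} (hv : IsGenericPolygon v) :
    ∃ V x y, Normalized V x y ∧ Represents v V := by
  let U : ℤ → Fin 3 → ℝ := fun i => (v i).rep
  have hU : Represents v U := fun i => ⟨(v i).rep_nonzero, (v i).mk_rep.symm⟩
  have hg := hv
  simp only [IsGenericPolygon, hU.generalPosition] at hg
  have hrec : ∀ i, ∃ a b c : ℝ, a ≠ 0 ∧ b ≠ 0 ∧ c ≠ 0 ∧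
      U (i + 2) = a • U (i + 1) + b • U i + c • U (i - 1) := by
    intro i
    obtain ⟨h1, h2, h3, h4⟩ := hg (i - 1)
    rw [show i - 1 + 1 = i by ring, show i - 1 + 2 = i + 1 by ring,
      show i - 1 + 3 = i + 2 by ring] at *
    have key := cramer_three (U (i - 1)) (U i) (U (i + 1)) (U (i + 2))
    set d := U (i - 1) ⬝ᵥ (U i ⨯₃ U (i + 1))
    refine ⟨d⁻¹ * (U (i - 1) ⬝ᵥ (U i ⨯₃ U (i + 2))),
      - (d⁻¹ * (U (i - 1) ⬝ᵥ (U (i + 1) ⨯₃ U (i + 2)))),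
      d⁻¹ * (U i ⬝ᵥ (U (i + 1) ⨯₃ U (i + 2))), mul_ne_zero (inv_ne_zero h1) h2,
      neg_ne_zero.2 (mul_ne_zero (inv_ne_zero h1) h3), mul_ne_zero (inv_ne_zero h1) h4, ?_⟩
    have e : U (i + 2) = d⁻¹ • (d • U (i + 2)) := (inv_smul_smul₀ h1 _).symm
    rw [key] at e
    refine e.trans ?_
    module
  choose a b c ha hb hc hrec using hrec
  -- The leading coefficient becomes `1` when `l (i+2) * a i = l (i+1)`, which prescribes the
  -- quotients of consecutive scale factors; hence the shift to `a (i - 1)`.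
  obtain ⟨l, -, hl⟩ := exists_int_seq (fun i => (Units.mk0 (a (i - 1)) (ha _))⁻¹)
  have hl' : ∀ i, (l (i + 2) : ℝ) * a i = l (i + 1) := by
    intro i
    have := hl (i + 1)
    rw [show i + 1 + 1 = i + 2 by ring, show i + 1 - 1 = i by ring] at this
    rw [this]
    simp [ha]
  have hl0 : ∀ i, (l i : ℝ) ≠ 0 := fun i => (l i).ne_zero
  let y : ℤ → ℝ := fun i => - (l (i + 2) * b i / l i)
  have hy : ∀ i, y i ≠ 0 := fun i => by simp [y, hb, hl0]
  let x : ℤ → ℝ := fun i => l (i + 2) * c i / l (i - 1) / (y (i - 1) * y i)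
  refine ⟨fun i => (l i : ℝ) • U i, x, y, ⟨?_, hy, ?_, ?_⟩, ?_⟩
  · intro i
    simp [x, hy, hl0, hc]
  · intro i
    have e : y (i - 1) * x i * y i = l (i + 2) * c i / l (i - 1) := by
      have := hy i
      have := hy (i - 1)
      simp only [x]
      field_simp
    simp only [e]
    rw [hrec i, ← hl' i]
    simp only [y]
    match_scalars
    · ring
    · have := hl0 i
      field_simp
    · have := hl0 (i - 1)
      field_simp
  · intro i
    have := (hg (i - 2)).1
    rw [show i - 2 + 1 = i - 1 by ring, show i - 2 + 2 = i by ring] at this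
    simp [hl0, this]
  · intro i
    refine ⟨smul_ne_zero (hl0 i) (v i).rep_nonzero, ?_⟩
    conv_lhs => rw [← (v i).mk_rep]
    rw [Projectivization.mk_eq_mk_iff]
    exact ⟨(l i)⁻¹, by simp [U, Units.smul_def, smul_smul]⟩

/-! ### Transfer matrices, and existence and uniqueness of normalized sequences. -/

/-- The transfer matrix of the normalised recurrence. -/
def transfer {R : Type*} [CommRing R] (f g : R) : Matrix (Fin 3) (Fin 3) R :=
  !![1, 1, 0; f, 0, 1; g, 0, 0]

theorem det_transfer {R : Type*} [CommRing R] (f g : R) : (transfer f g).det = g := by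
  simp [transfer, Matrix.det_fin_three]

/-- The matrix with columns `V i`, `V (i - 1)`, `V (i - 2)`. -/
def frame (V : ℤ → Fin 3 → ℝ) (i : ℤ) : Matrix (Fin 3) (Fin 3) ℝ :=
  (Matrix.of ![V i, V (i - 1), V (i - 2)])ᵀ

/-- The recurrence acts on frames from the right and linear maps act from the left, so the two
commute. Uniqueness of solutions and the computation of the monodromy both rest on this. -/
theorem Normalized.frame_succ {V : ℤ → Fin 3 → ℝ} {x y : ℤ → ℝ} (h : Normalized V x y) (i : ℤ) :
    frame V (i + 1) =
      frame V i * transfer (-y (i - 1)) (y (i - 2) * x (i - 1) * y (i - 1)) := by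
  ext a b
  have e1 : i + 1 - 1 = i := by ring
  have e2 : i + 1 - 2 = i - 1 := by ring
  fin_cases b <;>
    simp [frame, transfer, Matrix.mul_apply, Fin.sum_univ_three, h.recur' i, e1, e2]
  ring

theorem Normalized.det_frame_ne_zero {V : ℤ → Fin 3 → ℝ} {x y : ℤ → ℝ} (h : Normalized V x y)
    (i : ℤ) : (frame V i).det ≠ 0 := by
  have e : (frame V i).det = - (V (i - 2) ⬝ᵥ (V (i - 1) ⨯₃ V i)) := by
    simp [frame, Matrix.det_fin_three, crossProduct, dotProduct, Fin.sum_univ_three]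
    ring
  rw [e]
  exact neg_ne_zero.2 (h.independent i)

/-- A two-sided product of transfer matrices in the general linear group has the solution as its
first column; the other two columns are the two preceding values, so independence is invertibility
of the product. -/
theorem exists_normalized {x y : ℤ → ℝ} (hx : ∀ i, x i ≠ 0) (hy : ∀ i, y i ≠ 0) :
    ∃ V, Normalized V x y := by
  let C : ℤ → Matrix (Fin 3) (Fin 3) ℝ := fun i =>
    transfer (-y (i - 1)) (y (i - 2) * x (i - 1) * y (i - 1))
  have hC : ∀ i, (C i).det ≠ 0 := by
    intro i
    simp only [C, det_transfer]
    simp [hx, hy]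
  obtain ⟨W, -, hW⟩ := exists_int_seq
    (fun i => Matrix.GeneralLinearGroup.mkOfDetNeZero (C i) (hC i))
  have hW' : ∀ i a b, (W (i + 1)).val a b = ∑ j, (W i).val a j * C i j b := by
    intro i a b
    rw [hW i]
    rfl
  simp only [Fin.sum_univ_three, C, transfer] at hW'
  have h1 : ∀ i a, (W (i + 1)).val a 1 = (W i).val a 0 := fun i a => by simp [hW']
  have h2 : ∀ i a, (W (i + 1)).val a 2 = (W i).val a 1 := fun i a => by simp [hW']
  have h0 : ∀ i a, (W (i + 1)).val a 0 = (W i).val a 0 - y (i - 1) * (W i).val a 1 +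
      y (i - 2) * x (i - 1) * y (i - 1) * (W i).val a 2 := fun i a => by simp [hW']; ring
  have k1 : ∀ i a, (W i).val a 1 = (W (i - 1)).val a 0 := fun i a => by
    rw [← h1, sub_add_cancel]
  have k2 : ∀ i a, (W i).val a 2 = (W (i - 2)).val a 0 := fun i a => by
    rw [← h1, ← h2]
    ring_nf
  refine ⟨fun i a => (W i).val a 0, hx, hy, ?_, ?_⟩
  · intro i
    ext a
    have := h0 (i + 1) a
    rw [k1, k2, show i + 1 + 1 = i + 2 by ring, show i + 1 - 1 = i by ring,
      show i + 1 - 2 = i - 1 by ring] at this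
    simp only [Pi.add_apply, Pi.sub_apply, Pi.smul_apply, smul_eq_mul, this]
  · intro i
    have hd := det_ne_zero (W i)
    rw [Matrix.det_fin_three] at hd
    simp only [k1, k2] at hd
    simp only [crossProduct, dotProduct, Fin.sum_univ_three]
    intro h
    apply hd
    simp at h
    linear_combination -h

/-- The linear map matching the frames at `0` matches them at every index, forwards by multiplying
and backwards by cancelling an invertible transfer matrix. -/
theorem Normalized.exists_smul {V V' : ℤ → Fin 3 → ℝ} {x y : ℤ → ℝ} (h : Normalized V x y)
    (h' : Normalized V' x y) :
    ∃ g : GL (Fin 3) ℝ, ∀ i, frame V' i = g.val * frame V i := by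
  have hu : IsUnit (frame V 0).det := isUnit_iff_ne_zero.2 (h.det_frame_ne_zero 0)
  refine ⟨Matrix.GeneralLinearGroup.mkOfDetNeZero (frame V' 0 * (frame V 0)⁻¹) ?_, ?_⟩
  · rw [Matrix.det_mul, Matrix.det_nonsing_inv]
    exact mul_ne_zero (h'.det_frame_ne_zero 0)
      (by rw [Ring.inverse_eq_inv']; exact inv_ne_zero (h.det_frame_ne_zero 0))
  · intro i
    change _ = frame V' 0 * (frame V 0)⁻¹ * _
    induction i using Int.induction_on with
    | zero => rw [Matrix.mul_assoc, Matrix.nonsing_inv_mul _ hu, Matrix.mul_one]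
    | succ k ih => rw [h.frame_succ, h'.frame_succ, ih, Matrix.mul_assoc _ _ (transfer _ _)]
    | pred k ih =>
      have e1 := h.frame_succ (-k - 1)
      have e2 := h'.frame_succ (-k - 1)
      rw [sub_add_cancel] at e1 e2
      rw [e1, e2, ← Matrix.mul_assoc] at ih
      refine (Matrix.isUnit_iff_isUnit_det _).2 ?_ |>.mul_right_cancel ih
      rw [det_transfer, isUnit_iff_ne_zero]
      simp [h.x_ne, h.y_ne]

theorem frame_mulVec {V V' : ℤ → Fin 3 → ℝ} {g : Matrix (Fin 3) (Fin 3) ℝ} {i : ℤ}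
    (h : frame V' i = g * frame V i) : V' i = g *ᵥ V i := by
  ext a
  have := congrFun (congrFun h a) 0
  simpa [frame, Matrix.mul_apply, Matrix.mulVec, dotProduct] using this

/-! ### Corner invariants as coordinates -/

/-- The `n`-periodic sequence of the `x`-coordinates. -/
def xs {n : ℕ} (z : Coord n) (i : ℤ) : ℝ := z (.inl (i : ZMod n))

/-- The `n`-periodic sequence of the `y`-coordinates. -/
def ys {n : ℕ} (z : Coord n) (i : ℤ) : ℝ := z (.inr (i : ZMod n))

/-- The coordinates of a class are sampled at representatives in `{0, …, n - 1}`; this allows any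
integer index in their place. -/
theorem periodic_val {α : Type*} {n : ℕ} [NeZero n] {f : ℤ → α} (hf : ∀ i, f (i + n) = f i)
    (i : ℤ) : f ((i : ZMod n).val : ℤ) = f i := by
  have hp : Function.Periodic f (n : ℤ) := hf
  rw [ZMod.val_intCast]
  conv_rhs => rw [← Int.emod_add_mul_ediv i n]
  rw [mul_comm]
  exact (hp.int_mul _ _).symm

theorem corner_toSpace {n : ℕ} [NeZero n] {φ : TwistedPolygon n} (h : IsGenericPolygon φ.vertex)
    (i : ℤ) : xs (corner n φ.toSpace) i = leftCorner φ.vertex i ∧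
      ys (corner n φ.toSpace) i = rightCorner φ.vertex i := by
  have e : corner n φ.toSpace = Sum.elim (fun i => leftCorner φ.vertex i.val)
      (fun i => rightCorner φ.vertex i.val) := if_pos h
  rw [xs, ys, e]
  exact ⟨periodic_val (fun i => (φ.corner_periodic h i).1) i,
    periodic_val (fun i => (φ.corner_periodic h i).2) i⟩

theorem coord_ext {n : ℕ} [NeZero n] {z w : Coord n} (hx : ∀ i, xs z i = xs w i)
    (hy : ∀ i, ys z i = ys w i) : z = w := by
  ext a
  rcases a with i | i
  · simpa [xs] using hx i.val
  · simpa [ys] using hy i.val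

theorem coord_ne_zero_iff {n : ℕ} [NeZero n] {z : Coord n} :
    (∀ a, z a ≠ 0) ↔ (∀ i, xs z i ≠ 0) ∧ ∀ i, ys z i ≠ 0 := by
  refine ⟨fun h => ⟨fun i => h _, fun i => h _⟩, fun h a => ?_⟩
  rcases a with i | i
  · simpa [xs] using h.1 i.val
  · simpa [ys] using h.2 i.val

theorem exists_lift {n : ℕ} [NeZero n] {φ : TwistedPolygon n} (h : IsGenericPolygon φ.vertex) :
    ∃ V, Normalized V (xs (corner n φ.toSpace)) (ys (corner n φ.toSpace)) ∧
      Represents φ.vertex V := by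
  obtain ⟨V, x, y, hV, hr⟩ := exists_normalized_lift h
  have hx : xs (corner n φ.toSpace) = x := by
    ext i; rw [(corner_toSpace h i).1, (hV.corner hr i).1]
  have hy : ys (corner n φ.toSpace) = y := by
    ext i; rw [(corner_toSpace h i).2, (hV.corner hr i).2]
  exact ⟨V, by rwa [hx, hy], hr⟩

theorem corner_eq_of_normalized {n : ℕ} [NeZero n] {φ : TwistedPolygon n} {V : ℤ → Fin 3 → ℝ}
    {z : Coord n} (hV : Normalized V (xs z) (ys z)) (hr : Represents φ.vertex V) :
    corner n φ.toSpace = z := by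
  have h := hV.isGeneric hr
  refine coord_ext (fun i => ?_) (fun i => ?_)
  · rw [(corner_toSpace h i).1, (hV.corner hr i).1]
  · rw [(corner_toSpace h i).2, (hV.corner hr i).2]

theorem Represents.smul {v v' : ℤ → Plane} {V V' : ℤ → Fin 3 → ℝ} (h : Represents v V)
    (h' : Represents v' V') {g : GL (Fin 3) ℝ} (hg : ∀ i, V' i = g.val *ᵥ V i) (i : ℤ) :
    v' i = (Matrix.ProjGenLinGroup.mk g : PGL(3, ℝ)) • v i := by
  obtain ⟨h0, h1⟩ := h i
  obtain ⟨h0', h1'⟩ := h' i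
  rw [h1, h1', mk_smul_mk]
  congr 1
  exact hg i

theorem Normalized.shift {V : ℤ → Fin 3 → ℝ} {x y : ℤ → ℝ} (h : Normalized V x y) (k : ℤ) :
    Normalized (fun i => V (i + k)) (fun i => x (i + k)) (fun i => y (i + k)) where
  x_ne _ := h.x_ne _
  y_ne _ := h.y_ne _
  recur i := by
    have := h.recur (i + k)
    simpa only [add_right_comm, sub_add_eq_add_sub] using this
  independent i := by
    have := h.independent (i + k)
    simpa only [sub_add_eq_add_sub] using this

theorem xs_add {n : ℕ} (z : Coord n) (i : ℤ) : xs z (i + n) = xs z i := by simp [xs]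

theorem ys_add {n : ℕ} (z : Coord n) (i : ℤ) : ys z (i + n) = ys z i := by simp [ys]

theorem Normalized.shift_period {n : ℕ} {V : ℤ → Fin 3 → ℝ} {z : Coord n}
    (h : Normalized V (xs z) (ys z)) : Normalized (fun i => V (i + n)) (xs z) (ys z) := by
  simpa only [xs_add, ys_add] using h.shift n

/-- Periodic parameters make the sequence shifted by `n` a second solution of the same recurrence;
the linear map relating the two is a monodromy. -/
theorem exists_polygon {n : ℕ} [NeZero n] {z : Coord n} (hz : ∀ a, z a ≠ 0) :
    ∃ (φ : TwistedPolygon n) (V : ℤ → Fin 3 → ℝ),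
      Normalized V (xs z) (ys z) ∧ Represents φ.vertex V := by
  obtain ⟨V, hV⟩ := exists_normalized (coord_ne_zero_iff.1 hz).1 (coord_ne_zero_iff.1 hz).2
  obtain ⟨g, hg⟩ := hV.exists_smul hV.shift_period
  refine ⟨⟨fun i => .mk ℝ (V i) (hV.ne_zero i), ⟨Matrix.ProjGenLinGroup.mk g, ?_⟩,
    hV.isPolygon hV.represents⟩, V, hV, hV.represents⟩
  exact hV.represents.smul hV.shift_period.represents (fun i => frame_mulVec (hg i))

theorem corner_injOn (n : ℕ) [NeZero n] : Set.InjOn (corner n) (generic n) := by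
  intro p hp q hq h
  induction p using Quotient.inductionOn with | h φ => ?_
  induction q using Quotient.inductionOn with | h ψ => ?_
  obtain ⟨V, hV, hr⟩ := exists_lift (φ := φ) hp
  obtain ⟨V', hV', hr'⟩ := exists_lift (φ := ψ) hq
  change corner n φ.toSpace = corner n ψ.toSpace at h
  rw [← h] at hV'
  obtain ⟨g, hg⟩ := hV.exists_smul hV'
  exact Quotient.sound ⟨_, hr.smul hr' (fun i => frame_mulVec (hg i))⟩

theorem corner_ne_zero {n : ℕ} [NeZero n] {p : PolygonSpace n} (hp : p ∈ generic n)
    (a : ZMod n ⊕ ZMod n) : corner n p a ≠ 0 := by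
  induction p using Quotient.inductionOn with | h φ => ?_
  obtain ⟨V, hV, hr⟩ := exists_lift (φ := φ) hp
  exact coord_ne_zero_iff.2 ⟨hV.x_ne, hV.y_ne⟩ a

theorem exists_generic {n : ℕ} [NeZero n] {z : Coord n} (hz : ∀ a, z a ≠ 0) :
    ∃ p ∈ generic n, corner n p = z := by
  obtain ⟨φ, V, hV, hr⟩ := exists_polygon hz
  exact ⟨φ.toSpace, hV.isGeneric hr, corner_eq_of_normalized hV hr⟩

theorem corner_image (n : ℕ) [NeZero n] : corner n '' generic n = {z | ∀ a, z a ≠ 0} := by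
  ext z
  constructor
  · rintro ⟨p, hp, rfl⟩
    exact corner_ne_zero hp
  · exact exists_generic

/-! ### The pentagram map in coordinates -/

/-- Homogeneous vectors for the image of a polygon under the pentagram map. -/
def star (V : ℤ → Fin 3 → ℝ) (x y : ℤ → ℝ) (i : ℤ) : Fin 3 → ℝ :=
  V (i + 1) + (y (i - 1) * x i * y i) • V (i - 1)

/-- By the recurrence the vector also equals `V (i+2) + y_i V i`, so it lies on both short
diagonals. -/
theorem Normalized.represents_star {V : ℤ → Fin 3 → ℝ} {x y : ℤ → ℝ} (h : Normalized V x y)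
    {v : ℤ → Plane} (hv : Represents v V) : Represents (pentagramVertex v) (star V x y) := by
  intro i
  obtain ⟨_, h1⟩ := hv (i - 1)
  obtain ⟨_, h2⟩ := hv i
  obtain ⟨_, h3⟩ := hv (i + 1)
  obtain ⟨_, h4⟩ := hv (i + 2)
  have hi := h.independent (i + 1)
  rw [show i + 1 - 2 = i - 1 by ring, show i + 1 - 1 = i by ring] at hi
  have hi' : V (i - 1) ⬝ᵥ (V (i + 1) ⨯₃ V i) ≠ 0 := by
    rwa [← cross_anticomm, dotProduct_neg, neg_ne_zero]
  have h0 : star V x y i ≠ 0 := by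
    have := comb_ne_zero (cross_mk_ne_zero hi') (a := y (i - 1) * x i * y i) (b := 1) (by simp)
    rw [star]
    convert this using 1
    module
  refine ⟨h0, ?_⟩
  rw [pentagramVertex, h1, h2, h3, h4]
  refine meet_eq_mk _ _ _ _ _ (neg_ne_zero.2 hi') ?_
  have a1 : V i = (0 : ℝ) • V (i - 1) + (0 : ℝ) • V (i + 1) + (1 : ℝ) • V i := by module
  have a2 : V (i + 2) = (y (i - 1) * x i * y i) • V (i - 1) + (1 : ℝ) • V (i + 1) +
    (-y i) • V i := by rw [h.recur i]; module
  rw [a2]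
  conv_lhs => enter [2, 1, 2]; rw [a1]
  rw [cross_cross_comb, star]
  module

theorem triple_comb (A B C : Fin 3 → ℝ) (a b c p q r p' q' r' : ℝ) :
    (a • A + b • B + c • C) ⬝ᵥ ((p • A + q • B + r • C) ⨯₃ (p' • A + q' • B + r' • C)) =
      (a * (q * r' - r * q') - b * (p * r' - r * p') + c * (p * q' - q * p')) *
        (A ⬝ᵥ (B ⨯₃ C)) := by
  simp [crossProduct, dotProduct, Fin.sum_univ_three]
  ring

/-- This locates the boundary of the domain of `T`: two consecutive image vertices collide when `x_i
y_i = 1`. -/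
theorem Normalized.star_sub {V : ℤ → Fin 3 → ℝ} {x y : ℤ → ℝ} (h : Normalized V x y) (i : ℤ) :
    star V x y i = star V x y (i - 1) + (y (i - 1) * (x i * y i - 1)) • V (i - 1) := by
  rw [star, star, show i - 1 + 1 = i by ring, show i - 1 - 1 = i - 2 by ring, h.recur']
  module

theorem Normalized.mul_ne_one {V : ℤ → Fin 3 → ℝ} {x y : ℤ → ℝ} (h : Normalized V x y)
    {v : ℤ → Plane} (hv : Represents v V) (hp : IsPolygon (pentagramVertex v)) (i : ℤ) :
    x i * y i ≠ 1 := by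
  intro h1
  have e := h.star_sub i
  rw [h1, sub_self, mul_zero, zero_smul, add_zero] at e
  have := hp i
  rw [(h.represents_star hv).generalPosition, e] at this
  simp at this

/-- The action of the pentagram map on the `x`-coordinates. -/
def starX (x y : ℤ → ℝ) (i : ℤ) : ℝ :=
  x i * (1 - x (i - 1) * y (i - 1)) / (1 - x (i + 1) * y (i + 1))

/-- The action of the pentagram map on the `y`-coordinates. -/
def starY (x y : ℤ → ℝ) (i : ℤ) : ℝ :=
  y (i + 1) * (1 - x (i + 2) * y (i + 2)) / (1 - x i * y i)

/-- The factors `1 - x_j y_j` cancel crosswise. The last coefficient of the new recurrence thereby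
becomes `x_i y_i` times the new `y_i`. -/
theorem starY_mul_starX {x y : ℤ → ℝ} (hxy : ∀ i, x i * y i ≠ 1) (i : ℤ) :
    starY x y (i - 1) * starX x y i = x i * y i := by
  have hs : ∀ i, 1 - x i * y i ≠ 0 := fun i => sub_ne_zero.2 (hxy i).symm
  rw [starX, starY, show i - 1 + 1 = i by ring, show i - 1 + 2 = i + 1 by ring,
    div_mul_div_comm, div_eq_iff (mul_ne_zero (hs _) (hs _))]
  ring

/-- Write `s_i` for the image vectors. Then `s_i - x_i y_i s_{i-1} = (1 - x_i y_i) V (i+1)` and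
`s_{i+2} - s_{i+1} = -y_{i+1} (1 - x_{i+2} y_{i+2}) V (i+1)`. Both are multiples of the same vector,
so the recurrence for `s` is one scalar identity, and that identity is the defining formula of the
new `y_i`. -/
theorem Normalized.star {V : ℤ → Fin 3 → ℝ} {x y : ℤ → ℝ} (h : Normalized V x y)
    (hxy : ∀ i, x i * y i ≠ 1) : Normalized (star V x y) (starX x y) (starY x y) := by
  have hs : ∀ i, 1 - x i * y i ≠ 0 := fun i => sub_ne_zero.2 (hxy i).symm
  refine ⟨fun i => ?_, fun i => ?_, fun i => ?_, fun i => ?_⟩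
  · simp [starX, hs, h.x_ne]
  · simp [starY, hs, h.y_ne]
  · have e1 := h.recur' i
    have e2 := h.recur i
    have e3 := h.recur (i + 1)
    rw [show i + 1 + 2 = i + 3 by ring, show i + 1 + 1 = i + 2 by ring,
      show i + 1 - 1 = i by ring] at e3
    have es : starY x y i * (1 - x i * y i) = y (i + 1) * (1 - x (i + 2) * y (i + 2)) :=
      div_mul_cancel₀ _ (hs i)
    rw [starY_mul_starX hxy]
    simp only [Pentagram.star]
    rw [show i + 2 + 1 = i + 3 by ring, show i + 1 + 1 = i + 2 by ring,
      show i + 2 - 1 = i + 1 by ring, show i + 1 - 1 = i by ring, show i - 1 + 1 = i by ring,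
      show i - 1 - 1 = i - 2 by ring]
    -- The second expression for `s_{i-1}`, by the other diagonal, removes `V (i - 2)`.
    have e4 : V i + (y (i - 2) * x (i - 1) * y (i - 1)) • V (i - 2) =
        V (i + 1) + y (i - 1) • V (i - 1) := by rw [e1]; module
    rw [e4, e3, e2]
    match_scalars
    · linear_combination es
    · ring
    · ring
  · have e1 := h.recur' i
    have e0 := h.recur (i - 2)
    rw [show i - 2 + 2 = i by ring, show i - 2 + 1 = i - 1 by ring,
      show i - 2 - 1 = i - 3 by ring] at e0
    simp only [Pentagram.star]
    rw [show i - 2 + 1 = i - 1 by ring, show i - 1 + 1 = i by ring,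
      show i - 2 - 1 = i - 3 by ring, show i - 1 - 1 = i - 2 by ring]
    have t := triple_comb (V (i - 2)) (V (i - 1)) (V i) (y (i - 2)) 0 1
      (y (i - 2) * x (i - 1) * y (i - 1)) 0 1 (y (i - 2) * x (i - 1) * y (i - 1))
      (y (i - 1) * x i * y i - y (i - 1)) 1
    have a1 : V (i - 1) + (y (i - 3) * x (i - 2) * y (i - 2)) • V (i - 3) =
      y (i - 2) • V (i - 2) + (0 : ℝ) • V (i - 1) + (1 : ℝ) • V i := by rw [e0]; module
    have a2 : V i + (y (i - 2) * x (i - 1) * y (i - 1)) • V (i - 2) =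
      (y (i - 2) * x (i - 1) * y (i - 1)) • V (i - 2) + (0 : ℝ) • V (i - 1) + (1 : ℝ) • V i := by
      module
    have a3 : V (i + 1) + (y (i - 1) * x i * y i) • V (i - 1) =
      (y (i - 2) * x (i - 1) * y (i - 1)) • V (i - 2) +
        (y (i - 1) * x i * y i - y (i - 1)) • V (i - 1) + (1 : ℝ) • V i := by rw [e1]; module
    rw [a1, a2, a3, t]
    refine mul_ne_zero ?_ (h.independent i)
    -- This is the determinant of the coefficients of three consecutive image vectors in the basis
    -- `V (i-2)`, `V (i-1)`, `V i`.
    have : y (i - 2) * (1 - x (i - 1) * y (i - 1)) * (y (i - 1) * (1 - x i * y i)) ≠ 0 := by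
      simp [h.y_ne, hs]
    convert this using 1
    ring

theorem starX_xs {n : ℕ} (z : Coord n) : starX (xs z) (ys z) = xs (pentagramCoord z) := by
  ext i
  simp [starX, xs, ys, pentagramCoord]

theorem starY_ys {n : ℕ} (z : Coord n) : starY (xs z) (ys z) = ys (pentagramCoord z) := by
  ext i
  simp [starY, xs, ys, pentagramCoord]

theorem T_toSpace {n : ℕ} {φ : TwistedPolygon n} (h : IsPolygon (pentagramVertex φ.vertex)) :
    T n φ.toSpace = (φ.pentagram h).toSpace := by
  simp only [T, TwistedPolygon.toSpace, Quotient.map_mk, dif_pos h]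
  rfl

theorem mul_ne_one_iff {n : ℕ} [NeZero n] {z : Coord n} :
    (∀ i, z (.inl i) * z (.inr i) ≠ 1) ↔ ∀ i, xs z i * ys z i ≠ 1 := by
  refine ⟨fun h i => h _, fun h i => ?_⟩
  simpa [xs, ys] using h i.val

/-- A product equal to `1` makes consecutive image vertices coincide. Otherwise the image has a
normalized lift with nonzero parameters and is generic automatically. -/
theorem mem_domT_iff {n : ℕ} [NeZero n] {p : PolygonSpace n} (hp : p ∈ generic n) :
    p ∈ domT n ↔ ∀ i, corner n p (.inl i) * corner n p (.inr i) ≠ 1 := by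
  rw [mul_ne_one_iff]
  induction p using Quotient.inductionOn with | h φ => ?_
  obtain ⟨V, hV, hr⟩ := exists_lift (φ := φ) hp
  refine ⟨fun h => hV.mul_ne_one hr h.2.1, fun h => ?_⟩
  have hs := hV.star h
  have hrs := hV.represents_star hr
  have hP : IsPolygon (pentagramVertex φ.vertex) := hs.isPolygon hrs
  refine ⟨hp, hP, ?_⟩
  change T n φ.toSpace ∈ generic n
  rw [T_toSpace hP]
  exact hs.isGeneric hrs

theorem corner_T {n : ℕ} [NeZero n] {p : PolygonSpace n} (hp : p ∈ domT n) :
    corner n (T n p) = pentagramCoord (corner n p) := by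
  have h := (mem_domT_iff hp.1).1 hp
  rw [mul_ne_one_iff] at h
  induction p using Quotient.inductionOn with | h φ => ?_
  obtain ⟨V, hV, hr⟩ := exists_lift (φ := φ) hp.1
  have hs := hV.star h
  have hrs := hV.represents_star hr
  have hP : IsPolygon (pentagramVertex φ.vertex) := hp.2.1
  change corner n (T n φ.toSpace) = pentagramCoord (corner n φ.toSpace)
  rw [T_toSpace hP]
  refine corner_eq_of_normalized ?_ hrs
  rw [← starX_xs, ← starY_ys]
  exact hs

theorem corner_image_domT (n : ℕ) [NeZero n] : corner n '' domT n =
    {z | (∀ a, z a ≠ 0) ∧ ∀ i, z (.inl i) * z (.inr i) ≠ 1} := by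
  ext z
  constructor
  · rintro ⟨p, hp, rfl⟩
    exact ⟨corner_ne_zero hp.1, (mem_domT_iff hp.1).1 hp⟩
  · rintro ⟨h0, h1⟩
    obtain ⟨p, hp, rfl⟩ := exists_generic h0
    exact ⟨p, (mem_domT_iff hp).2 h1, rfl⟩

/-! ### Traces of cyclic products of matrices as sums over closed walks -/

section Walks

variable {R : Type*} [CommRing R]

/-- The product of the first `k` matrices of a cyclic sequence. -/
def chain {n : ℕ} {m : Type*} [Fintype m] [DecidableEq m] (A : ZMod n → Matrix m m R) :
    ℕ → Matrix m m R
  | 0 => 1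
  | k + 1 => chain A k * A k

/-- The arbitrary weight `F` on the end points carries the induction on the length; taking the last
matrix, transposed, as weight then closes the walk and gives the trace. -/
theorem sum_prod_walk {m : Type*} [Fintype m] [DecidableEq m] (A P : ℕ → Matrix m m R)
    (h0 : P 0 = 1) (hP : ∀ k, P (k + 1) = P k * A k) (k : ℕ) (F : m → m → R) :
    ∑ a, ∑ b, P k a b * F a b = ∑ s : Fin (k + 1) → m,
      (∏ i : Fin k, A i (s i.castSucc) (s i.succ)) * F (s 0) (s (Fin.last k)) := by
  induction k generalizing F with
  | zero =>
    rw [h0, ← (Equiv.funUnique (Fin 1) m).symm.sum_comp]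
    simp [Matrix.one_apply]
  | succ k ih =>
    rw [← (Fin.snocEquiv (fun _ => m)).sum_comp, Fintype.sum_prod_type_right]
    have := ih (fun a c => ∑ b, A k c b * F a b)
    rw [hP]
    calc _ = ∑ a, ∑ c, P k a c * ∑ b, A k c b * F a b := by
          refine Finset.sum_congr rfl fun a _ => ?_
          simp only [Matrix.mul_apply, Finset.sum_mul, Finset.mul_sum, mul_assoc]
          exact Finset.sum_comm
      _ = _ := by
          rw [this]
          refine Finset.sum_congr rfl fun s _ => ?_
          rw [Finset.mul_sum]
          refine Finset.sum_congr rfl fun b _ => ?_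
          rw [Fin.prod_univ_castSucc]
          have e0 : (Fin.snoc s b : Fin (k + 1 + 1) → m) 0 = s 0 := by
            rw [← Fin.castSucc_zero, Fin.snoc_castSucc]
          simp only [Fin.snocEquiv, Equiv.coe_fn_mk, Fin.snoc_castSucc, Fin.succ_castSucc,
            Fin.succ_last, Fin.snoc_last, e0, Fin.val_castSucc, Fin.val_last, mul_assoc]

theorem trace_chain {n : ℕ} [NeZero n] {m : Type*} [Fintype m] [DecidableEq m]
    (A : ZMod n → Matrix m m R) :
    (chain A n).trace = ∑ s : ZMod n → m, ∏ i, A i (s i) (s (i + 1)) := by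
  obtain ⟨k, rfl⟩ : ∃ k, n = k + 1 := ⟨n - 1, (Nat.sub_add_cancel (NeZero.one_le)).symm⟩
  have key := sum_prod_walk (fun i => A i) (chain A) rfl (fun _ => rfl) k (fun a b => A k b a)
  calc _ = ∑ a, ∑ b, chain A k a b * A k b a := by
        simp [Matrix.trace, chain, Matrix.mul_apply]
    _ = _ := by
        rw [key]
        refine Finset.sum_congr rfl fun s _ => ?_
        change _ = ∏ i : Fin (k + 1), A i (s i) (s (i + 1))
        rw [Fin.prod_univ_castSucc]
        congr 1
        · refine Finset.prod_congr rfl fun i _ => ?_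
          have e1 : (((i : ℕ) : ZMod (k + 1)) : Fin (k + 1)) = i.castSucc := by
            exact Fin.ext (Nat.mod_eq_of_lt (by omega))
          have e2 : (i.castSucc + 1 : Fin (k + 1)) = i.succ := by simp
          rw [e2]
          exact congrArg (fun j => A j (s i.castSucc) (s i.succ)) e1
        · have e1 : ((k : ZMod (k + 1)) : Fin (k + 1)) = Fin.last k := by
            exact Fin.ext (Nat.mod_eq_of_lt (by omega))
          have e2 : (Fin.last k + 1 : Fin (k + 1)) = 0 := by simp
          rw [e2]
          exact congrArg (fun j => A j (s (Fin.last k)) (s 0)) e1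

end Walks

/-! ### Admissible choices and closed walks -/

section Admissible

variable {n : ℕ}

theorem zmod_ne (hn : 3 ≤ n) (i : ZMod n) : i ≠ i + 1 ∧ i ≠ i + 2 := by
  have h : ∀ k : ℕ, 0 < k → k < n → (k : ZMod n) ≠ 0 := fun k h1 h2 h0 =>
    absurd (Nat.le_of_dvd h1 ((ZMod.natCast_eq_zero_iff k n).1 h0)) (by omega)
  have h1 := h 1 (by omega) (by omega)
  have h2 := h 2 (by omega) (by omega)
  push_cast at h1 h2
  exact ⟨by simpa using h1, by simpa using h2⟩

theorem admissible_empty : Admissible (∅ : Finset (ZMod n)) ∅ := by simp [Admissible]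

variable [NeZero n]

/-- The steps of a walk through the nonzero entries of the matrices `transfer`. -/
def Step (a b : Fin 3) : Prop :=
  (a = 0 ∧ b = 0) ∨ (a = 0 ∧ b = 1) ∨ (a = 1 ∧ b = 0) ∨ (a = 1 ∧ b = 2) ∨ (a = 2 ∧ b = 0)

instance (a b : Fin 3) : Decidable (Step a b) := by unfold Step; infer_instance

/-- Starting points of the arcs of length three. -/
def longArcs (s : ZMod n → Fin 3) : Finset (ZMod n) := {i | s (i + 1) = 1 ∧ s (i + 2) = 2}

/-- Starting points of the arcs of length two. -/
def shortArcs (s : ZMod n → Fin 3) : Finset (ZMod n) := {i | s (i + 1) = 1 ∧ s (i + 2) = 0}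

theorem mem_longArcs {s : ZMod n → Fin 3} {i : ZMod n} :
    i ∈ longArcs s ↔ s (i + 1) = 1 ∧ s (i + 2) = 2 := by simp [longArcs]

theorem mem_shortArcs {s : ZMod n → Fin 3} {i : ZMod n} :
    i ∈ shortArcs s ↔ s (i + 1) = 1 ∧ s (i + 2) = 0 := by simp [shortArcs]

open Classical in
/-- The walk of a choice of arcs. -/
def walkOf (I J : Finset (ZMod n)) (i : ZMod n) : Fin 3 :=
  if i - 1 ∈ I ∨ i - 1 ∈ J then 1 else if i - 2 ∈ I then 2 else 0

/-- The state records the progress within an arc: `0` at its ends or outside, `1` after one step,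
`2` after two steps. A walk is in one state at a time, so its arcs cannot overlap, and non-overlap
is admissibility. -/
theorem admissible_of_walk {s : ZMod n → Fin 3} (hs : ∀ i, Step (s i) (s (i + 1))) :
    Admissible (longArcs s) (shortArcs s) := by
  simp only [Admissible, mem_longArcs, mem_shortArcs]
  have h3 : ∀ i : ZMod n, i + 1 + 1 = i + 2 := fun i => by ring
  have h4 : ∀ i : ZMod n, i + 1 + 2 = i + 2 + 1 := fun i => by ring
  have h5 : ∀ i : ZMod n, i - 1 + 1 = i := fun i => by ring
  have h6 : ∀ i : ZMod n, i - 2 + 2 = i := fun i => by ring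
  have key : ∀ i, s (i + 1) = 1 → s i = 0 := by
    intro i h
    have := hs i
    rw [h] at this
    revert this
    generalize s i = a
    revert a
    decide
  have key2 : ∀ i, s i = 2 → s (i + 1) = 0 := by
    intro i h
    have := hs i
    rw [h] at this
    revert this
    generalize s (i + 1) = a
    revert a
    decide
  refine ⟨?_, ?_, ?_⟩
  · rintro i ⟨a1, a2⟩ j ⟨b1, b2⟩ -
    refine ⟨?_, ?_, ?_, ?_⟩ <;> rintro rfl
    · rw [h6, key i a1] at b2; exact absurd b2 (by decide)
    · rw [h5, key i a1] at b1; exact absurd b1 (by decide)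
    · rw [h3, a2] at b1; exact absurd b1 (by decide)
    · rw [key2 _ a2] at b1; exact absurd b1 (by decide)
  · rintro i ⟨a1, a2⟩ j ⟨b1, b2⟩
    refine ⟨?_, ?_, ?_, ?_⟩ <;> rintro rfl
    · rw [h5, key i a1] at b1; exact absurd b1 (by decide)
    · rw [a2] at b2; exact absurd b2 (by decide)
    · rw [h3, a2] at b1; exact absurd b1 (by decide)
    · rw [key2 _ a2] at b1; exact absurd b1 (by decide)
  · rintro i ⟨a1, a2⟩ ⟨b1, b2⟩
    rw [h3, a2] at b1; exact absurd b1 (by decide)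

theorem step_walkOf (hn : 3 ≤ n) {I J : Finset (ZMod n)} (h : Admissible I J) (i : ZMod n) :
    Step (walkOf I J i) (walkOf I J (i + 1)) := by
  obtain ⟨h1, h2, h3⟩ := h
  have e1 : i + 1 - 1 = i := by ring
  have e2 : i + 1 - 2 = i - 1 := by ring
  have e3 : i - 1 + 1 = i := by ring
  have e4 : i - 2 + 2 = i := by ring
  have n1 := (zmod_ne hn (i - 1)).1
  have n2 := (zmod_ne hn (i - 2)).2
  rw [e3] at n1
  rw [e4] at n2
  have a1 : i - 1 ∈ I → i ∉ I := fun a b => (h1 _ a _ b n1).2.2.1 e3.symm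
  have a2 : i - 1 ∈ I → i ∉ J := fun a b => (h2 _ a _ b).2.2.1 e3.symm
  have a3 : i - 1 ∈ J → i ∉ I := fun a b => (h2 _ b _ a).1 rfl
  have a4 : i - 1 ∈ J → i ∉ J := fun a b => h3 _ a (by rwa [e3])
  have a5 : i - 2 ∈ I → i ∉ I := fun a b => (h1 _ a _ b n2).2.2.2 e4.symm
  have a6 : i - 2 ∈ I → i ∉ J := fun a b => (h2 _ a _ b).2.2.2 e4.symm
  clear h1 h2 h3
  simp only [walkOf, e1, e2]
  split_ifs <;> first | decide | (exfalso; tauto)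

theorem walkOf_arcs {s : ZMod n → Fin 3} (hs : ∀ i, Step (s i) (s (i + 1))) :
    walkOf (longArcs s) (shortArcs s) = s := by
  ext1 i
  have h5 : i - 1 + 1 = i := by ring
  have h6 : i - 2 + 2 = i := by ring
  have h7 : i - 1 + 2 = i + 1 := by ring
  have h8 : i - 2 + 1 = i - 1 := by ring
  have k1 := hs (i - 1)
  have k2 := hs i
  rw [h5] at k1
  simp only [walkOf, mem_longArcs, mem_shortArcs, h5, h6, h7, h8]
  revert k1 k2
  generalize s i = a
  generalize s (i - 1) = b
  generalize s (i + 1) = c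
  revert a b c
  decide

theorem arcs_walkOf {I J : Finset (ZMod n)} (hn : 3 ≤ n) (h : Admissible I J) :
    longArcs (walkOf I J) = I ∧ shortArcs (walkOf I J) = J := by
  obtain ⟨h1, h2, h3⟩ := h
  have key : ∀ i, (i ∈ I → i + 1 ∉ I) ∧ (i ∈ I → i + 1 ∉ J) ∧ (i ∈ J → i + 1 ∉ I) ∧
      (i ∈ J → i + 1 ∉ J) ∧ (i ∈ I → i ∉ J) := fun i =>
    ⟨fun a b => (h1 _ a _ b (zmod_ne hn i).1).2.2.1 rfl, fun a b => (h2 _ a _ b).2.2.1 rfl,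
      fun a b => (h2 _ b _ a).1 (by ring), fun a => h3 _ a, fun a b => (h2 _ a _ b).2.1 rfl⟩
  constructor
  · ext i
    have e1 : i + 1 - 1 = i := by ring
    have e2 : i + 2 - 1 = i + 1 := by ring
    have e3 : i + 2 - 2 = i := by ring
    obtain ⟨a1, a2, a3, a4, a5⟩ := key i
    clear h1 h2 h3 key
    simp only [mem_longArcs, walkOf, e1, e2, e3]
    split_ifs <;> (simp_all; try tauto)
  · ext i
    have e1 : i + 1 - 1 = i := by ring
    have e2 : i + 2 - 1 = i + 1 := by ring
    have e3 : i + 2 - 2 = i := by ring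
    obtain ⟨a1, a2, a3, a4, a5⟩ := key i
    clear h1 h2 h3 key
    simp only [mem_shortArcs, walkOf, e1, e2, e3]
    split_ifs <;> (simp_all; try tauto)

-- Only the closing step of an arc has a weight different from `1`. The shifts `i - 1` and `i - 2`
-- in the transfer matrix attach that weight to the starting point of the arc.
open Classical in
theorem prod_transfer_walk {R : Type*} [CommRing R] (f g : ZMod n → R) {s : ZMod n → Fin 3}
    (hs : ∀ i, Step (s i) (s (i + 1))) :
    ∏ i, transfer (f (i - 1)) (g (i - 2)) (s i) (s (i + 1)) =
      (∏ i ∈ longArcs s, g i) * ∏ j ∈ shortArcs s, f j := by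
  have e1 : ∏ i ∈ longArcs s, g i = ∏ i, if i - 2 ∈ longArcs s then g (i - 2) else 1 := by
    refine Eq.trans ?_ ((Equiv.subRight (2 : ZMod n)).prod_comp
      (fun i => if i ∈ longArcs s then g i else 1)).symm
    rw [Finset.prod_ite_mem, Finset.univ_inter]
  have e2 : ∏ i ∈ shortArcs s, f i = ∏ i, if i - 1 ∈ shortArcs s then f (i - 1) else 1 := by
    refine Eq.trans ?_ ((Equiv.subRight (1 : ZMod n)).prod_comp
      (fun i => if i ∈ shortArcs s then f i else 1)).symm
    rw [Finset.prod_ite_mem, Finset.univ_inter]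
  rw [e1, e2, ← Finset.prod_mul_distrib]
  refine Finset.prod_congr rfl fun i _ => ?_
  have h5 : i - 1 + 1 = i := by ring
  have h6 : i - 2 + 2 = i := by ring
  have h7 : i - 1 + 2 = i + 1 := by ring
  have h8 : i - 2 + 1 = i - 1 := by ring
  have k1 := hs (i - 1)
  have k2 := hs i
  rw [h5] at k1
  simp only [mem_longArcs, mem_shortArcs, h5, h6, h7, h8]
  rcases k2 with ⟨a, b⟩ | ⟨a, b⟩ | ⟨a, b⟩ | ⟨a, b⟩ | ⟨a, b⟩ <;> rw [a] at k1 ⊢ <;> rw [b] <;>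
    simp [transfer]
  rcases k1 with ⟨a, b⟩ | ⟨a, b⟩ | ⟨a, b⟩ | ⟨a, b⟩ | ⟨a, b⟩ <;> simp_all

open Classical in
/-- The generating function of admissible choices with weights `g i` for the factors in the first
set and `f j` for the factors in the second set. -/
def admissibleGen {R : Type*} [CommRing R] (f g : ZMod n → R) : R :=
  ∑ IJ : Finset (ZMod n) × Finset (ZMod n),
    if Admissible IJ.1 IJ.2 then (∏ i ∈ IJ.1, g i) * ∏ j ∈ IJ.2, f j else 0

/-- Walks through a zero entry drop out. The others are made of excursions `0 → 1 → 0` and `0 → 1 →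
2 → 0` and rests at `0`, and the starting points of the excursions form an arbitrary admissible
choice. -/
theorem trace_chain_transfer {R : Type*} [CommRing R] (hn : 3 ≤ n) (f g : ZMod n → R) :
    (chain (fun i => transfer (f (i - 1)) (g (i - 2))) n).trace = admissibleGen f g := by
  classical
  rw [trace_chain, admissibleGen, ← Finset.sum_filter,
    ← Finset.sum_filter_of_ne (p := fun s : ZMod n → Fin 3 => ∀ i, Step (s i) (s (i + 1)))]
  · refine Finset.sum_bij' (fun s _ => (longArcs s, shortArcs s)) (fun IJ _ => walkOf IJ.1 IJ.2)
      ?_ ?_ ?_ ?_ ?_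
    · intro s hs
      simp only [Finset.mem_filter, Finset.mem_univ, true_and] at hs ⊢
      exact admissible_of_walk hs
    · intro IJ h
      simp only [Finset.mem_filter, Finset.mem_univ, true_and] at h ⊢
      exact step_walkOf hn h
    · intro s hs
      simp only [Finset.mem_filter, Finset.mem_univ, true_and] at hs
      exact walkOf_arcs hs
    · intro IJ h
      simp only [Finset.mem_filter, Finset.mem_univ, true_and] at h
      exact Prod.ext (arcs_walkOf hn h).1 (arcs_walkOf hn h).2
    · intro s hs
      simp only [Finset.mem_filter, Finset.mem_univ, true_and] at hs
      exact prod_transfer_walk f g hs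
  · intro s _ h i
    by_contra hc
    apply h
    refine Finset.prod_eq_zero (Finset.mem_univ i) ?_
    revert hc
    generalize s i = a
    generalize s (i + 1) = b
    revert a b
    intro a b
    fin_cases a <;> fin_cases b <;> simp [transfer, Step]

/-- The arcs occupy the sites `i, i+1, i+2` for `i ∈ I` and `j, j+1` for `j ∈ J`, and admissibility
says that these sets are disjoint. -/
theorem Admissible.card_le (hn : 3 ≤ n) {I J : Finset (ZMod n)} (h : Admissible I J) :
    3 * I.card + 2 * J.card ≤ n := by
  classical
  obtain ⟨h1, h2, h3⟩ := h
  have sh : ∀ (S : Finset (ZMod n)) (k : ZMod n),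
      ∑ i, (if i - k ∈ S then 1 else 0) = S.card := by
    intro S k
    refine ((Equiv.subRight k).sum_comp (fun i => if i ∈ S then 1 else 0)).trans ?_
    rw [Finset.sum_ite_mem,
      Finset.univ_inter, Finset.card_eq_sum_ones]
  have key : ∀ i : ZMod n, (if i - 0 ∈ I then 1 else 0) + (if i - 1 ∈ I then 1 else 0) +
      (if i - 2 ∈ I then 1 else 0) + (if i - 0 ∈ J then 1 else 0) +
      (if i - 1 ∈ J then 1 else 0) ≤ 1 := by
    intro i
    rw [sub_zero]
    have e3 : i - 1 + 1 = i := by ring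
    have e4 : i - 2 + 2 = i := by ring
    have e5 : i - 2 + 1 = i - 1 := by ring
    have n1 := (zmod_ne hn (i - 1)).1
    have n2 := (zmod_ne hn (i - 2)).2
    have n3 := (zmod_ne hn (i - 2)).1
    rw [e3] at n1
    rw [e4] at n2
    rw [e5] at n3
    have a1 : i - 1 ∈ I → i ∉ I := fun a b => (h1 _ a _ b n1).2.2.1 e3.symm
    have a2 : i - 1 ∈ I → i ∉ J := fun a b => (h2 _ a _ b).2.2.1 e3.symm
    have a3 : i - 1 ∈ J → i ∉ I := fun a b => (h2 _ b _ a).1 rfl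
    have a4 : i - 1 ∈ J → i ∉ J := fun a b => h3 _ a (by rwa [e3])
    have a5 : i - 2 ∈ I → i ∉ I := fun a b => (h1 _ a _ b n2).2.2.2 e4.symm
    have a6 : i - 2 ∈ I → i ∉ J := fun a b => (h2 _ a _ b).2.2.2 e4.symm
    have a7 : i - 2 ∈ I → i - 1 ∉ I := fun a b => (h1 _ a _ b n3).2.2.1 e5.symm
    have a8 : i - 2 ∈ I → i - 1 ∉ J := fun a b => (h2 _ a _ b).2.2.1 e5.symm
    have a9 : i ∈ I → i ∉ J := fun a b => (h2 _ a _ b).2.1 rfl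
    have a10 : i - 1 ∈ I → i - 1 ∉ J := fun a b => (h2 _ a _ b).2.1 rfl
    clear h1 h2 h3 sh
    grind
  have := Finset.sum_le_sum (fun i (_ : i ∈ Finset.univ) => key i)
  simp only [Finset.sum_add_distrib, sh, Finset.sum_const, Finset.card_univ, ZMod.card,
    smul_eq_mul] at this
  omega

theorem map_admissibleSum {R : Type*} [CommRing R] (ψ : CornerPoly n →+* R)
    (X u : ZMod n → CornerPoly n) (k : ℕ) :
    open Classical in
    ψ (admissibleSum X u k) = ∑ IJ : Finset (ZMod n) × Finset (ZMod n),
      if Admissible IJ.1 IJ.2 ∧ IJ.1.card + IJ.2.card = k then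
        (-1) ^ IJ.2.card * (∏ i ∈ IJ.1, ψ (X i)) * ∏ j ∈ IJ.2, ψ (u j) else 0 := by
  rw [admissibleSum, map_sum]
  refine Finset.sum_congr rfl fun IJ _ => ?_
  split_ifs <;> simp [map_prod]

theorem admissibleSum_zero (X u : ZMod n → CornerPoly n) : admissibleSum X u 0 = 1 := by
  classical
  rw [admissibleSum, Finset.sum_eq_single (∅, ∅)]
  · simp [admissible_empty]
  · rintro ⟨I, J⟩ _ h
    refine if_neg ?_
    rintro ⟨-, h1⟩
    apply h
    simp only [Nat.add_eq_zero_iff, Finset.card_eq_zero] at h1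
    rw [h1.1, h1.2]
  · simp

/-- The parameter `r` counts the chosen factors. The summand `1` is the empty choice, and the bound
on the occupied sites ends the sum at `n / 2`. -/
theorem admissibleGen_eq_sum {R : Type*} [CommRing R] (hn : 3 ≤ n) (ψ : CornerPoly n →+* R)
    (X u : ZMod n → CornerPoly n) (r : R) :
    admissibleGen (fun i => -(r * ψ (u i))) (fun i => r * ψ (X i)) =
      1 + ∑ k ∈ Finset.Icc 1 (n / 2), r ^ k * ψ (admissibleSum X u k) := by
  classical
  have h1 : (1 : R) + ∑ k ∈ Finset.Icc 1 (n / 2), r ^ k * ψ (admissibleSum X u k) =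
      ∑ k ∈ Finset.range (n / 2 + 1), r ^ k * ψ (admissibleSum X u k) := by
    rw [Finset.sum_range_succ', add_comm, admissibleSum_zero, pow_zero, map_one, one_mul]
    congr 1
    rw [Finset.range_eq_Ico, Finset.sum_Ico_add' (fun k => r ^ k * ψ (admissibleSum X u k)) 0 _ 1]
    rfl
  rw [h1]
  simp only [map_admissibleSum, Finset.mul_sum]
  rw [Finset.sum_comm, admissibleGen]
  refine Finset.sum_congr rfl fun IJ _ => ?_
  by_cases h : Admissible IJ.1 IJ.2
  · have hc := h.card_le hn
    rw [if_pos h, Finset.sum_eq_single (IJ.1.card + IJ.2.card)]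
    · rw [if_pos ⟨h, rfl⟩, Finset.prod_neg, Finset.prod_mul_distrib, Finset.prod_mul_distrib,
        Finset.prod_const, Finset.prod_const]
      ring
    · intro k _ hk
      rw [if_neg (fun h' => hk h'.2.symm), mul_zero]
    · intro hk
      exact absurd (Finset.mem_range.2 (by omega)) hk
  · simp [h]

theorem admissibleGen_eq_sum_O {R : Type*} [CommRing R] (hn : 3 ≤ n) (ψ : CornerPoly n →+* R)
    (r : R) :
    admissibleGen (fun i => -(r * ψ (xVar i)))
      (fun i => r * ψ (xVar i * yVar i * xVar (i + 1))) =
      1 + ∑ k ∈ Finset.Icc 1 (n / 2), r ^ k * ψ (O n k) := by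
  rw [admissibleGen_eq_sum hn ψ (fun i => xVar i * yVar i * xVar (i + 1)) xVar]
  congr 1
  refine Finset.sum_congr rfl fun k hk => ?_
  rw [Finset.mem_Icc] at hk
  rw [O, if_neg (by omega)]

theorem admissibleGen_eq_sum_E {R : Type*} [CommRing R] (hn : 3 ≤ n) (ψ : CornerPoly n →+* R)
    (r : R) :
    admissibleGen (fun i => -(r * ψ (yVar i)))
      (fun i => r * ψ (yVar i * xVar (i + 1) * yVar (i + 1))) =
      1 + ∑ k ∈ Finset.Icc 1 (n / 2), r ^ k * ψ (E n k) := by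
  rw [admissibleGen_eq_sum hn ψ (fun i => yVar i * xVar (i + 1) * yVar (i + 1)) yVar]
  congr 1
  refine Finset.sum_congr rfl fun k hk => ?_
  rw [Finset.mem_Icc] at hk
  rw [E, if_neg (by omega)]

end Admissible

/-! ### The reversal symmetry -/

section Reversal

variable {n : ℕ}

/-- The permutation of the coordinates induced by reversing the numbering of the vertices. -/
def flip : ZMod n ⊕ ZMod n → ZMod n ⊕ ZMod n :=
  Sum.elim (fun i => .inr (-i)) (fun i => .inl (-i))

theorem flip_flip (a : ZMod n ⊕ ZMod n) : flip (flip a) = a := by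
  rcases a with i | i <;> simp [flip]

theorem crossRatio_reverse (a b c d : Plane) : crossRatio a b c d = crossRatio d c b a := by
  simp only [crossRatio, vecCrossRatio]
  generalize a.rep = a
  generalize b.rep = b
  generalize c.rep = c
  generalize d.rep = d
  rw [← cross_anticomm a b, ← cross_anticomm c d, ← cross_anticomm a c, ← cross_anticomm b d]
  simp only [dotProduct_neg, neg_neg, dotProduct_comm]

theorem meet_reverse (a b c d : Plane) : meet a b c d = meet d c b a := by
  rw [meet, meet, Projectivization.cross_comm a b, Projectivization.cross_comm c d,
    Projectivization.cross_comm]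

/-- The four points defining `y` are those defining `x` seen from the other end, and the cross-ratio
is unchanged when its arguments are reversed. -/
theorem corner_reverse (v : ℤ → Plane) (i : ℤ) :
    leftCorner (fun k => v (-k)) i = rightCorner v (-i) ∧
      rightCorner (fun k => v (-k)) i = leftCorner v (-i) := by
  constructor
  · rw [leftCorner, rightCorner, crossRatio_reverse, meet_reverse, meet_reverse (v (-(i - 2)))]
    congr 3 <;> ring_nf
  · rw [leftCorner, rightCorner, crossRatio_reverse, meet_reverse, meet_reverse (v (-(i - 2)))]
    congr 3 <;> ring_nf

/-- The polygon with reversed numbering of the vertices. -/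
def TwistedPolygon.reverse (φ : TwistedPolygon n) : TwistedPolygon n where
  vertex k := φ.vertex (-k)
  exists_monodromy := by
    obtain ⟨M, hM⟩ := φ.exists_monodromy
    refine ⟨M⁻¹, fun k => ?_⟩
    rw [eq_inv_smul_iff, ← hM]
    congr 1
    ring
  isPolygon i := by
    have := (φ.isPolygon (-i)).rotate.rotate.swap
    rw [show -i - 1 = -(i + 1) by ring, show -i + 1 = -(i - 1) by ring] at this
    exact this

theorem TwistedPolygon.HasMonodromy.reverse {φ : TwistedPolygon n} {M : PGL(3, ℝ)}
    (h : φ.HasMonodromy M) : φ.reverse.HasMonodromy M⁻¹ := by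
  intro k
  change φ.vertex _ = _ • φ.vertex _
  rw [eq_inv_smul_iff, ← h]
  congr 1
  ring

theorem IsGenericPolygon.reverse {v : ℤ → Plane} (h : IsGenericPolygon v) :
    IsGenericPolygon (fun k => v (-k)) := by
  intro i
  obtain ⟨h1, h2, h3, h4⟩ := h (-(i + 3))
  rw [show -(i + 3) + 1 = -(i + 2) by ring, show -(i + 3) + 2 = -(i + 1) by ring,
    show -(i + 3) + 3 = -i by ring] at *
  exact ⟨h4.rotate.rotate.swap, h3.rotate.rotate.swap, h2.rotate.rotate.swap,
    h1.rotate.rotate.swap⟩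

theorem corner_reverse_toSpace [NeZero n] {φ : TwistedPolygon n}
    (h : IsGenericPolygon φ.vertex) :
    corner n φ.reverse.toSpace = corner n φ.toSpace ∘ flip := by
  have h' : IsGenericPolygon φ.reverse.vertex := h.reverse
  refine coord_ext (fun i => ?_) (fun i => ?_)
  · rw [(corner_toSpace h' i).1]
    refine (corner_reverse φ.vertex i).1.trans ?_
    rw [← (corner_toSpace h _).2]
    simp [xs, ys, flip]
  · rw [(corner_toSpace h' i).2]
    refine (corner_reverse φ.vertex i).2.trans ?_
    rw [← (corner_toSpace h _).1]
    simp [xs, ys, flip]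

variable [NeZero n]

/-- The reflection `k ↦ 1 - k` of the sites maps the arc `{j, j+1}` to the one starting at `-j`, but
`{i, i+1, i+2}` to the one starting at `-1 - i`; hence the two different index maps. -/
theorem admissible_reflect (I J : Finset (ZMod n)) :
    Admissible (I.map (Equiv.subLeft (-1 : ZMod n)).toEmbedding)
      (J.map (Equiv.neg (ZMod n)).toEmbedding) ↔ Admissible I J := by
  have hI : ∀ i, i ∈ I.map (Equiv.subLeft (-1 : ZMod n)).toEmbedding ↔ -1 - i ∈ I := by
    intro i
    simp only [Finset.mem_map_equiv]
    change -i + -1 ∈ I ↔ _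
    rw [neg_add_eq_sub]
  have hJ : ∀ j, j ∈ J.map (Equiv.neg (ZMod n)).toEmbedding ↔ -j ∈ J := by
    intro j
    simp only [Finset.mem_map_equiv]
    rfl
  have key : ∀ i j : ZMod n, (j ≠ i - 2 ∧ j ≠ i - 1 ∧ j ≠ i + 1 ∧ j ≠ i + 2) ↔
      (-1 - j ≠ -1 - i - 2 ∧ -1 - j ≠ -1 - i - 1 ∧ -1 - j ≠ -1 - i + 1 ∧ -1 - j ≠ -1 - i + 2) := by
    intro i j
    have e1 : (-1 - j = -1 - i - 2) ↔ j = i + 2 :=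
      ⟨fun h => by linear_combination -h, fun h => by linear_combination -h⟩
    have e2 : (-1 - j = -1 - i - 1) ↔ j = i + 1 :=
      ⟨fun h => by linear_combination -h, fun h => by linear_combination -h⟩
    have e3 : (-1 - j = -1 - i + 1) ↔ j = i - 1 :=
      ⟨fun h => by linear_combination -h, fun h => by linear_combination -h⟩
    have e4 : (-1 - j = -1 - i + 2) ↔ j = i - 2 :=
      ⟨fun h => by linear_combination -h, fun h => by linear_combination -h⟩
    simp only [ne_eq, e1, e2, e3, e4]
    tauto
  have key2 : ∀ i j : ZMod n, (j ≠ i - 1 ∧ j ≠ i ∧ j ≠ i + 1 ∧ j ≠ i + 2) ↔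
      (-j ≠ -1 - i - 1 ∧ -j ≠ -1 - i ∧ -j ≠ -1 - i + 1 ∧ -j ≠ -1 - i + 2) := by
    intro i j
    have e1 : (-j = -1 - i - 1) ↔ j = i + 2 :=
      ⟨fun h => by linear_combination -h, fun h => by linear_combination -h⟩
    have e2 : (-j = -1 - i) ↔ j = i + 1 :=
      ⟨fun h => by linear_combination -h, fun h => by linear_combination -h⟩
    have e3 : (-j = -1 - i + 1) ↔ j = i :=
      ⟨fun h => by linear_combination -h, fun h => by linear_combination -h⟩
    have e4 : (-j = -1 - i + 2) ↔ j = i - 1 :=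
      ⟨fun h => by linear_combination -h, fun h => by linear_combination -h⟩
    simp only [ne_eq, e1, e2, e3, e4]
    tauto
  simp only [Admissible, hI, hJ]
  refine and_congr ?_ (and_congr ?_ ?_)
  · constructor
    · intro h i hi j hj hij
      have := h (-1 - i) (by simpa using hi) (-1 - j) (by simpa using hj) (by simpa using hij)
      rwa [← key] at this
    · intro h i hi j hj hij
      have := h _ hi _ hj (by simpa using hij)
      rwa [← key] at this
  · constructor
    · intro h i hi j hj
      have := h (-1 - i) (by simpa using hi) (-j) (by simpa using hj)
      rwa [← key2] at this
    · intro h i hi j hj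
      have := h _ hi _ hj
      rwa [← key2] at this
  · constructor
    · intro h i hi hi'
      exact h (-(i + 1)) (by simpa using hi') (by simpa using hi)
    · intro h i hi hi'
      exact h _ hi' (by simpa using hi)

theorem rename_flip_admissibleSum (X X' u u' : ZMod n → CornerPoly n)
    (hX : ∀ i, MvPolynomial.rename flip (X i) = X' (-1 - i))
    (hu : ∀ i, MvPolynomial.rename flip (u i) = u' (-i)) (k : ℕ) :
    MvPolynomial.rename flip (admissibleSum X u k) = admissibleSum X' u' k := by
  classical
  have := map_admissibleSum (MvPolynomial.rename (R := ℝ) (flip (n := n))).toRingHom X u k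
  simp only [AlgHom.toRingHom_eq_coe, RingHom.coe_coe] at this
  rw [this, admissibleSum]
  refine Fintype.sum_equiv (Equiv.prodCongr (Equiv.finsetCongr (Equiv.subLeft (-1 : ZMod n)))
    (Equiv.finsetCongr (Equiv.neg (ZMod n)))) _ _ fun IJ => ?_
  simp only [Equiv.prodCongr_apply, Prod.map_fst, Prod.map_snd, Equiv.finsetCongr_apply,
    admissible_reflect, Finset.card_map, Finset.prod_map, hX, hu]
  simp

theorem rename_flip_E (k : ℕ) : MvPolynomial.rename flip (E n k) = O n k := by
  rw [E, O]
  split_ifs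
  · simp only [map_prod, yVar, xVar, MvPolynomial.rename_X, flip, Sum.elim_inr]
    exact Equiv.prod_comp (Equiv.neg (ZMod n))
      (fun i => (MvPolynomial.X (.inl i) : CornerPoly n))
  · refine rename_flip_admissibleSum _ _ _ _ (fun i => ?_) (fun i => ?_) k
    · simp only [yVar, xVar, map_mul, MvPolynomial.rename_X, flip, Sum.elim_inr, Sum.elim_inl]
      rw [show -1 - i + 1 = -i by ring, show -(i + 1) = -1 - i by ring]
      ring
    · simp [yVar, xVar, flip]

theorem rename_flip_O (k : ℕ) : MvPolynomial.rename flip (O n k) = E n k := by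
  rw [← rename_flip_E, MvPolynomial.rename_rename]
  have : (flip ∘ flip : ZMod n ⊕ ZMod n → _) = id := funext flip_flip
  rw [this, MvPolynomial.rename_id]
  rfl

theorem eval_flip_E (z : Coord n) (k : ℕ) :
    MvPolynomial.eval (z ∘ flip) (E n k) = MvPolynomial.eval z (O n k) := by
  rw [← rename_flip_E, MvPolynomial.eval_rename]

theorem eval_flip_O (z : Coord n) (k : ℕ) :
    MvPolynomial.eval (z ∘ flip) (O n k) = MvPolynomial.eval z (E n k) := by
  rw [← rename_flip_O, MvPolynomial.eval_rename]

end Reversal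

/-! ### The trace of the monodromy -/

section Monodromy

variable {n : ℕ} [NeZero n]

theorem eval_O_self (z : Coord n) : MvPolynomial.eval z (O n n) = ∏ i, z (.inl i) := by
  simp [O, xVar, map_prod]

theorem eval_E_self (z : Coord n) : MvPolynomial.eval z (E n n) = ∏ i, z (.inr i) := by
  simp [E, yVar, map_prod]

/-- The sequence of transfer matrices with the given corner invariants. -/
def transferSeq (z : Coord n) (i : ZMod n) : Matrix (Fin 3) (Fin 3) ℝ :=
  transfer (-z (.inr (i - 1)))
    (z (.inr (i - 2)) * z (.inl (i - 2 + 1)) * z (.inr (i - 2 + 1)))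

theorem trace_transferSeq (hn : 3 ≤ n) (z : Coord n) :
    (chain (transferSeq z) n).trace =
      1 + ∑ k ∈ Finset.Icc 1 (n / 2), MvPolynomial.eval z (E n k) := by
  have h1 := trace_chain_transfer hn (fun i => -z (.inr i))
    (fun i => z (.inr i) * z (.inl (i + 1)) * z (.inr (i + 1)))
  have h2 := admissibleGen_eq_sum_E hn (MvPolynomial.eval z) 1
  simp only [xVar, yVar, map_mul, MvPolynomial.eval_X, one_mul, one_pow] at h2
  rw [← h2]
  exact h1

theorem det_chain {R : Type*} [CommRing R] (A : ZMod n → Matrix (Fin 3) (Fin 3) R) :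
    (chain A n).det = ∏ i, (A i).det := by
  have h : ∀ k, (chain A k).det = ∏ i ∈ Finset.range k, (A (i : ZMod n)).det := by
    intro k
    induction k with
    | zero => simp [chain]
    | succ k ih => rw [chain, Matrix.det_mul, ih, Finset.prod_range_succ]
  rw [h]
  refine Finset.prod_bij' (fun i _ => (i : ZMod n)) (fun i _ => i.val) ?_ ?_ ?_ ?_ ?_
  · simp
  · simp [ZMod.val_lt]
  · intro i hi
    exact ZMod.val_cast_of_lt (Finset.mem_range.1 hi)
  · simp
  · simp

theorem det_transferSeq (z : Coord n) : (chain (transferSeq z) n).det =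
    MvPolynomial.eval z (O n n) * MvPolynomial.eval z (E n n) ^ 2 := by
  rw [det_chain, eval_O_self, eval_E_self]
  simp only [transferSeq, det_transfer, Finset.prod_mul_distrib]
  have e1 := (Equiv.subRight (2 : ZMod n)).prod_comp (fun i => z (.inr i))
  have e2 := ((Equiv.subRight (2 : ZMod n)).trans (Equiv.addRight (1 : ZMod n))).prod_comp
    (fun i => z (.inr i))
  have e3 := ((Equiv.subRight (2 : ZMod n)).trans (Equiv.addRight (1 : ZMod n))).prod_comp
    (fun i => z (.inl i))
  simp only [Equiv.trans_apply, Equiv.coe_addRight, Equiv.subRight_apply] at e1 e2 e3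
  rw [e1, e2, e3]
  ring

theorem Normalized.frame_chain {V : ℤ → Fin 3 → ℝ} {z : Coord n}
    (h : Normalized V (xs z) (ys z)) (k : ℕ) :
    frame V k = frame V 0 * chain (transferSeq z) k := by
  induction k with
  | zero => simp [chain]
  | succ k ih =>
    rw [chain, ← Matrix.mul_assoc, ← ih, Nat.cast_succ, h.frame_succ]
    congr 2
    · simp [ys]
    · simp only [xs, ys]
      push_cast
      rw [show (k : ZMod n) - 1 = k - 2 + 1 by ring]

/-- A priori `V (i+n)` is proportional to the image of `V i` with a factor depending on `i`. The
leading coefficient `1` in the recurrence forces consecutive factors to agree. -/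
theorem Normalized.exists_frame_eq {V : ℤ → Fin 3 → ℝ} {z : Coord n}
    (h : Normalized V (xs z) (ys z)) {φ : TwistedPolygon n} (hr : Represents φ.vertex V)
    {M : GL (Fin 3) ℝ} (hM : φ.HasMonodromy (Matrix.ProjGenLinGroup.mk M)) :
    ∃ c : ℝ, c ≠ 0 ∧ frame V n = c • (M.val * frame V 0) := by
  have h1 : ∀ i, ∃ c : ℝ, c ≠ 0 ∧ V (i + n) = c • (M.val *ᵥ V i) := by
    intro i
    have := hM i
    obtain ⟨h0, h1⟩ := hr i
    obtain ⟨h0', h1'⟩ := hr (i + n)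
    rw [h1, h1', mk_smul_mk, Projectivization.mk_eq_mk_iff] at this
    obtain ⟨a, ha⟩ := this
    exact ⟨a, a.ne_zero, ha.symm⟩
  choose c hc0 hc using h1
  have h2 : ∀ i, c (i + 2) = c (i + 1) := by
    intro i
    have r1 := h.recur i
    have r2 := h.shift_period.recur i
    simp only [hc] at r2
    have hi := h.independent (i + 1)
    rw [show i + 1 - 2 = i - 1 by ring, show i + 1 - 1 = i by ring] at hi
    have hd : (M.val *ᵥ V (i - 1)) ⬝ᵥ ((M.val *ᵥ V i) ⨯₃ (M.val *ᵥ V (i + 1))) ≠ 0 := by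
      have hg := (generalPosition_smul (Matrix.ProjGenLinGroup.mk M) (.mk ℝ _ (h.ne_zero (i - 1)))
        (.mk ℝ _ (h.ne_zero i)) (.mk ℝ _ (h.ne_zero (i + 1)))).2
        ((generalPosition_mk _ _ _).2 hi)
      rwa [mk_smul_mk, mk_smul_mk, mk_smul_mk, generalPosition_mk] at hg
    rw [r1] at r2
    simp only [Matrix.mulVec_add, Matrix.mulVec_sub, Matrix.mulVec_smul] at r2
    -- This triple product kills the terms in `V i` and `V (i - 1)` and isolates the coefficient of
    -- `V (i + 1)`.
    have e := congrArg (fun w => (M.val *ᵥ V (i - 1)) ⬝ᵥ ((M.val *ᵥ V i) ⨯₃ w)) r2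
    simp only [map_add, map_sub, map_smul, dotProduct_add, dotProduct_sub, dotProduct_smul,
      cross_self, smul_eq_mul, dotProduct_zero, mul_zero, sub_zero] at e
    have e' : (M.val *ᵥ V (i - 1)) ⬝ᵥ ((M.val *ᵥ V i) ⨯₃ (M.val *ᵥ V (i - 1))) = 0 :=
      dot_cross_self _ _
    rw [e'] at e
    simp only [mul_zero, add_zero] at e
    exact mul_right_cancel₀ hd e
  -- The frame at `0` involves the indices `-2`, `-1`, `0`, so two equalities of factors are enough.
  have k1 := h2 (-3)
  have k2 := h2 (-2)
  norm_num at k1 k2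
  refine ⟨c 0, hc0 0, ?_⟩
  have v0 := hc 0
  have v1 := hc (-1)
  have v2 := hc (-2)
  rw [← k1, ← k2] at v2
  rw [← k2] at v1
  rw [zero_add] at v0
  rw [show -1 + (n : ℤ) = n - 1 by ring] at v1
  rw [show -2 + (n : ℤ) = n - 2 by ring] at v2
  ext a b
  fin_cases b <;>
    simp [frame, v0, v1, v2, Matrix.mul_apply, Matrix.mulVec, dotProduct]

/-- The quotient is invariant under conjugation and homogeneous of degree zero, so it depends only
on the projective class of the monodromy. -/
theorem trace_pow_div_det {W C M : Matrix (Fin 3) (Fin 3) ℝ} {c : ℝ} (hW : W.det ≠ 0)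
    (hc : c ≠ 0) (h : W * C = c • (M * W)) :
    M.trace ^ 3 / M.det = C.trace ^ 3 / C.det := by
  have hu := isUnit_iff_ne_zero.2 hW
  have hC : C = c • (W⁻¹ * M * W) := by
    rw [Matrix.mul_assoc, ← Matrix.mul_smul, ← h, ← Matrix.mul_assoc, Matrix.nonsing_inv_mul _ hu,
      Matrix.one_mul]
  have ht : C.trace = c * M.trace := by
    rw [hC, Matrix.trace_smul, Matrix.trace_mul_comm, ← Matrix.mul_assoc,
      Matrix.mul_nonsing_inv _ hu, Matrix.one_mul, smul_eq_mul]
  have hd : C.det = c ^ 3 * M.det := by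
    rw [hC, Matrix.det_smul, Matrix.det_mul, Matrix.det_mul, Matrix.det_nonsing_inv,
      Ring.inverse_eq_inv', Fintype.card_fin]
    field_simp
  rw [ht, hd, mul_pow, mul_div_mul_left _ _ (pow_ne_zero 3 hc)]

theorem trace_monodromy (hn : 3 ≤ n) {φ : TwistedPolygon n} {M : GL (Fin 3) ℝ}
    (hg : IsGenericPolygon φ.vertex) (hM : φ.HasMonodromy (Matrix.ProjGenLinGroup.mk M)) :
    MvPolynomial.eval (corner n φ.toSpace) (O n n) *
      MvPolynomial.eval (corner n φ.toSpace) (E n n) ^ 2 * (M.val.trace ^ 3 / M.val.det) =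
      (1 + ∑ k ∈ Finset.Icc 1 (n / 2), MvPolynomial.eval (corner n φ.toSpace) (E n k)) ^ 3 := by
  obtain ⟨V, hV, hr⟩ := exists_lift hg
  obtain ⟨c, hc, h⟩ := hV.exists_frame_eq hr hM
  rw [hV.frame_chain n] at h
  rw [trace_pow_div_det (hV.det_frame_ne_zero 0) hc h, ← det_transferSeq, ← trace_transferSeq hn]
  refine mul_div_cancel₀ _ ?_
  rw [det_transferSeq, eval_O_self, eval_E_self]
  have := corner_ne_zero (p := φ.toSpace) hg
  exact mul_ne_zero (Finset.prod_ne_zero_iff.2 fun i _ => this _)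
    (pow_ne_zero _ (Finset.prod_ne_zero_iff.2 fun i _ => this _))

/-- The formula for the `E_k` is applied to the reversed polygon. -/
theorem trace_monodromy_inv (hn : 3 ≤ n) {φ : TwistedPolygon n} {M : GL (Fin 3) ℝ}
    (hg : IsGenericPolygon φ.vertex) (hM : φ.HasMonodromy (Matrix.ProjGenLinGroup.mk M)) :
    MvPolynomial.eval (corner n φ.toSpace) (O n n) ^ 2 *
      MvPolynomial.eval (corner n φ.toSpace) (E n n) * ((M⁻¹).val.trace ^ 3 / (M⁻¹).val.det) =
      (1 + ∑ k ∈ Finset.Icc 1 (n / 2), MvPolynomial.eval (corner n φ.toSpace) (O n k)) ^ 3 := by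
  have h := trace_monodromy hn (φ := φ.reverse) (M := M⁻¹) hg.reverse
    (by rw [map_inv]; exact hM.reverse)
  simp only [corner_reverse_toSpace hg, eval_flip_E, eval_flip_O] at h
  rw [← h]
  ring

/-! ### Weights under rescaling. -/

theorem eval_rescale_O (t : ℝ) (z : Coord n) (k : ℕ) (ht : t ≠ 0) :
    MvPolynomial.eval (rescale t z) (O n k) = t ^ k * MvPolynomial.eval z (O n k) := by
  classical
  rw [O]
  split_ifs with h
  · subst h
    simp [xVar, map_prod, rescale, Finset.prod_mul_distrib, ZMod.card]
  · rw [map_admissibleSum, map_admissibleSum, Finset.mul_sum]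
    refine Finset.sum_congr rfl fun IJ _ => ?_
    split_ifs with h
    · have e : ∀ i : ZMod n, MvPolynomial.eval (rescale t z) (xVar i * yVar i * xVar (i + 1)) =
          t * MvPolynomial.eval z (xVar i * yVar i * xVar (i + 1)) := by
        intro i
        simp only [xVar, yVar, map_mul, MvPolynomial.eval_X, rescale, Sum.elim_inl, Sum.elim_inr]
        field_simp
      have e' : ∀ i : ZMod n, MvPolynomial.eval (rescale t z) (xVar i) =
          t * MvPolynomial.eval z (xVar i) := by
        intro i
        simp [xVar, rescale]
      simp only [e, e', Finset.prod_mul_distrib, Finset.prod_const, ← h.2, pow_add]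
      ring
    · rw [mul_zero]

theorem eval_rescale_E (t : ℝ) (z : Coord n) (k : ℕ) (ht : t ≠ 0) :
    MvPolynomial.eval (rescale t z) (E n k) = t⁻¹ ^ k * MvPolynomial.eval z (E n k) := by
  have e : rescale t z = rescale t⁻¹ (z ∘ flip) ∘ flip := by
    ext a
    rcases a with i | i <;> simp [rescale, flip]
  rw [e, eval_flip_E, eval_rescale_O _ _ _ (inv_ne_zero ht), eval_flip_O]

/-! ### Invariance under the pentagram map -/

/-- Comparison of coefficients from infinitely many parameter values; it separates the weights here
and the spectral parameters in the commutation proof. -/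
theorem eq_of_sum_pow_eq {m : ℕ} {S : Set ℝ} (hS : S.Infinite) {a b : ℕ → ℝ}
    (h : ∀ s ∈ S, ∑ k ∈ Finset.Icc 1 m, s ^ k * a k = ∑ k ∈ Finset.Icc 1 m, s ^ k * b k)
    {k : ℕ} (hk : k ∈ Finset.Icc 1 m) : a k = b k := by
  have hp : (∑ k ∈ Finset.Icc 1 m, Polynomial.monomial k (a k)) =
      ∑ k ∈ Finset.Icc 1 m, Polynomial.monomial k (b k) := by
    refine Polynomial.eq_of_infinite_eval_eq _ _ (hS.mono fun s hs => ?_)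
    simpa [Polynomial.eval_finsetSum, mul_comm] using h s hs
  have := congrArg (fun p => Polynomial.coeff p k) hp
  simpa [Polynomial.finsetSum_coeff, Polynomial.coeff_monomial, hk] using this

theorem infinite_ne_zero : {s : ℝ | s ≠ 0}.Infinite := by
  have : {s : ℝ | s ≠ 0} = {0}ᶜ := rfl
  rw [this]
  exact (Set.finite_singleton 0).infinite_compl

theorem eval_pentagramCoord_self {z : Coord n} (hz : ∀ i, z (.inl i) * z (.inr i) ≠ 1) :
    MvPolynomial.eval (pentagramCoord z) (O n n) = MvPolynomial.eval z (O n n) ∧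
      MvPolynomial.eval (pentagramCoord z) (E n n) = MvPolynomial.eval z (E n n) := by
  have hs : ∏ i, (1 - z (.inl i) * z (.inr i)) ≠ 0 :=
    Finset.prod_ne_zero_iff.2 fun i _ => sub_ne_zero.2 (hz i).symm
  have s1 := (Equiv.subRight (1 : ZMod n)).prod_comp (fun i => 1 - z (.inl i) * z (.inr i))
  have s2 := Equiv.prod_comp (Equiv.addRight (1 : ZMod n)) (fun i => 1 - z (.inl i) * z (.inr i))
  have s3 := Equiv.prod_comp (Equiv.addRight (2 : ZMod n)) (fun i => 1 - z (.inl i) * z (.inr i))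
  have s4 := Equiv.prod_comp (Equiv.addRight (1 : ZMod n)) (fun i => z (.inr i))
  simp only [Equiv.coe_addRight, Equiv.subRight_apply] at s1 s2 s3 s4
  simp only [eval_O_self, eval_E_self, pentagramCoord, Sum.elim_inl, Sum.elim_inr,
    Finset.prod_div_distrib, Finset.prod_mul_distrib, s1, s2, s3, s4]
  exact ⟨mul_div_cancel_right₀ _ hs, mul_div_cancel_right₀ _ hs⟩

theorem TwistedPolygon.HasMonodromy.pentagram {φ : TwistedPolygon n} {M : PGL(3, ℝ)}
    (hM : φ.HasMonodromy M) (h : IsPolygon (pentagramVertex φ.vertex)) :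
    (φ.pentagram h).HasMonodromy M := by
  intro k
  have := pentagramVertex_smul (w := fun k => φ.vertex (k + n)) hM φ.isPolygon k
  simp only [pentagramVertex] at this
  simpa only [TwistedPolygon.pentagram, pentagramVertex, add_sub_right_comm, add_right_comm]
    using this

/-- The image polygon has the same monodromy, `O_n` and `E_n`. The trace formulas therefore give
equal cubes, and cubing is injective on the reals. -/
theorem sum_pentagramCoord (hn : 3 ≤ n) {z : Coord n} (h0 : ∀ a, z a ≠ 0)
    (h1 : ∀ i, z (.inl i) * z (.inr i) ≠ 1) :
    (∑ k ∈ Finset.Icc 1 (n / 2), MvPolynomial.eval (pentagramCoord z) (O n k) =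
      ∑ k ∈ Finset.Icc 1 (n / 2), MvPolynomial.eval z (O n k)) ∧
    ∑ k ∈ Finset.Icc 1 (n / 2), MvPolynomial.eval (pentagramCoord z) (E n k) =
      ∑ k ∈ Finset.Icc 1 (n / 2), MvPolynomial.eval z (E n k) := by
  obtain ⟨p, hp, rfl⟩ := exists_generic h0
  have hT := (mem_domT_iff hp).2 h1
  have hs := eval_pentagramCoord_self h1
  rw [← corner_T hT] at hs ⊢
  induction p using Quotient.inductionOn with | h φ => ?_
  obtain ⟨M, hM⟩ := φ.exists_monodromy
  induction M using Matrix.ProjGenLinGroup.induction_on with | mk M => ?_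
  change φ.toSpace ∈ domT n at hT
  change IsGenericPolygon φ.vertex at hp
  have hP : IsPolygon (pentagramVertex φ.vertex) := hT.2.1
  have e := T_toSpace hP
  have hg : IsGenericPolygon (φ.pentagram hP).vertex := by
    have := hT.2.2
    rwa [e] at this
  have hM' := TwistedPolygon.HasMonodromy.pentagram hM hP
  change MvPolynomial.eval (corner n (T n φ.toSpace)) (O n n) =
      MvPolynomial.eval (corner n φ.toSpace) (O n n) ∧
    MvPolynomial.eval (corner n (T n φ.toSpace)) (E n n) =
      MvPolynomial.eval (corner n φ.toSpace) (E n n) at hs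
  change (∑ k ∈ Finset.Icc 1 (n / 2), MvPolynomial.eval (corner n (T n φ.toSpace)) (O n k) =
      ∑ k ∈ Finset.Icc 1 (n / 2), MvPolynomial.eval (corner n φ.toSpace) (O n k)) ∧
    ∑ k ∈ Finset.Icc 1 (n / 2), MvPolynomial.eval (corner n (T n φ.toSpace)) (E n k) =
      ∑ k ∈ Finset.Icc 1 (n / 2), MvPolynomial.eval (corner n φ.toSpace) (E n k)
  have hinj := (Odd.strictMono_pow (by decide : Odd 3) (R := ℝ)).injective
  constructor
  · have e2 := trace_monodromy_inv hn hg hM'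
    rw [← e, hs.1, hs.2, trace_monodromy_inv hn hp hM] at e2
    exact (add_left_cancel (hinj e2)).symm
  · have e2 := trace_monodromy hn hg hM'
    rw [← e, hs.1, hs.2, trace_monodromy hn hp hM] at e2
    exact (add_left_cancel (hinj e2)).symm

theorem pentagramCoord_rescale {t : ℝ} (ht : t ≠ 0) (z : Coord n) :
    pentagramCoord (rescale t z) = rescale t (pentagramCoord z) := by
  have e : ∀ i, t * z (.inl i) * (t⁻¹ * z (.inr i)) = z (.inl i) * z (.inr i) := by
    intro i
    field_simp
  ext a
  rcases a with i | i <;> simp only [pentagramCoord, rescale, Sum.elim_inl, Sum.elim_inr, e] <;>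
    ring

theorem rescale_ne_zero {t : ℝ} (ht : t ≠ 0) {z : Coord n} (h0 : ∀ a, z a ≠ 0)
    (a : ZMod n ⊕ ZMod n) : rescale t z a ≠ 0 := by
  rcases a with i | i <;> simp [rescale, h0, ht]

theorem rescale_mul_ne_one {t : ℝ} (ht : t ≠ 0) {z : Coord n}
    (h1 : ∀ i, z (.inl i) * z (.inr i) ≠ 1) (i : ZMod n) :
    rescale t z (.inl i) * rescale t z (.inr i) ≠ 1 := by
  have e : t * z (.inl i) * (t⁻¹ * z (.inr i)) = z (.inl i) * z (.inr i) := by field_simp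
  simpa only [rescale, Sum.elim_inl, Sum.elim_inr, e] using h1 i

/-- The sum of the invariants is preserved at all rescalings of `z`, so its homogeneous parts are
preserved separately. -/
theorem eval_pentagramCoord (hn : 3 ≤ n) {z : Coord n} (h0 : ∀ a, z a ≠ 0)
    (h1 : ∀ i, z (.inl i) * z (.inr i) ≠ 1) {k : ℕ} (hk : k ∈ Finset.Icc 1 (n / 2)) :
    MvPolynomial.eval (pentagramCoord z) (O n k) = MvPolynomial.eval z (O n k) ∧
      MvPolynomial.eval (pentagramCoord z) (E n k) = MvPolynomial.eval z (E n k) := by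
  constructor
  · refine eq_of_sum_pow_eq (a := fun k => MvPolynomial.eval (pentagramCoord z) (O n k))
      (b := fun k => MvPolynomial.eval z (O n k)) infinite_ne_zero (fun s hs => ?_) hk
    have := (sum_pentagramCoord hn (rescale_ne_zero hs h0) (rescale_mul_ne_one hs h1)).1
    simpa only [pentagramCoord_rescale hs, eval_rescale_O _ _ _ hs] using this
  · refine eq_of_sum_pow_eq (a := fun k => MvPolynomial.eval (pentagramCoord z) (E n k))
      (b := fun k => MvPolynomial.eval z (E n k)) infinite_ne_zero (fun s hs => ?_) hk
    -- The weight of `E_k` is `-k`; rescaling by the inverse turns it into a positive power of `s`.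
    have hs' : s⁻¹ ≠ 0 := inv_ne_zero hs
    have := (sum_pentagramCoord hn (rescale_ne_zero hs' h0) (rescale_mul_ne_one hs' h1)).2
    simpa only [pentagramCoord_rescale hs', eval_rescale_E _ _ _ hs', inv_inv] using this

theorem isInvariant_monodromyInvariant (hn : 3 ≤ n) (i : InvIndex n ⊕ InvIndex n) :
    IsInvariant (monodromyInvariant n i).toFun := by
  intro p hp
  have h0 := corner_ne_zero hp.1
  have h1 := (mem_domT_iff hp.1).1 hp
  simp only [CornerPoly.toFun, corner_T hp]
  rcases i with ⟨k, hk⟩ | ⟨k, hk⟩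
  · rcases hk with hk | rfl
    · exact (eval_pentagramCoord hn h0 h1 (Finset.mem_Icc.2 hk)).1
    · exact (eval_pentagramCoord_self h1).1
  · rcases hk with hk | rfl
    · exact (eval_pentagramCoord hn h0 h1 (Finset.mem_Icc.2 hk)).2
    · exact (eval_pentagramCoord_self h1).2

end Monodromy

/-! ### Gauge transformations of transfer matrices -/

section Gauge

variable {R : Type*} [CommRing R]

/-- Matrices gauge equivalent to transfer matrices. -/
def gaugeMatrix (α β γ c d : R) : Matrix (Fin 3) (Fin 3) R :=
  !![1, α, β; γ, 0, c; d, 0, 0]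

/-- There are now two excursions of length two, through state `1` and through state `2`, and one of
length three. The triangular matrices `S i` satisfy `S i * A i = C i * S (i + 1)` and so merge both
short excursions into one entry of a transfer matrix. -/
theorem trace_chain_gaugeMatrix [IsDomain R] {n : ℕ} [NeZero n] (hn : 3 ≤ n)
    (α β γ c d : ZMod n → R) (hα : ∀ i, α i ≠ 0) (hc : ∀ i, c i ≠ 0) :
    (chain (fun i => gaugeMatrix (α i) (β i) (γ i) (c i) (d i)) n).trace =
      admissibleGen (fun i => α i * γ (i + 1) + β i * d (i + 1))
        (fun i => α i * c (i + 1) * d (i + 2)) := by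
  let S : ZMod n → Matrix (Fin 3) (Fin 3) R := fun i =>
    !![1, 0, 0; 0, α (i - 1), β (i - 1); 0, 0, α (i - 2) * c (i - 1)]
  set A : ZMod n → Matrix (Fin 3) (Fin 3) R := fun i =>
    gaugeMatrix (α i) (β i) (γ i) (c i) (d i)
  rw [← trace_chain_transfer hn]
  set C : ZMod n → Matrix (Fin 3) (Fin 3) R := fun i =>
    transfer (α (i - 1) * γ (i - 1 + 1) + β (i - 1) * d (i - 1 + 1))
      (α (i - 2) * c (i - 2 + 1) * d (i - 2 + 2))
  have h1 : ∀ i, S i * A i = C i * S (i + 1) := by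
    intro i
    have e1 : i + 1 - 2 = i - 1 := by ring
    have e2 : i - 2 + 1 = i - 1 := by ring
    ext a b
    fin_cases a <;> fin_cases b <;>
      simp [S, A, C, gaugeMatrix, transfer, Matrix.mul_apply, Fin.sum_univ_three, e1, e2]
  have h2 : ∀ k : ℕ, S 0 * chain A k = chain C k * S k := by
    intro k
    induction k with
    | zero => simp [chain]
    | succ k ih =>
      rw [chain, chain, ← Matrix.mul_assoc, ih, Matrix.mul_assoc, h1, ← Matrix.mul_assoc,
        Nat.cast_succ]
  have h3 := h2 n
  rw [ZMod.natCast_self] at h3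
  have hd : (S 0).det ≠ 0 := by
    have : (S 0).det = α (0 - 1) * (α (0 - 2) * c (0 - 1)) := by
      simp [S, Matrix.det_fin_three]
    rw [this]
    exact mul_ne_zero (hα _) (mul_ne_zero (hα _) (hc _))
  refine mul_left_cancel₀ hd ?_
  -- Over a domain the matrix `S 0` need not be invertible; the adjugate stands in for the inverse
  -- and the nonzero determinant is cancelled.
  have e1 : (S 0).det • chain A n = (S 0).adjugate * chain C n * S 0 := by
    rw [Matrix.mul_assoc, ← h3, ← Matrix.mul_assoc, Matrix.adjugate_mul, Matrix.smul_mul,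
      Matrix.one_mul]
  calc _ = ((S 0).det • chain A n).trace := by rw [Matrix.trace_smul, smul_eq_mul]
    _ = ((S 0).det • chain C n).trace := by
      rw [e1, Matrix.trace_mul_comm, ← Matrix.mul_assoc, Matrix.mul_adjugate, Matrix.smul_mul,
        Matrix.one_mul]
    _ = _ := by rw [Matrix.trace_smul, smul_eq_mul]

end Gauge

/-! ### Commuting traces for ultralocal brackets -/

section Ultralocal

variable {R : Type*} [CommRing R]

/-- A map of two arguments that is a derivation in each argument. -/
structure IsBiderivation (β : R → R → R) : Prop where
  add_left : ∀ a b c, β (a + b) c = β a c + β b c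
  add_right : ∀ a b c, β a (b + c) = β a b + β a c
  mul_left : ∀ a b c, β (a * b) c = a * β b c + b * β a c
  mul_right : ∀ a b c, β a (b * c) = b * β a c + c * β a b

namespace IsBiderivation

variable {β : R → R → R} (h : IsBiderivation β)
include h

theorem sum_left {ι : Type*} (s : Finset ι) (f : ι → R) (c : R) :
    β (∑ i ∈ s, f i) c = ∑ i ∈ s, β (f i) c :=
  map_sum (AddMonoidHom.mk' (fun a => β a c) (fun a b => h.add_left a b c)) f s

theorem sum_right {ι : Type*} (s : Finset ι) (f : ι → R) (c : R) :
    β c (∑ i ∈ s, f i) = ∑ i ∈ s, β c (f i) :=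
  map_sum (AddMonoidHom.mk' (fun a => β c a) (fun a b => h.add_right c a b)) f s

theorem zero_left (c : R) : β 0 c = 0 := by simpa using h.add_left 0 0 c

theorem zero_right (c : R) : β c 0 = 0 := by simpa using h.add_right c 0 0

theorem one_left (c : R) : β 1 c = 0 := by simpa using h.mul_left 1 1 c

theorem one_right (c : R) : β c 1 = 0 := by simpa using h.mul_right c 1 1

/-- By the Leibniz rule, and since different sites do not interact, the brackets of the entries of
two partial products again form a commutator with the same `K`, up to the factor `δ`. The trace of
the full commutator is zero. -/
theorem commute_trace {n : ℕ} {m : Type*} [Fintype m] [DecidableEq m]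
    {L N : ZMod n → Matrix m m R} {K : Matrix (m × m) (m × m) R} {δ : R}
    (hloc : ∀ i j, i ≠ j → ∀ a b c d, β (L i a b) (N j c d) = 0)
    (hsite : ∀ i, δ • (Matrix.of fun p q : m × m => β (L i p.1 q.1) (N i p.2 q.2)) =
      (Matrix.kronecker (L i) (N i)) * K - K * Matrix.kronecker (L i) (N i)) :
    δ * β (chain L n).trace (chain N n).trace = 0 := by
  have hcast : ∀ k l : ℕ, k < l → l < n → (k : ZMod n) ≠ l := by
    intro k l h1 h2 he
    rw [ZMod.natCast_eq_natCast_iff', Nat.mod_eq_of_lt (h1.trans h2), Nat.mod_eq_of_lt h2] at he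
    omega
  have hL : ∀ k l : ℕ, k ≤ l → l < n → ∀ a b c d, β (chain L k a b) (N l c d) = 0 := by
    intro k l h1 h2
    induction k with
    | zero =>
      intro a b c d
      rw [chain, Matrix.one_apply]
      split_ifs
      · exact h.one_left _
      · exact h.zero_left _
    | succ k ih =>
      intro a b c d
      rw [chain, Matrix.mul_apply, h.sum_left]
      refine Finset.sum_eq_zero fun e _ => ?_
      rw [h.mul_left, ih (by omega), hloc _ _ (hcast k l (by omega) h2), mul_zero, mul_zero,
        add_zero]
  have hN : ∀ k l : ℕ, k ≤ l → l < n → ∀ a b c d, β (L l c d) (chain N k a b) = 0 := by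
    intro k l h1 h2
    induction k with
    | zero =>
      intro a b c d
      rw [chain, Matrix.one_apply]
      split_ifs
      · exact h.one_right _
      · exact h.zero_right _
    | succ k ih =>
      intro a b c d
      rw [chain, Matrix.mul_apply, h.sum_right]
      refine Finset.sum_eq_zero fun e _ => ?_
      rw [h.mul_right, ih (by omega), hloc _ _ (hcast k l (by omega) h2).symm, mul_zero, mul_zero,
        add_zero]
  have key : ∀ k : ℕ, k ≤ n →
      δ • (Matrix.of fun p q : m × m => β (chain L k p.1 q.1) (chain N k p.2 q.2)) =
      (Matrix.kronecker (chain L k) (chain N k)) * K -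
        K * Matrix.kronecker (chain L k) (chain N k) := by
    intro k hk
    induction k with
    | zero =>
      have e0 : Matrix.kronecker (1 : Matrix m m R) (1 : Matrix m m R) = 1 :=
        Matrix.one_kronecker_one
      rw [chain, chain, e0, Matrix.one_mul, Matrix.mul_one, sub_self]
      ext p q
      simp only [Matrix.smul_apply, Matrix.of_apply, Matrix.one_apply, Matrix.zero_apply]
      split_ifs <;> simp [h.one_left, h.zero_left]
    | succ k ih =>
      have e1 : (Matrix.of fun p q : m × m => β (chain L (k + 1) p.1 q.1)
          (chain N (k + 1) p.2 q.2)) =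
          Matrix.kronecker (chain L k) (chain N k) *
            (Matrix.of fun p q : m × m => β (L k p.1 q.1) (N k p.2 q.2)) +
          (Matrix.of fun p q : m × m => β (chain L k p.1 q.1) (chain N k p.2 q.2)) *
            Matrix.kronecker (L k) (N k) := by
        ext ⟨a, b⟩ ⟨c, d⟩
        simp only [Matrix.of_apply, Matrix.add_apply, Matrix.mul_apply, chain,
          Fintype.sum_prod_type, ← Finset.sum_add_distrib, Matrix.kronecker,
          Matrix.kroneckerMap_apply]
        rw [h.sum_left]
        refine Finset.sum_congr rfl fun e _ => ?_
        rw [h.sum_right]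
        refine Finset.sum_congr rfl fun f _ => ?_
        rw [h.mul_left, h.mul_right, h.mul_right, hL k k le_rfl (by omega),
          hN k k le_rfl (by omega)]
        ring
      have e2 : Matrix.kronecker (chain L (k + 1)) (chain N (k + 1)) =
          Matrix.kronecker (chain L k) (chain N k) * Matrix.kronecker (L k) (N k) :=
        Matrix.mul_kronecker_mul _ _ _ _
      rw [e1, e2, smul_add, ← Matrix.mul_smul, ← Matrix.smul_mul, hsite, ih (by omega)]
      noncomm_ring
  have ht := congrArg Matrix.trace (key n le_rfl)
  rw [Matrix.trace_sub, Matrix.trace_mul_comm, sub_self, Matrix.trace_smul, smul_eq_mul] at ht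
  rw [← ht]
  congr 1
  simp only [Matrix.trace, Matrix.diag_apply, Matrix.of_apply, Fintype.sum_prod_type]
  rw [h.sum_left]
  refine Finset.sum_congr rfl fun a _ => ?_
  rw [h.sum_right]

end IsBiderivation

/-- The ultralocal transfer matrix for the invariants `E_k`. -/
def laxE (s P Q P' Q' : R) : Matrix (Fin 3) (Fin 3) R :=
  gaugeMatrix P' 0 (-(s * Q')) (s * Q' * P' * P) (Q * Q')

/-- The ultralocal transfer matrix for the invariants `O_k`. -/
def laxO (t P Q P' Q' : R) : Matrix (Fin 3) (Fin 3) R :=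
  gaugeMatrix (t * P * P') (-(t * P)) 0 (Q * Q' * P) Q


end Ultralocal

/-! ### Exchange relations -/

section Exchange

variable {R : Type*} [CommRing R]

/-- The exchange matrix for two matrices `laxE`. -/
def exchangeEE (s t : R) : Matrix (Fin 3 × Fin 3) (Fin 3 × Fin 3) R := fun p q =>
  (if q = p then (!![0, s, s; t, 0, t; t, s, 0] : Matrix (Fin 3) (Fin 3) R) p.1 p.2 else 0) -
    if q = p.swap then (!![0, t, s; s, 0, s; t, t, 0] : Matrix (Fin 3) (Fin 3) R) p.1 p.2 else 0

/-- The exchange matrix for `laxE` and `laxO`. -/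
def exchangeEO (s t : R) : Matrix (Fin 3 × Fin 3) (Fin 3 × Fin 3) R := fun p q =>
  (if p.2 = p.1 + 1 ∧ q.2 = q.1 + 1 then
    (!![-(s * t), -1, -s; -(s * t), -1, -s; -t, -t, -(s * t)] : Matrix (Fin 3) (Fin 3) R) p.1 q.1
    else 0) + if p = (2, 1) ∧ q = (2, 1) then 1 - s * t else 0

/-- The exchange matrix is a diagonal matrix minus a weighted swap of the tensor factors, so each
entry of a product with it has only two terms. The lemmas of this kind keep the entrywise checks
small. -/
theorem sum_mul_exchangeEE (s t : R) (X : Fin 3 → Fin 3 → R) (c d : Fin 3) :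
    ∑ e, ∑ f, X e f * exchangeEE s t (e, f) (c, d) =
      X c d * (!![0, s, s; t, 0, t; t, s, 0] : Matrix (Fin 3) (Fin 3) R) c d -
      X d c * (!![0, t, s; s, 0, s; t, t, 0] : Matrix (Fin 3) (Fin 3) R) d c := by
  simp only [exchangeEE, mul_sub, Finset.sum_sub_distrib, Prod.mk.injEq, Prod.swap_prod_mk,
    mul_ite, mul_zero]
  congr 1
  · rw [Finset.sum_eq_single c, Finset.sum_eq_single d] <;> simp +contextual [eq_comm]
  · rw [Finset.sum_eq_single d, Finset.sum_eq_single c] <;> simp +contextual [eq_comm]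

theorem sum_exchangeEE_mul (s t : R) (X : Fin 3 → Fin 3 → R) (a b : Fin 3) :
    ∑ e, ∑ f, exchangeEE s t (a, b) (e, f) * X e f =
      X a b * (!![0, s, s; t, 0, t; t, s, 0] : Matrix (Fin 3) (Fin 3) R) a b -
      X b a * (!![0, t, s; s, 0, s; t, t, 0] : Matrix (Fin 3) (Fin 3) R) a b := by
  simp only [exchangeEE, sub_mul, Finset.sum_sub_distrib, Prod.mk.injEq, Prod.swap_prod_mk,
    ite_mul, zero_mul]
  congr 1
  · rw [Finset.sum_eq_single a, Finset.sum_eq_single b] <;> simp +contextual [eq_comm, mul_comm]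
  · rw [Finset.sum_eq_single b, Finset.sum_eq_single a] <;> simp +contextual [eq_comm, mul_comm]

theorem sum_mul_exchangeEO (s t : R) (X : Fin 3 → Fin 3 → R) (c d : Fin 3) :
    ∑ e, ∑ f, X e f * exchangeEO s t (e, f) (c, d) =
      (if d = c + 1 then ∑ e, X e (e + 1) *
        (!![-(s * t), -1, -s; -(s * t), -1, -s; -t, -t, -(s * t)] : Matrix _ _ R) e c else 0) +
      if c = 2 ∧ d = 1 then X 2 1 * (1 - s * t) else 0 := by
  simp only [exchangeEO, mul_add, Finset.sum_add_distrib, Prod.mk.injEq, mul_ite, mul_zero]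
  congr 1
  · split_ifs with h
    · refine Finset.sum_congr rfl fun e _ => ?_
      rw [Finset.sum_eq_single (e + 1)] <;> simp +contextual [h]
    · simp [h]
  · rw [Finset.sum_eq_single 2, Finset.sum_eq_single 1] <;> simp +contextual

theorem sum_exchangeEO_mul (s t : R) (X : Fin 3 → Fin 3 → R) (a b : Fin 3) :
    ∑ e, ∑ f, exchangeEO s t (a, b) (e, f) * X e f =
      (if b = a + 1 then ∑ e, X e (e + 1) *
        (!![-(s * t), -1, -s; -(s * t), -1, -s; -t, -t, -(s * t)] : Matrix _ _ R) a e else 0) +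
      if a = 2 ∧ b = 1 then X 2 1 * (1 - s * t) else 0 := by
  simp only [exchangeEO, add_mul, Finset.sum_add_distrib, Prod.mk.injEq, ite_mul, zero_mul]
  congr 1
  · split_ifs with h
    · refine Finset.sum_congr rfl fun e _ => ?_
      rw [Finset.sum_eq_single (e + 1)] <;> simp +contextual [h, mul_comm]
    · simp [h]
  · rw [Finset.sum_eq_single 2, Finset.sum_eq_single 1] <;> simp +contextual [mul_comm]

/-- The exponents of the variables `P`, `Q`, `P'`, `Q'` in the entries of `laxE`. -/
def expE (v : Fin 4) : Matrix (Fin 3) (Fin 3) R :=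
  if v = 0 then !![0, 0, 0; 0, 0, 1; 0, 0, 0] else if v = 1 then !![0, 0, 0; 0, 0, 0; 1, 0, 0]
  else if v = 2 then !![0, 1, 0; 0, 0, 1; 0, 0, 0] else !![0, 0, 0; 1, 0, 1; 1, 0, 0]

/-- The exponents of the variables `P`, `Q`, `P'`, `Q'` in the entries of `laxO`. -/
def expO (v : Fin 4) : Matrix (Fin 3) (Fin 3) R :=
  if v = 0 then !![0, 1, 1; 0, 0, 1; 0, 0, 0] else if v = 1 then !![0, 0, 0; 0, 0, 1; 1, 0, 0]
  else if v = 2 then !![0, 1, 0; 0, 0, 0; 0, 0, 0] else !![0, 0, 0; 0, 0, 1; 0, 0, 0]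

/-- The logarithmic bracket of two monomials in `P`, `Q`, `P'`, `Q'` with given exponents. -/
def logBracket (e f : Fin 4 → R) : R :=
  e 0 * f 1 - e 1 * f 0 + e 3 * f 2 - e 2 * f 3

/-- All entries are monomials or zero, so the bracket of two entries is their product times a number
read off from the exponents. The relation is then a polynomial identity in each of the 81 entries.
-/
theorem site_EE (s t P Q P' Q' : R) :
    (s - t) • (Matrix.of fun p q : Fin 3 × Fin 3 =>
      logBracket (fun v => expE v p.1 q.1) (fun v => expE v p.2 q.2) *
        (laxE s P Q P' Q' p.1 q.1 * laxE t P Q P' Q' p.2 q.2)) =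
      Matrix.kronecker (laxE s P Q P' Q') (laxE t P Q P' Q') * exchangeEE s t -
        exchangeEE s t * Matrix.kronecker (laxE s P Q P' Q') (laxE t P Q P' Q') := by
  ext ⟨a, b⟩ ⟨c, d⟩
  simp only [Matrix.smul_apply, Matrix.of_apply, Matrix.sub_apply, Matrix.mul_apply,
    Fintype.sum_prod_type, Matrix.kronecker, Matrix.kroneckerMap_apply]
  rw [sum_mul_exchangeEE s t (fun e f => laxE s P Q P' Q' a e * laxE t P Q P' Q' b f),
    sum_exchangeEE_mul s t (fun e f => laxE s P Q P' Q' e c * laxE t P Q P' Q' f d)]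
  fin_cases a <;> fin_cases b <;> fin_cases c <;> fin_cases d <;>
    simp [logBracket, expE, laxE, gaugeMatrix] <;> ring

/-- The spectral factor is `1 - s t` instead of `s - t`, in accordance with the opposite weights of
the two families. -/
theorem site_EO (s t P Q P' Q' : R) :
    (1 - s * t) • (Matrix.of fun p q : Fin 3 × Fin 3 =>
      logBracket (fun v => expE v p.1 q.1) (fun v => expO v p.2 q.2) *
        (laxE s P Q P' Q' p.1 q.1 * laxO t P Q P' Q' p.2 q.2)) =
      Matrix.kronecker (laxE s P Q P' Q') (laxO t P Q P' Q') * exchangeEO s t -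
        exchangeEO s t * Matrix.kronecker (laxE s P Q P' Q') (laxO t P Q P' Q') := by
  ext ⟨a, b⟩ ⟨c, d⟩
  simp only [Matrix.smul_apply, Matrix.of_apply, Matrix.sub_apply, Matrix.mul_apply,
    Fintype.sum_prod_type, Matrix.kronecker, Matrix.kroneckerMap_apply]
  rw [sum_mul_exchangeEO s t (fun e f => laxE s P Q P' Q' a e * laxO t P Q P' Q' b f),
    sum_exchangeEO_mul s t (fun e f => laxE s P Q P' Q' e c * laxO t P Q P' Q' f d)]
  simp only [Fin.sum_univ_three, show (2 : Fin 3) + 1 = 0 from rfl, show (1 : Fin 3) + 1 = 2 from rfl,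
    show (0 : Fin 3) + 1 = 1 from rfl]
  fin_cases a <;> fin_cases b <;> fin_cases c <;> fin_cases d <;>
    simp [logBracket, expE, expO, laxE, laxO, gaugeMatrix] <;> ring

end Exchange

/-! ### Commuting polynomials -/

section Commuting

open MvPolynomial

variable {n : ℕ}

/-- The Euler derivation `X_v ∂/∂X_v`. -/
def euler {σ : Type*} (v : σ) : Derivation ℝ (MvPolynomial σ ℝ) (MvPolynomial σ ℝ) :=
  (X v : MvPolynomial σ ℝ) • pderiv v

theorem euler_X {σ : Type*} [DecidableEq σ] (v w : σ) :
    euler v (X w : MvPolynomial σ ℝ) = if v = w then X w else 0 := by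
  rw [euler, Derivation.smul_apply, pderiv_X, Pi.single_apply, smul_eq_mul]
  split_ifs with h1 h2 h2 <;> simp_all

theorem euler_C {σ : Type*} (v : σ) (r : ℝ) : euler v (C r : MvPolynomial σ ℝ) = 0 := by
  simp [euler]

theorem eval_euler {σ : Type*} (v : σ) (z : σ → ℝ) (F : MvPolynomial σ ℝ) :
    eval z (euler v F) = z v * eval z (pderiv v F) := by
  simp [euler]

/-- The ring of polynomials in the variables `P_i`, `Q_i`, `P'_i`, `Q'_i`. -/
abbrev SplitPoly (n : ℕ) : Type := MvPolynomial (ZMod n × Fin 4) ℝ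

/-- The ultralocal bracket. -/
def ultralocal [NeZero n] (F G : SplitPoly n) : SplitPoly n :=
  ∑ i, logBracket (fun v => euler (i, v) F) (fun v => euler (i, v) G)

theorem isBiderivation_ultralocal [NeZero n] : IsBiderivation (ultralocal (n := n)) where
  add_left a b c := by
    rw [ultralocal, ultralocal, ultralocal, ← Finset.sum_add_distrib]
    refine Finset.sum_congr rfl fun i _ => ?_
    simp only [logBracket, map_add]
    ring
  add_right a b c := by
    rw [ultralocal, ultralocal, ultralocal, ← Finset.sum_add_distrib]
    refine Finset.sum_congr rfl fun i _ => ?_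
    simp only [logBracket, map_add]
    ring
  mul_left a b c := by
    rw [ultralocal, ultralocal, ultralocal, Finset.mul_sum, Finset.mul_sum,
      ← Finset.sum_add_distrib]
    refine Finset.sum_congr rfl fun i _ => ?_
    simp only [logBracket, Derivation.leibniz, smul_eq_mul]
    ring
  mul_right a b c := by
    rw [ultralocal, ultralocal, ultralocal, Finset.mul_sum, Finset.mul_sum,
      ← Finset.sum_add_distrib]
    refine Finset.sum_congr rfl fun i _ => ?_
    simp only [logBracket, Derivation.leibniz, smul_eq_mul]
    ring

/-- The matrix `laxE` at the `i`-th site. -/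
def siteE (s : ℝ) (i : ZMod n) : Matrix (Fin 3) (Fin 3) (SplitPoly n) :=
  laxE (C s) (X (i, 0)) (X (i, 1)) (X (i, 2)) (X (i, 3))

/-- The matrix `laxO` at the `i`-th site. -/
def siteO (s : ℝ) (i : ZMod n) : Matrix (Fin 3) (Fin 3) (SplitPoly n) :=
  laxO (C s) (X (i, 0)) (X (i, 1)) (X (i, 2)) (X (i, 3))

theorem euler_siteE (s : ℝ) (i j : ZMod n) (v : Fin 4) (a b : Fin 3) :
    euler (j, v) (siteE s i a b) = if j = i then expE v a b * siteE s i a b else 0 := by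
  split_ifs with h
  · subst h
    fin_cases v <;> fin_cases a <;> fin_cases b <;>
      simp [siteE, laxE, gaugeMatrix, expE, euler_X] <;> ring
  · fin_cases a <;> fin_cases b <;>
      simp [siteE, laxE, gaugeMatrix, euler_X, h]

theorem euler_siteO (s : ℝ) (i j : ZMod n) (v : Fin 4) (a b : Fin 3) :
    euler (j, v) (siteO s i a b) = if j = i then expO v a b * siteO s i a b else 0 := by
  split_ifs with h
  · subst h
    fin_cases v <;> fin_cases a <;> fin_cases b <;>
      simp [siteO, laxO, gaugeMatrix, expO, euler_X] <;> ring
  · fin_cases a <;> fin_cases b <;>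
      simp [siteO, laxO, gaugeMatrix, euler_X, h]

/-- Each argument is an eigenvector of the Euler derivations at its own site and is killed by those
at all other sites. -/
theorem ultralocal_site [NeZero n] {F G : SplitPoly n} {i j : ZMod n} {e f : Fin 4 → SplitPoly n}
    (hF : ∀ k v, euler (k, v) F = if k = i then e v * F else 0)
    (hG : ∀ k v, euler (k, v) G = if k = j then f v * G else 0) :
    ultralocal F G = if i = j then logBracket e f * (F * G) else 0 := by
  simp only [ultralocal, hF, hG, logBracket]
  rw [Finset.sum_eq_single i]
  · simp only [if_true]
    split_ifs <;> ring
  · intro k _ hk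
    simp [hk]
  · simp

theorem ultralocal_trace_EE [NeZero n] {s t : ℝ} (h : s ≠ t) :
    ultralocal (chain (siteE (n := n) s) n).trace (chain (siteE t) n).trace = 0 := by
  have := isBiderivation_ultralocal.commute_trace (L := siteE (n := n) s) (N := siteE t)
    (K := exchangeEE (C s) (C t)) (δ := C s - C t)
    (fun i j hij a b c d => by
      rw [ultralocal_site (fun k v => euler_siteE s i k v a b)
        (fun k v => euler_siteE t j k v c d), if_neg hij])
    (fun i => by
      have := site_EE (C s : SplitPoly n) (C t) (X (i, 0)) (X (i, 1)) (X (i, 2)) (X (i, 3))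
      refine Eq.trans ?_ this
      congr 1
      ext p q : 2
      rw [Matrix.of_apply, Matrix.of_apply, ultralocal_site
        (fun k v => euler_siteE s i k v p.1 q.1) (fun k v => euler_siteE t i k v p.2 q.2),
        if_pos rfl]
      rfl)
  rw [← C_sub] at this
  exact (mul_eq_zero.1 this).resolve_left (C_ne_zero.2 (sub_ne_zero.2 h))

theorem ultralocal_trace_EO [NeZero n] {s t : ℝ} (h : s * t ≠ 1) :
    ultralocal (chain (siteE (n := n) s) n).trace (chain (siteO t) n).trace = 0 := by
  have := isBiderivation_ultralocal.commute_trace (L := siteE (n := n) s) (N := siteO t)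
    (K := exchangeEO (C s) (C t)) (δ := 1 - C s * C t)
    (fun i j hij a b c d => by
      rw [ultralocal_site (fun k v => euler_siteE s i k v a b)
        (fun k v => euler_siteO t j k v c d), if_neg hij])
    (fun i => by
      have := site_EO (C s : SplitPoly n) (C t) (X (i, 0)) (X (i, 1)) (X (i, 2)) (X (i, 3))
      refine Eq.trans ?_ this
      congr 1
      ext p q : 2
      rw [Matrix.of_apply, Matrix.of_apply, ultralocal_site
        (fun k v => euler_siteE s i k v p.1 q.1) (fun k v => euler_siteO t i k v p.2 q.2),
        if_pos rfl]
      rfl)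
  rw [← C_mul, ← C_1, ← C_sub] at this
  exact (mul_eq_zero.1 this).resolve_left (C_ne_zero.2 (sub_ne_zero.2 h.symm))

/-- The substitution `x_i = P_i Q_{i+1}`, `y_i = P'_i Q'_{i+1}`. -/
def split : CornerPoly n →ₐ[ℝ] SplitPoly n :=
  aeval (Sum.elim (fun i => X (i, 0) * X (i + 1, 1)) (fun i => X (i, 2) * X (i + 1, 3)))

theorem split_C (r : ℝ) : split (C r : CornerPoly n) = C r := by
  rw [split, aeval_C]
  rfl

theorem split_inl (i : ZMod n) :
    split (X (.inl i) : CornerPoly n) = X (i, 0) * X (i + 1, 1) := by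
  rw [split, aeval_X, Sum.elim_inl]

theorem split_inr (i : ZMod n) :
    split (X (.inr i) : CornerPoly n) = X (i, 2) * X (i + 1, 3) := by
  rw [split, aeval_X, Sum.elim_inr]

theorem split_one_add_sum (s : Finset ℕ) (r : ℝ) (F : ℕ → CornerPoly n) :
    split (1 + ∑ k ∈ s, C (r ^ k) * F k) = 1 + ∑ k ∈ s, C r ^ k * split (F k) := by
  simp only [map_add, map_one, map_sum, map_mul, map_pow, split_C]

/-- The coordinate containing a given variable. -/
def unsplit (v : ZMod n × Fin 4) : ZMod n ⊕ ZMod n :=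
  ![.inl v.1, .inl (v.1 - 1), .inr v.1, .inr (v.1 - 1)] v.2

/-- Every split variable occurs in the image of exactly one coordinate, with exponent one, so the
Euler derivation along it restricts to the one along that coordinate. -/
theorem euler_split (v : ZMod n × Fin 4) (F : CornerPoly n) :
    euler v (split F) = split (euler (unsplit v) F) := by
  induction F using MvPolynomial.induction_on with
  | C r =>
    rw [euler_C, map_zero]
    rw [split_C, euler_C]
  | add F G hF hG => simp only [map_add, hF, hG]
  | mul_X F a hF =>
    have key : euler v (split (X a : CornerPoly n)) = split (euler (unsplit v) (X a)) := by
      obtain ⟨j, v⟩ := v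
      rw [euler_X]
      have e : ∀ i : ZMod n, j = i + 1 ↔ j - 1 = i := fun i => sub_eq_iff_eq_add.symm
      rcases a with i | i <;> fin_cases v <;>
        simp [split_inl, split_inr, unsplit, euler_X, e] <;> split_ifs <;>
        simp [split_inl, split_inr, mul_comm]
    simp only [map_mul, Derivation.leibniz, hF, key, smul_eq_mul, map_add]

theorem trace_siteE [NeZero n] (hn : 3 ≤ n) {s : ℝ} (hs : s ≠ 0) :
    (chain (siteE (n := n) s) n).trace =
      split (1 + ∑ k ∈ Finset.Icc 1 (n / 2), C (s ^ k) * E n k) := by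
  have h := trace_chain_gaugeMatrix hn (fun i : ZMod n => (X (i, 2) : SplitPoly n)) (fun _ => 0)
    (fun i => -(C s * X (i, 3))) (fun i => C s * X (i, 3) * X (i, 2) * X (i, 0))
    (fun i => X (i, 1) * X (i, 3)) (fun i => X_ne_zero _)
    (fun i => mul_ne_zero (mul_ne_zero (mul_ne_zero (C_ne_zero.2 hs) (X_ne_zero _))
      (X_ne_zero _)) (X_ne_zero _))
  have h2 := admissibleGen_eq_sum_E hn (split (n := n) : CornerPoly n →+* SplitPoly n) (C s)
  simp only [RingHom.coe_coe] at h2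
  rw [split_one_add_sum, ← h2]
  refine h.trans ?_
  congr 1
  · funext i
    rw [yVar, split_inr]
    ring
  · funext i
    rw [map_mul, map_mul, yVar, xVar, yVar, split_inr, split_inl, split_inr,
      show i + 1 + 1 = i + 2 by ring]
    ring

/-- Here `γ = 0` and the short excursions pass through state `2`; for `siteE` it is `β = 0` and they
pass through state `1`. -/
theorem trace_siteO [NeZero n] (hn : 3 ≤ n) {s : ℝ} (hs : s ≠ 0) :
    (chain (siteO (n := n) s) n).trace =
      split (1 + ∑ k ∈ Finset.Icc 1 (n / 2), C (s ^ k) * O n k) := by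
  have h := trace_chain_gaugeMatrix hn (fun i : ZMod n => (C s * X (i, 0) * X (i, 2) : SplitPoly n))
    (fun i => -(C s * X (i, 0)))
    (fun i => 0) (fun i => X (i, 1) * X (i, 3) * X (i, 0))
    (fun i => X (i, 1))
    (fun i => mul_ne_zero (mul_ne_zero (C_ne_zero.2 hs) (X_ne_zero _)) (X_ne_zero _))
    (fun i => mul_ne_zero (mul_ne_zero (X_ne_zero _) (X_ne_zero _)) (X_ne_zero _))
  have h2 := admissibleGen_eq_sum_O hn (split (n := n) : CornerPoly n →+* SplitPoly n) (C s)
  simp only [RingHom.coe_coe] at h2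
  rw [split_one_add_sum, ← h2]
  refine h.trans ?_
  congr 1
  · funext i
    rw [xVar, split_inl]
    ring
  · funext i
    rw [map_mul, map_mul, yVar, xVar, xVar, split_inr, split_inl, split_inl,
      show i + 1 + 1 = i + 2 by ring]
    ring

/-! ### The bracket as a constant form on logarithmic gradients. -/

/-- The logarithmic bracket of two covectors. -/
def logForm [NeZero n] (u v : Coord n) : ℝ := ∑ a, ∑ b, bracketCoeff a b * u a * v b

/-- The logarithmic gradient of a polynomial. -/
def logGrad (z : Coord n) (F : CornerPoly n) : Coord n := fun a => eval z (euler a F)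

theorem sum_bracketCoeff [NeZero n] (hn : 3 ≤ n) (v : Coord n) (i : ZMod n) :
    ∑ b, bracketCoeff (.inl i) b * v b = v (.inl (i - 1)) - v (.inl (i + 1)) ∧
      ∑ b, bracketCoeff (.inr i) b * v b = v (.inr (i + 1)) - v (.inr (i - 1)) := by
  have h : i - 1 ≠ i + 1 := by
    intro h
    refine (zmod_ne hn (i - 1)).2 ?_
    rw [show i - 1 + 2 = i + 1 by ring]
    exact h
  have key : ∀ (w : ZMod n → ℝ) (r : ℝ),
      ∑ j, (if j = i + 1 then r else if j = i - 1 then -r else 0) * w j =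
        r * w (i + 1) - r * w (i - 1) := by
    intro w r
    rw [← Finset.add_sum_erase _ _ (Finset.mem_univ (i + 1)),
      ← Finset.add_sum_erase _ _ (Finset.mem_erase.2 ⟨h, Finset.mem_univ (i - 1)⟩),
      Finset.sum_eq_zero]
    · rw [if_pos rfl, if_neg h, if_pos rfl]
      ring
    · intro j hj
      simp only [Finset.mem_erase] at hj
      rw [if_neg hj.2.1, if_neg hj.1, zero_mul]
  have k1 := key (fun j => v (.inl j)) (-1)
  have k2 := key (fun j => v (.inr j)) 1
  rw [neg_neg] at k1
  constructor
  · simp only [Fintype.sum_sum_type, bracketCoeff, zero_mul, Finset.sum_const_zero, add_zero]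
    rw [k1]
    ring
  · simp only [Fintype.sum_sum_type, bracketCoeff, zero_mul, Finset.sum_const_zero, zero_add]
    rw [k2]
    ring

/-- Summation by parts groups the terms by neighbouring pairs `i - 1`, `i`; each pair becomes the
bracket at the site `i` after splitting. -/
theorem logForm_eq [NeZero n] (hn : 3 ≤ n) (u v : Coord n) :
    logForm u v = ∑ i, (u (.inl i) * v (.inl (i - 1)) - u (.inl (i - 1)) * v (.inl i) +
      (u (.inr (i - 1)) * v (.inr i) - u (.inr i) * v (.inr (i - 1)))) := by
  have e : logForm u v = ∑ a, u a * ∑ b, bracketCoeff a b * v b := by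
    refine Finset.sum_congr rfl fun a _ => ?_
    rw [Finset.mul_sum]
    exact Finset.sum_congr rfl fun b _ => by ring
  rw [e, Fintype.sum_sum_type]
  simp only [(sum_bracketCoeff hn v _).1, (sum_bracketCoeff hn v _).2, mul_sub,
    Finset.sum_sub_distrib, Finset.sum_add_distrib]
  have k1 := Equiv.sum_comp (Equiv.addRight (1 : ZMod n)) (fun i => u (.inl (i - 1)) * v (.inl i))
  have k2 := Equiv.sum_comp (Equiv.addRight (1 : ZMod n)) (fun i => u (.inr (i - 1)) * v (.inr i))
  simp only [Equiv.coe_addRight, add_sub_cancel_right] at k1 k2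
  rw [k1, k2]

theorem logForm_logGrad [NeZero n] (hn : 3 ≤ n) {F G : CornerPoly n}
    (h : ultralocal (split F) (split G) = 0) (z : Coord n) :
    logForm (logGrad z F) (logGrad z G) = 0 := by
  -- At `P = x`, `P' = y`, `Q = Q' = 1` the split coordinates take the values of the original ones.
  have hw : ∀ F : CornerPoly n, eval (fun v : ZMod n × Fin 4 =>
      (![z (.inl v.1), 1, z (.inr v.1), 1] : Fin 4 → ℝ) v.2) (split F) = eval z F := by
    intro F
    induction F using MvPolynomial.induction_on with
    | C r => rw [split_C, eval_C, eval_C]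
    | add F G hF hG => simp only [map_add, hF, hG]
    | mul_X F a hF =>
      rw [map_mul, map_mul, hF, map_mul]
      rcases a with i | i <;> simp [split_inl, split_inr]
  have := congrArg (eval (fun v : ZMod n × Fin 4 =>
      (![z (.inl v.1), 1, z (.inr v.1), 1] : Fin 4 → ℝ) v.2)) h
  rw [map_zero] at this
  rw [← this, logForm_eq hn, ultralocal, map_sum]
  refine Finset.sum_congr rfl fun i _ => ?_
  simp only [logBracket, euler_split, map_add, map_sub, map_mul, hw]
  simp only [logGrad, unsplit, Matrix.cons_val]
  ring

theorem logForm_sum_left [NeZero n] {ι : Type*} (s : Finset ι) (c : ι → ℝ) (u : ι → Coord n)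
    (v : Coord n) : logForm (∑ i ∈ s, c i • u i) v = ∑ i ∈ s, c i * logForm (u i) v := by
  simp only [logForm, Finset.mul_sum, Finset.sum_apply, Finset.sum_mul, Pi.smul_apply, smul_eq_mul]
  rw [Finset.sum_comm' (t' := Finset.univ) (s' := fun _ => s) (by simp)]
  refine Finset.sum_congr rfl fun a _ => ?_
  rw [Finset.sum_comm]
  exact Finset.sum_congr rfl fun b _ => Finset.sum_congr rfl fun i _ => by ring

theorem bracketCoeff_swap (hn : 3 ≤ n) (a b : ZMod n ⊕ ZMod n) :
    bracketCoeff a b = -bracketCoeff b a := by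
  have h : ∀ i : ZMod n, i - 1 ≠ i + 1 := by
    intro i h
    refine (zmod_ne hn (i - 1)).2 ?_
    rw [show i - 1 + 2 = i + 1 by ring]
    exact h
  have e1 : ∀ i j : ZMod n, i = j + 1 ↔ j = i - 1 := fun i j => by
    rw [eq_sub_iff_add_eq, eq_comm]
  have e2 : ∀ i j : ZMod n, i = j - 1 ↔ j = i + 1 := fun i j => by
    rw [eq_sub_iff_add_eq, eq_comm]
  rcases a with i | i <;> rcases b with j | j <;> simp only [bracketCoeff, neg_zero]
  · simp only [e1 i j, e2 i j]
    split_ifs with h1 h2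
    · exact absurd (h2.symm.trans h1) (h i)
    all_goals norm_num
  · simp only [e1 i j, e2 i j]
    split_ifs with h1 h2
    · exact absurd (h2.symm.trans h1) (h i)
    all_goals norm_num

theorem logForm_swap [NeZero n] (hn : 3 ≤ n) (u v : Coord n) : logForm u v = -logForm v u := by
  simp only [logForm]
  rw [Finset.sum_comm, ← Finset.sum_neg_distrib]
  refine Finset.sum_congr rfl fun a _ => ?_
  rw [← Finset.sum_neg_distrib]
  refine Finset.sum_congr rfl fun b _ => ?_
  rw [bracketCoeff_swap hn]
  ring

theorem logForm_sum_right [NeZero n] (hn : 3 ≤ n) {ι : Type*} (s : Finset ι) (c : ι → ℝ)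
    (u : ι → Coord n) (v : Coord n) :
    logForm v (∑ i ∈ s, c i • u i) = ∑ i ∈ s, c i * logForm v (u i) := by
  rw [logForm_swap hn, logForm_sum_left, ← Finset.sum_neg_distrib]
  exact Finset.sum_congr rfl fun i _ => by rw [logForm_swap hn (u i), mul_neg, neg_neg]

theorem logGrad_one_add_sum (z : Coord n) (s : Finset ℕ) (c : ℕ → ℝ) (F : ℕ → CornerPoly n) :
    logGrad z (1 + ∑ k ∈ s, C (c k) * F k) = ∑ k ∈ s, c k • logGrad z (F k) := by
  funext a
  simp [logGrad, Finset.sum_apply]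

/-- The form on two generating functions is polynomial in `s` and in `t`. The set `S s` leaves out
the values of `t` at which the spectral factor vanishes, and remains infinite. -/
theorem logForm_eq_zero_of_generating [NeZero n] (hn : 3 ≤ n) {F G : ℕ → CornerPoly n}
    {S : ℝ → Set ℝ} (hS : ∀ s, (S s).Infinite)
    (h : ∀ s, s ≠ 0 → ∀ t ∈ S s, ultralocal
      (split (1 + ∑ k ∈ Finset.Icc 1 (n / 2), C (s ^ k) * F k))
      (split (1 + ∑ k ∈ Finset.Icc 1 (n / 2), C (t ^ k) * G k)) = 0) (z : Coord n) {k l : ℕ}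
    (hk : k ∈ Finset.Icc 1 (n / 2)) (hl : l ∈ Finset.Icc 1 (n / 2)) :
    logForm (logGrad z (F k)) (logGrad z (G l)) = 0 := by
  refine eq_of_sum_pow_eq (a := fun k => logForm (logGrad z (F k)) (logGrad z (G l)))
    (b := fun _ => 0) infinite_ne_zero (fun s hs => ?_) hk
  rw [← logForm_sum_left]
  simp only [mul_zero, Finset.sum_const_zero]
  refine eq_of_sum_pow_eq (b := fun _ => 0)
    (a := fun l => logForm (∑ k ∈ Finset.Icc 1 (n / 2), s ^ k • logGrad z (F k))
      (logGrad z (G l))) (hS s) (fun t ht => ?_) hl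
  rw [← logForm_sum_right hn]
  simp only [mul_zero, Finset.sum_const_zero]
  rw [← logGrad_one_add_sum, ← logGrad_one_add_sum]
  exact logForm_logGrad hn (h s hs t ht) z

theorem infinite_compl_pair (a b : ℝ) : {t : ℝ | t ≠ a ∧ t ≠ b}.Infinite := by
  have : {t : ℝ | t ≠ a ∧ t ≠ b} = ({a, b} : Set ℝ)ᶜ := by
    ext t
    simp
  rw [this]
  exact (Set.toFinite _).infinite_compl

theorem logForm_E_E [NeZero n] (hn : 3 ≤ n) (z : Coord n) {k l : ℕ}
    (hk : k ∈ Finset.Icc 1 (n / 2)) (hl : l ∈ Finset.Icc 1 (n / 2)) :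
    logForm (logGrad z (E n k)) (logGrad z (E n l)) = 0 := by
  refine logForm_eq_zero_of_generating hn (fun s => infinite_compl_pair 0 s)
    (fun s hs t ht => ?_) z hk hl
  rw [← trace_siteE hn hs, ← trace_siteE hn ht.1]
  exact ultralocal_trace_EE ht.2.symm

theorem logForm_E_O [NeZero n] (hn : 3 ≤ n) (z : Coord n) {k l : ℕ}
    (hk : k ∈ Finset.Icc 1 (n / 2)) (hl : l ∈ Finset.Icc 1 (n / 2)) :
    logForm (logGrad z (E n k)) (logGrad z (O n l)) = 0 := by
  refine logForm_eq_zero_of_generating hn (fun s => infinite_compl_pair 0 s⁻¹)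
    (fun s hs t ht => ?_) z hk hl
  rw [← trace_siteE hn hs, ← trace_siteO hn ht.1]
  refine ultralocal_trace_EO fun h => ht.2 ?_
  exact eq_inv_of_mul_eq_one_right h

theorem logGrad_rename_flip (z : Coord n) (F : CornerPoly n) :
    logGrad z (rename flip F) = logGrad (z ∘ flip) F ∘ flip := by
  funext a
  have key : euler a (rename flip F) = rename flip (euler (flip a) F) := by
    induction F using MvPolynomial.induction_on with
    | C r => simp
    | add F G hF hG => simp only [map_add, hF, hG]
    | mul_X F b hF =>
      have e : a = flip b ↔ flip a = b :=
        ⟨fun h => by rw [h, flip_flip], fun h => by rw [← h, flip_flip]⟩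
      simp only [map_mul, Derivation.leibniz, hF, rename_X, euler_X, e, smul_eq_mul, map_add]
      split_ifs <;> simp
  rw [Function.comp_apply, logGrad, key, eval_rename, logGrad]

/-- Reversal interchanges the two neighbours and swaps `x` with `y`, whose brackets have opposite
signs; the two sign changes cancel. -/
theorem logForm_comp_flip [NeZero n] (hn : 3 ≤ n) (u v : Coord n) :
    logForm (u ∘ flip) (v ∘ flip) = logForm u v := by
  have hc : ∀ a b : ZMod n ⊕ ZMod n, bracketCoeff (flip a) (flip b) = bracketCoeff a b := by
    intro a b
    have e1 : ∀ i j : ZMod n, -j = -i + 1 ↔ j = i - 1 := fun i j =>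
      ⟨fun h => by linear_combination -h, fun h => by linear_combination -h⟩
    have e2 : ∀ i j : ZMod n, -j = -i - 1 ↔ j = i + 1 := fun i j =>
      ⟨fun h => by linear_combination -h, fun h => by linear_combination -h⟩
    have h : ∀ i : ZMod n, i - 1 ≠ i + 1 := by
      intro i h
      refine (zmod_ne hn (i - 1)).2 ?_
      rw [show i - 1 + 2 = i + 1 by ring]
      exact h
    rcases a with i | i <;> rcases b with j | j <;>
      simp only [flip, Sum.elim_inl, Sum.elim_inr, bracketCoeff, e1, e2]
    · split_ifs with h1 h2
      · exact absurd (h1.symm.trans h2) (h i)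
      all_goals rfl
    · split_ifs with h1 h2
      · exact absurd (h1.symm.trans h2) (h i)
      all_goals rfl
  let e : ZMod n ⊕ ZMod n ≃ ZMod n ⊕ ZMod n := ⟨flip, flip, flip_flip, flip_flip⟩
  rw [logForm, logForm, ← e.sum_comp]
  refine Finset.sum_congr rfl fun a _ => ?_
  rw [← e.sum_comp]
  refine Finset.sum_congr rfl fun b _ => ?_
  simp [e, hc, flip_flip]

/-- Reversal carries this to the case of two `E`'s, so no third exchange relation is needed. -/
theorem logForm_O_O [NeZero n] (hn : 3 ≤ n) (z : Coord n) {k l : ℕ}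
    (hk : k ∈ Finset.Icc 1 (n / 2)) (hl : l ∈ Finset.Icc 1 (n / 2)) :
    logForm (logGrad z (O n k)) (logGrad z (O n l)) = 0 := by
  rw [← rename_flip_E, ← rename_flip_E]
  rw [logGrad_rename_flip, logGrad_rename_flip, logForm_comp_flip hn]
  exact logForm_E_E hn _ hk hl

theorem logForm_left_of_period [NeZero n] (hn : 3 ≤ n) {u : Coord n}
    (hx : ∀ i, u (.inl (i - 1)) = u (.inl (i + 1)))
    (hy : ∀ i, u (.inr (i - 1)) = u (.inr (i + 1))) (v : Coord n) : logForm v u = 0 := by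
  refine Finset.sum_eq_zero fun a _ => ?_
  have : ∑ b, bracketCoeff a b * v a * u b = v a * ∑ b, bracketCoeff a b * u b := by
    rw [Finset.mul_sum]
    exact Finset.sum_congr rfl fun b _ => by ring
  rw [this]
  rcases a with i | i
  · rw [(sum_bracketCoeff hn u i).1, hx, sub_self, mul_zero]
  · rw [(sum_bracketCoeff hn u i).2, hy, sub_self, mul_zero]

end Commuting

/-! ### The bracket in logarithmic coordinates -/

section Calculus

open Filter Topology

variable {n : ℕ} [NeZero n]

/-- The image of the generic part under the corner invariants. -/
def regular (n : ℕ) : Set (Coord n) := {z | ∀ a, z a ≠ 0}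

theorem isOpen_regular : IsOpen (regular n) := by
  simp only [regular, Set.ofPred_forall]
  exact isOpen_iInter_of_finite fun a => isOpen_ne_fun (continuous_apply a) continuous_const

theorem coordRep_corner {p : PolygonSpace n} (hp : p ∈ generic n) (f : PolygonSpace n → ℝ) :
    coordRep f (corner n p) = f p := by
  have : Function.Injective (fun p : generic n => corner n p) :=
    fun p q h => Subtype.ext (corner_injOn n p.2 q.2 h)
  exact this.extend_apply _ _ ⟨p, hp⟩

/-- Identities on the generic part hold on an open set of coordinates, and so they may be
differentiated. -/
theorem coordRep_eventuallyEq {f : PolygonSpace n → ℝ} {F : Coord n → ℝ}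
    (h : ∀ p ∈ generic n, f p = F (corner n p)) {z : Coord n} (hz : z ∈ regular n) :
    coordRep f =ᶠ[𝓝 z] F := by
  filter_upwards [isOpen_regular.mem_nhds hz] with w hw
  obtain ⟨p, hp, rfl⟩ := exists_generic hw
  rw [coordRep_corner hp, h p hp]

theorem IsSmooth.contDiffAt {f : PolygonSpace n → ℝ} (hf : IsSmooth f) {z : Coord n}
    (hz : z ∈ regular n) : ContDiffAt ℝ ∞ (coordRep f) z := by
  rw [IsSmooth, corner_image] at hf
  exact hf.contDiffAt (isOpen_regular.mem_nhds hz)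

theorem isSmooth_of_eq {f : PolygonSpace n → ℝ} (F : Coord n → ℝ)
    (h : ∀ p ∈ generic n, f p = F (corner n p))
    (hF : ∀ z ∈ regular n, ContDiffAt ℝ ∞ F z) : IsSmooth f := by
  rw [IsSmooth, corner_image]
  intro z hz
  exact ((hF z hz).congr_of_eventuallyEq (coordRep_eventuallyEq h hz)).contDiffWithinAt

/-- The logarithmic gradient of a function. -/
def eulerGrad (F : Coord n → ℝ) (z : Coord n) : Coord n :=
  fun a => z a * fderiv ℝ F z (Pi.single a 1)

theorem eulerGrad_congr {F G : Coord n → ℝ} {z : Coord n} (h : F =ᶠ[𝓝 z] G) :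
    eulerGrad F z = eulerGrad G z := by
  funext a
  rw [eulerGrad, eulerGrad, h.fderiv_eq]

theorem bracket_eq (f g : PolygonSpace n → ℝ) (p : PolygonSpace n) :
    bracket f g p =
      logForm (eulerGrad (coordRep f) (corner n p)) (eulerGrad (coordRep g) (corner n p)) := by
  refine Finset.sum_congr rfl fun a _ => Finset.sum_congr rfl fun b _ => ?_
  simp only [eulerGrad, differential]
  ring

theorem eulerGrad_add {F G : Coord n → ℝ} {z : Coord n} (hF : DifferentiableAt ℝ F z)
    (hG : DifferentiableAt ℝ G z) : eulerGrad (F + G) z = eulerGrad F z + eulerGrad G z := by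
  funext a
  simp only [eulerGrad, fderiv_add hF hG, _root_.add_apply, Pi.add_apply]
  ring

theorem eulerGrad_smul (c : ℝ) {F : Coord n → ℝ} {z : Coord n} (hF : DifferentiableAt ℝ F z) :
    eulerGrad (c • F) z = c • eulerGrad F z := by
  funext a
  simp only [eulerGrad, fderiv_const_smul hF, _root_.smul_apply, Pi.smul_apply,
    smul_eq_mul]
  ring

theorem eulerGrad_mul {F G : Coord n → ℝ} {z : Coord n} (hF : DifferentiableAt ℝ F z)
    (hG : DifferentiableAt ℝ G z) :
    eulerGrad (F * G) z = F z • eulerGrad G z + G z • eulerGrad F z := by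
  funext a
  simp only [eulerGrad, fderiv_mul hF hG, _root_.add_apply,
    _root_.smul_apply, Pi.smul_apply, Pi.add_apply, smul_eq_mul]
  ring

theorem logForm_add_left (u v w : Coord n) : logForm (u + v) w = logForm u w + logForm v w := by
  simp only [logForm, ← Finset.sum_add_distrib, Pi.add_apply]
  exact Finset.sum_congr rfl fun a _ => Finset.sum_congr rfl fun b _ => by ring

theorem logForm_smul_left (c : ℝ) (u w : Coord n) : logForm (c • u) w = c * logForm u w := by
  simp only [logForm, Finset.mul_sum, Pi.smul_apply, smul_eq_mul]
  exact Finset.sum_congr rfl fun a _ => Finset.sum_congr rfl fun b _ => by ring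

theorem contDiffAt_eulerGrad {F : Coord n → ℝ} {z : Coord n} (hF : ContDiffAt ℝ ∞ F z)
    (a : ZMod n ⊕ ZMod n) : ContDiffAt ℝ ∞ (fun w => eulerGrad F w a) z :=
  (contDiff_apply ℝ ℝ a).contDiffAt.mul
    ((hF.fderiv_right (m := ∞) (by norm_cast)).clm_apply contDiffAt_const)

theorem contDiffAt_logForm {F G : Coord n → ℝ} {z : Coord n} (hF : ContDiffAt ℝ ∞ F z)
    (hG : ContDiffAt ℝ ∞ G z) :
    ContDiffAt ℝ ∞ (fun w => logForm (eulerGrad F w) (eulerGrad G w)) z := by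
  unfold logForm
  exact ContDiffAt.sum fun a _ => ContDiffAt.sum fun b _ =>
    (contDiffAt_const.mul (contDiffAt_eulerGrad hF a)).mul (contDiffAt_eulerGrad hG b)

/-- The logarithmic Hessian of a function. -/
def eulerHess (F : Coord n → ℝ) (z : Coord n) :
    Matrix (ZMod n ⊕ ZMod n) (ZMod n ⊕ ZMod n) ℝ :=
  fun a b => eulerGrad (fun w => eulerGrad F w b) z a

/-- The operators `z_a ∂_a` commute: besides the symmetric second derivative there is a first-order
term only for `a = b`. -/
theorem eulerHess_transpose {F : Coord n → ℝ} {z : Coord n} (hF : ContDiffAt ℝ ∞ F z) :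
    (eulerHess F z)ᵀ = eulerHess F z := by
  have hd : DifferentiableAt ℝ (fderiv ℝ F) z :=
    (hF.fderiv_right (m := ∞) (by norm_cast)).differentiableAt (by simp)
  have hs := hF.isSymmSndFDerivAt (by
    rw [minSmoothness_of_isRCLikeNormedField]
    exact WithTop.coe_le_coe.2 le_top)
  have key : ∀ a b, eulerHess F z a b = z a * ((Pi.single a 1 : Coord n) b *
      fderiv ℝ F z (Pi.single b 1) +
      z b * fderiv ℝ (fderiv ℝ F) z (Pi.single a 1) (Pi.single b 1)) := by
    intro a b
    have h1 : HasFDerivAt (fun w : Coord n => w b)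
      (ContinuousLinearMap.proj (R := ℝ) (φ := fun _ => ℝ) b) z :=
      (ContinuousLinearMap.proj (R := ℝ) (φ := fun _ => ℝ) b).hasFDerivAt
    have h2 := h1.fun_mul (hd.hasFDerivAt.clm_apply (hasFDerivAt_const (Pi.single b 1 : Coord n) z))
    simp only [eulerHess, eulerGrad]
    rw [h2.fderiv]
    simp
    left
    ring
  ext a b
  rw [Matrix.transpose_apply, key, key, hs]
  by_cases h : a = b
  · subst h
    rfl
  · rw [Pi.single_eq_of_ne (Ne.symm h), Pi.single_eq_of_ne h]
    ring

/-- The matrix of the coefficients of the bracket. -/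
def coeffMatrix (n : ℕ) : Matrix (ZMod n ⊕ ZMod n) (ZMod n ⊕ ZMod n) ℝ :=
  fun a b => bracketCoeff a b

theorem logForm_eq_dotProduct (u v : Coord n) : logForm u v = u ⬝ᵥ coeffMatrix n *ᵥ v := by
  simp only [logForm, dotProduct, Matrix.mulVec, Finset.mul_sum, coeffMatrix]
  exact Finset.sum_congr rfl fun a _ => Finset.sum_congr rfl fun b _ => by ring

theorem coeffMatrix_transpose (hn : 3 ≤ n) : (coeffMatrix n)ᵀ = -coeffMatrix n := by
  ext a b
  exact bracketCoeff_swap hn b a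

theorem eulerGrad_logForm (hn : 3 ≤ n) {F G : Coord n → ℝ} {z : Coord n}
    (hF : ContDiffAt ℝ ∞ F z) (hG : ContDiffAt ℝ ∞ G z) :
    eulerGrad (fun w => logForm (eulerGrad F w) (eulerGrad G w)) z =
      eulerHess F z *ᵥ (coeffMatrix n *ᵥ eulerGrad G z) -
        eulerHess G z *ᵥ (coeffMatrix n *ᵥ eulerGrad F z) := by
  have hd : ∀ {F : Coord n → ℝ}, ContDiffAt ℝ ∞ F z → ∀ a,
      DifferentiableAt ℝ (fun w => eulerGrad F w a) z :=
    fun hF a => (contDiffAt_eulerGrad hF a).differentiableAt (by simp)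
  have e : ∀ a b, HasFDerivAt (fun w => bracketCoeff a b * eulerGrad F w a * eulerGrad G w b)
      (bracketCoeff a b • (eulerGrad F z a • fderiv ℝ (fun w => eulerGrad G w b) z +
        eulerGrad G z b • fderiv ℝ (fun w => eulerGrad F w a) z)) z := by
    intro a b
    have := ((hd hF a).hasFDerivAt.fun_mul (hd hG b).hasFDerivAt).const_mul (bracketCoeff a b)
    simpa only [mul_assoc] using this
  have e2 := HasFDerivAt.fun_sum (u := Finset.univ) fun a _ =>
    HasFDerivAt.fun_sum (u := Finset.univ) fun b _ => e a b
  funext d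
  have e3 : eulerGrad (fun w => logForm (eulerGrad F w) (eulerGrad G w)) z d =
      ∑ a, ∑ b, bracketCoeff a b * (eulerGrad F z a * eulerHess G z d b +
        eulerGrad G z b * eulerHess F z d a) := by
    rw [eulerGrad]
    unfold logForm
    rw [e2.fderiv]
    simp only [_root_.sum_apply, _root_.smul_apply,
      _root_.add_apply, smul_eq_mul, Finset.mul_sum, eulerHess]
    refine Finset.sum_congr rfl fun a _ => Finset.sum_congr rfl fun b _ => ?_
    rw [eulerGrad.eq_def (fun w => eulerGrad G w b), eulerGrad.eq_def (fun w => eulerGrad F w a)]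
    ring
  rw [e3]
  simp only [Pi.sub_apply, Matrix.mulVec, dotProduct, coeffMatrix, Finset.mul_sum, mul_add,
    Finset.sum_add_distrib]
  rw [add_comm, sub_eq_add_neg, ← Finset.sum_neg_distrib]
  congr 1
  · exact Finset.sum_congr rfl fun a _ => Finset.sum_congr rfl fun b _ => by ring
  · rw [Finset.sum_comm]
    refine Finset.sum_congr rfl fun a _ => ?_
    rw [← Finset.sum_neg_distrib]
    refine Finset.sum_congr rfl fun b _ => ?_
    rw [bracketCoeff_swap hn a b]
    ring

/-- Since the coefficients are constant, only Hessians appear, each in two terms of opposite sign.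
The terms agree because `C S C` is symmetric for antisymmetric `C` and symmetric `S`. -/
theorem logForm_jacobi (hn : 3 ≤ n) {F G H : Coord n → ℝ} {z : Coord n}
    (hF : ContDiffAt ℝ ∞ F z) (hG : ContDiffAt ℝ ∞ G z) (hH : ContDiffAt ℝ ∞ H z) :
    logForm (eulerGrad F z) (eulerGrad (fun w => logForm (eulerGrad G w) (eulerGrad H w)) z) +
      logForm (eulerGrad G z) (eulerGrad (fun w => logForm (eulerGrad H w) (eulerGrad F w)) z) +
      logForm (eulerGrad H z) (eulerGrad (fun w => logForm (eulerGrad F w) (eulerGrad G w)) z) =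
      0 := by
  have key : ∀ S : Matrix (ZMod n ⊕ ZMod n) (ZMod n ⊕ ZMod n) ℝ, Sᵀ = S → ∀ u v : Coord n,
      u ⬝ᵥ coeffMatrix n *ᵥ (S *ᵥ (coeffMatrix n *ᵥ v)) =
        v ⬝ᵥ coeffMatrix n *ᵥ (S *ᵥ (coeffMatrix n *ᵥ u)) := by
    intro S hS u v
    rw [Matrix.mulVec_mulVec, Matrix.mulVec_mulVec, Matrix.mulVec_mulVec, Matrix.mulVec_mulVec,
      Matrix.dotProduct_mulVec, ← Matrix.mulVec_transpose, dotProduct_comm]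
    congr 2
    simp only [Matrix.transpose_mul, coeffMatrix_transpose hn, hS, Matrix.neg_mul, Matrix.mul_neg,
      neg_neg, Matrix.mul_assoc]
  rw [eulerGrad_logForm hn hG hH, eulerGrad_logForm hn hH hF, eulerGrad_logForm hn hF hG]
  simp only [logForm_eq_dotProduct, Matrix.mulVec_sub, dotProduct_sub]
  rw [key _ (eulerHess_transpose hG) (eulerGrad F z) (eulerGrad H z),
    key _ (eulerHess_transpose hH) (eulerGrad G z) (eulerGrad F z),
    key _ (eulerHess_transpose hF) (eulerGrad H z) (eulerGrad G z)]
  ring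

theorem coordRep_bracket {f g : PolygonSpace n → ℝ} {z : Coord n} (hz : z ∈ regular n) :
    coordRep (bracket f g) =ᶠ[𝓝 z]
      fun w => logForm (eulerGrad (coordRep f) w) (eulerGrad (coordRep g) w) :=
  coordRep_eventuallyEq (fun p _ => bracket_eq f g p) hz

theorem isPoissonBracket_bracket (hn : 3 ≤ n) : IsPoissonBracket (n := n) bracket := by
  have hd : ∀ {f : PolygonSpace n → ℝ}, IsSmooth f → ∀ {p}, p ∈ generic n →
      DifferentiableAt ℝ (coordRep f) (corner n p) :=
    fun hf p hp => (hf.contDiffAt (corner_ne_zero hp)).differentiableAt (by simp)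
  refine ⟨?_, ?_, ?_, ?_, ?_, ?_⟩
  · intro f g hf hg
    exact isSmooth_of_eq _ (fun p _ => bracket_eq f g p) fun z hz =>
      contDiffAt_logForm (hf.contDiffAt hz) (hg.contDiffAt hz)
  · intro f g h hf hg _ p hp
    have e : coordRep (f + g) =ᶠ[𝓝 (corner n p)] coordRep f + coordRep g :=
      coordRep_eventuallyEq (fun q hq => by
        rw [Pi.add_apply, Pi.add_apply, coordRep_corner hq, coordRep_corner hq])
        (corner_ne_zero hp)
    rw [bracket_eq, bracket_eq, bracket_eq, eulerGrad_congr e, eulerGrad_add (hd hf hp) (hd hg hp),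
      logForm_add_left]
  · intro c f g hf _ p hp
    have e : coordRep (c • f) =ᶠ[𝓝 (corner n p)] c • coordRep f :=
      coordRep_eventuallyEq (fun q hq => by
        rw [Pi.smul_apply, Pi.smul_apply, coordRep_corner hq]) (corner_ne_zero hp)
    rw [bracket_eq, bracket_eq, eulerGrad_congr e, eulerGrad_smul c (hd hf hp), logForm_smul_left]
  · intro f g _ _ p _
    rw [bracket_eq, bracket_eq, logForm_swap hn]
  · intro f g h hf hg _ p hp
    have e : coordRep (f * g) =ᶠ[𝓝 (corner n p)] coordRep f * coordRep g :=
      coordRep_eventuallyEq (fun q hq => by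
        rw [Pi.mul_apply, Pi.mul_apply, coordRep_corner hq, coordRep_corner hq])
        (corner_ne_zero hp)
    rw [bracket_eq, bracket_eq, bracket_eq, eulerGrad_congr e, eulerGrad_mul (hd hf hp) (hd hg hp),
      logForm_add_left, logForm_smul_left, logForm_smul_left, coordRep_corner hp,
      coordRep_corner hp]
  · intro f g h hf hg hh p hp
    have hz : corner n p ∈ regular n := corner_ne_zero hp
    rw [bracket_eq f, bracket_eq g, bracket_eq h, eulerGrad_congr (coordRep_bracket hz),
      eulerGrad_congr (coordRep_bracket hz), eulerGrad_congr (coordRep_bracket hz)]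
    exact logForm_jacobi hn (hf.contDiffAt hz) (hg.contDiffAt hz) (hh.contDiffAt hz)

end Calculus

/-! ### Invariance of the bracket -/

section Invariance

open Filter Topology

variable {n : ℕ} [NeZero n]

/-- The logarithmic gradient of `x_i y_i`. -/
def mulVec (i : ZMod n) : Coord n := Pi.single (.inl i) 1 + Pi.single (.inr i) 1

/-- The logarithmic gradients of the components of the pentagram map, for
`w_i = x_i y_i / (1 - x_i y_i)`. -/
def pentagramLog (w : ZMod n → ℝ) : ZMod n ⊕ ZMod n → Coord n :=
  Sum.elim
    (fun i => Pi.single (.inl i) 1 - w (i - 1) • mulVec (i - 1) + w (i + 1) • mulVec (i + 1))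
    (fun i => Pi.single (.inr (i + 1)) 1 - w (i + 2) • mulVec (i + 2) + w i • mulVec i)

theorem logForm_single (hn : 3 ≤ n) (v : Coord n) (i : ZMod n) :
    logForm (Pi.single (.inl i) 1) v = v (.inl (i - 1)) - v (.inl (i + 1)) ∧
      logForm (Pi.single (.inr i) 1) v = v (.inr (i + 1)) - v (.inr (i - 1)) := by
  simp only [logForm_eq_dotProduct, single_dotProduct, one_mul]
  exact sum_bracketCoeff hn v i

theorem logForm_mulVec (hn : 3 ≤ n) (v : Coord n) (i : ZMod n) :
    logForm (mulVec i) v =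
      v (.inl (i - 1)) - v (.inl (i + 1)) + (v (.inr (i + 1)) - v (.inr (i - 1))) := by
  rw [mulVec, logForm_add_left, (logForm_single hn v i).1, (logForm_single hn v i).2]

/-- This says that the logarithmic Jacobian of `T` preserves the constant form. The products `x_i
y_i` commute with each other, so terms quadratic in `w` vanish; the linear ones cancel after their
indices are matched. -/
theorem logForm_pentagramLog (hn : 3 ≤ n) (w : ZMod n → ℝ) (a b : ZMod n ⊕ ZMod n) :
    logForm (pentagramLog w a) (pentagramLog w b) = bracketCoeff a b := by
  let D : ZMod n → ℝ := fun k => if k = 0 then 1 else 0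
  -- `D` is a Kronecker delta; this moves the argument of `w` across it, which is all the linear
  -- arithmetic below needs.
  have hD : ∀ k l m : ZMod n, m - l = k → ∀ u : ZMod n → ℝ, u l * D k = u m * D k := by
    rintro k l m rfl u
    simp only [D]
    split_ifs with h
    · rw [sub_eq_zero.1 h]
    · ring
  have sl : ∀ (j k : ZMod n), (Pi.single (.inl j) 1 : Coord n) (.inl k) = D (k - j) := by
    intro j k
    simp [D, Pi.single_apply, sub_eq_zero]
  have sr : ∀ (j k : ZMod n), (Pi.single (.inr j) 1 : Coord n) (.inr k) = D (k - j) := by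
    intro j k
    simp [D, Pi.single_apply, sub_eq_zero]
  have slr : ∀ (j k : ZMod n), (Pi.single (.inl j) 1 : Coord n) (.inr k) = 0 := by
    intro j k
    simp
  have srl : ∀ (j k : ZMod n), (Pi.single (.inr j) 1 : Coord n) (.inl k) = 0 := by
    intro j k
    simp
  have hneg : ∀ k, D (-k) = D k := fun k => by simp [D]
  have e1 : ∀ i t : ZMod n, i - 1 = i - t ↔ t - 1 = 0 := fun i t =>
    ⟨fun h => by linear_combination h, fun h => by linear_combination h⟩
  have e2 : ∀ i t : ZMod n, i + 1 = i - t ↔ t + 1 = 0 := fun i t =>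
    ⟨fun h => by linear_combination h, fun h => by linear_combination h⟩
  have cl : ∀ i t : ZMod n, (bracketCoeff (.inl i) (.inl (i - t)) : ℝ) = D (t - 1) - D (t + 1) := by
    intro i t
    have := (sum_bracketCoeff hn (Pi.single (.inl (i - t)) 1) i).1
    simp only [Pi.single_apply, mul_ite, mul_one, mul_zero, Finset.sum_ite_eq',
      Finset.mem_univ, if_true] at this
    rw [this]
    simp only [D, Sum.inl.injEq, e1, e2]
  have cr : ∀ i t : ZMod n, (bracketCoeff (.inr i) (.inr (i - t)) : ℝ) = D (t + 1) - D (t - 1) := by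
    intro i t
    have := (sum_bracketCoeff hn (Pi.single (.inr (i - t)) 1) i).2
    simp only [Pi.single_apply, mul_ite, mul_one, mul_zero, Finset.sum_ite_eq',
      Finset.mem_univ, if_true] at this
    rw [this]
    simp only [D, Sum.inr.injEq, e1, e2]
  have hl : ∀ i v, logForm (pentagramLog w (.inl i)) v = v (.inl (i - 1)) - v (.inl (i + 1)) +
      -w (i - 1) * (v (.inl (i - 1 - 1)) - v (.inl (i - 1 + 1)) +
        (v (.inr (i - 1 + 1)) - v (.inr (i - 1 - 1)))) +
      w (i + 1) * (v (.inl (i + 1 - 1)) - v (.inl (i + 1 + 1)) +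
        (v (.inr (i + 1 + 1)) - v (.inr (i + 1 - 1)))) := by
    intro i v
    rw [pentagramLog, Sum.elim_inl, sub_eq_add_neg, ← neg_smul, logForm_add_left, logForm_add_left,
      logForm_smul_left, logForm_smul_left, logForm_mulVec hn, logForm_mulVec hn,
      (logForm_single hn v i).1]
  have hr : ∀ i v, logForm (pentagramLog w (.inr i)) v =
      v (.inr (i + 1 + 1)) - v (.inr (i + 1 - 1)) +
      -w (i + 2) * (v (.inl (i + 2 - 1)) - v (.inl (i + 2 + 1)) +
        (v (.inr (i + 2 + 1)) - v (.inr (i + 2 - 1)))) +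
      w i * (v (.inl (i - 1)) - v (.inl (i + 1)) + (v (.inr (i + 1)) - v (.inr (i - 1)))) := by
    intro i v
    rw [pentagramLog, Sum.elim_inr, sub_eq_add_neg, ← neg_smul, logForm_add_left, logForm_add_left,
      logForm_smul_left, logForm_smul_left, logForm_mulVec hn, logForm_mulVec hn,
      (logForm_single hn v (i + 1)).2]
  have hxy : ∀ i j, logForm (pentagramLog w (.inl i)) (pentagramLog w (.inr j)) = 0 := by
    intro i j
    obtain ⟨t, rfl⟩ : ∃ t, j = i - t := ⟨i - j, by ring⟩
    rw [hl]
    simp only [pentagramLog, mulVec, Sum.elim_inl, Sum.elim_inr, Pi.add_apply, Pi.sub_apply,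
      Pi.smul_apply, smul_eq_mul, sl, sr, slr, srl]
    have h1 := hD (t - 3) (i - t + 2) (i - 1) (by ring) w
    have h2 := hD (t - 1) (i - t + 2) (i + 1) (by ring) w
    have h3 := hD (t - 1) (i - t) (i - 1) (by ring) w
    have h4 := hD (t + 1) (i - t) (i + 1) (by ring) w
    ring_nf at h1 h2 h3 h4 ⊢
    linarith
  rcases a with i | i <;> rcases b with j | j
  · obtain ⟨t, rfl⟩ : ∃ t, j = i - t := ⟨i - j, by ring⟩
    rw [hl, cl]
    simp only [pentagramLog, mulVec, Sum.elim_inl, Sum.elim_inr, Pi.add_apply, Pi.sub_apply,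
      Pi.smul_apply, smul_eq_mul, sl, sr, slr, srl]
    have h1 := hD t (i - t - 1) (i - 1) (by ring) w
    have h2 := hD (t - 2) (i - t + 1) (i - 1) (by ring) w
    have h3 := hD (t + 2) (i - t - 1) (i + 1) (by ring) w
    have h4 := hD t (i - t + 1) (i + 1) (by ring) w
    ring_nf at h1 h2 h3 h4 ⊢
    linarith
  · exact hxy i j
  · rw [logForm_swap hn, hxy, neg_zero]
    rfl
  · obtain ⟨t, rfl⟩ : ∃ t, j = i - t := ⟨i - j, by ring⟩
    rw [hr, cr]
    simp only [pentagramLog, mulVec, Sum.elim_inl, Sum.elim_inr, Pi.add_apply, Pi.sub_apply,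
      Pi.smul_apply, smul_eq_mul, sl, sr, slr, srl]
    have h1 := hD t (i - t + 2) (i + 2) (by ring) w
    have h2 := hD (t - 2) (i - t + 2) i (by ring) w
    have h3 := hD (t + 2) (i - t) (i + 2) (by ring) w
    have h4 := hD t (i - t) i (by ring) w
    ring_nf at h1 h2 h3 h4 ⊢
    linarith

theorem eulerGrad_coord (z : Coord n) (a : ZMod n ⊕ ZMod n) :
    eulerGrad (fun w => w a) z = z a • Pi.single a 1 := by
  funext b
  have h1 : HasFDerivAt (fun w : Coord n => w a)
    (ContinuousLinearMap.proj (R := ℝ) (φ := fun _ => ℝ) a) z :=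
    (ContinuousLinearMap.proj (R := ℝ) (φ := fun _ => ℝ) a).hasFDerivAt
  rw [eulerGrad, h1.fderiv]
  by_cases h : a = b
  · subst h
    simp
  · simp [Pi.single_apply, h, Ne.symm h]

theorem differentiableAt_div {F G : Coord n → ℝ} {z : Coord n} (hF : DifferentiableAt ℝ F z)
    (hG : DifferentiableAt ℝ G z) (hGz : G z ≠ 0) :
    DifferentiableAt ℝ (fun w => F w / G w) z := by
  simpa only [div_eq_mul_inv] using hF.fun_mul (hG.fun_inv hGz)

theorem eulerGrad_div {F G : Coord n → ℝ} {z : Coord n} (hF : DifferentiableAt ℝ F z)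
    (hG : DifferentiableAt ℝ G z) (hFz : F z ≠ 0) (hGz : G z ≠ 0) :
    eulerGrad (fun w => F w / G w) z =
      (F z / G z) • ((F z)⁻¹ • eulerGrad F z - (G z)⁻¹ • eulerGrad G z) := by
  have hd : DifferentiableAt ℝ (fun w => F w / G w) z := differentiableAt_div hF hG hGz
  have h1 := eulerGrad_mul hd hG
  have e : (fun w => F w / G w) * G =ᶠ[𝓝 z] F := by
    filter_upwards [hG.continuousAt.eventually_ne hGz] with w hw
    exact div_mul_cancel₀ _ hw
  rw [eulerGrad_congr e] at h1
  rw [h1]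
  funext a
  simp only [Pi.smul_apply, Pi.sub_apply, Pi.add_apply, smul_eq_mul]
  field_simp
  ring

theorem eulerGrad_one_sub_mul (z : Coord n) (i : ZMod n) :
    eulerGrad (fun w => 1 - w (.inl i) * w (.inr i)) z =
      -(z (.inl i) * z (.inr i)) • mulVec i := by
  have hd : ∀ a, DifferentiableAt ℝ (fun w : Coord n => w a) z := fun a => differentiableAt_apply a z
  have h := eulerGrad_mul (hd (.inl i)) (hd (.inr i))
  rw [eulerGrad_coord, eulerGrad_coord] at h
  have e : eulerGrad (fun w => 1 - w (.inl i) * w (.inr i)) z =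
      -eulerGrad ((fun w : Coord n => w (.inl i)) * fun w => w (.inr i)) z := by
    funext a
    rw [Pi.neg_apply, eulerGrad, eulerGrad, fderiv_const_sub, _root_.neg_apply, mul_neg]
    rfl
  rw [e, h, mulVec]
  module

theorem eulerGrad_pentagramCoord {z : Coord n} (h0 : ∀ a, z a ≠ 0)
    (h1 : ∀ i, z (.inl i) * z (.inr i) ≠ 1) (b : ZMod n ⊕ ZMod n) :
    DifferentiableAt ℝ (fun w => pentagramCoord w b) z ∧ pentagramCoord z b ≠ 0 ∧
    eulerGrad (fun w => pentagramCoord w b) z = pentagramCoord z b • pentagramLog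
      (fun i => z (.inl i) * z (.inr i) / (1 - z (.inl i) * z (.inr i))) b := by
  have hd : ∀ a, DifferentiableAt ℝ (fun w : Coord n => w a) z := fun a => differentiableAt_apply a z
  have hu : ∀ i, DifferentiableAt ℝ (fun w : Coord n => 1 - w (.inl i) * w (.inr i)) z :=
    fun i => (differentiableAt_const 1).fun_sub ((hd _).fun_mul (hd _))
  have hu0 : ∀ i, 1 - z (.inl i) * z (.inr i) ≠ 0 := fun i => sub_ne_zero.2 (h1 i).symm
  have key : ∀ (a : ZMod n ⊕ ZMod n) (i j : ZMod n),
      DifferentiableAt ℝ (fun w : Coord n => w a * (1 - w (.inl i) * w (.inr i)) /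
        (1 - w (.inl j) * w (.inr j))) z ∧
      z a * (1 - z (.inl i) * z (.inr i)) / (1 - z (.inl j) * z (.inr j)) ≠ 0 ∧
      eulerGrad (fun w : Coord n => w a * (1 - w (.inl i) * w (.inr i)) /
        (1 - w (.inl j) * w (.inr j))) z =
      (z a * (1 - z (.inl i) * z (.inr i)) / (1 - z (.inl j) * z (.inr j))) •
        (Pi.single a 1 -
          (z (.inl i) * z (.inr i) / (1 - z (.inl i) * z (.inr i))) • mulVec i +
          (z (.inl j) * z (.inr j) / (1 - z (.inl j) * z (.inr j))) • mulVec j) := by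
    intro a i j
    have hm : DifferentiableAt ℝ (fun w : Coord n => w a * (1 - w (.inl i) * w (.inr i))) z :=
      (hd a).fun_mul (hu i)
    refine ⟨differentiableAt_div hm (hu j) (hu0 j),
      div_ne_zero (mul_ne_zero (h0 a) (hu0 i)) (hu0 j), ?_⟩
    rw [eulerGrad_div hm (hu j) (mul_ne_zero (h0 a) (hu0 i)) (hu0 j), eulerGrad_one_sub_mul]
    have e := eulerGrad_mul (hd a) (hu i)
    rw [eulerGrad_one_sub_mul, eulerGrad_coord] at e
    have e' : eulerGrad (fun w : Coord n => w a * (1 - w (.inl i) * w (.inr i))) z = _ := e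
    rw [e']
    congr 1
    have := hu0 i
    have := hu0 j
    have := h0 a
    funext c
    simp only [Pi.smul_apply, Pi.sub_apply, Pi.add_apply, smul_eq_mul]
    field_simp
    ring
  rcases b with i | i
  · exact key (.inl i) (i - 1) (i + 1)
  · exact key (.inr (i + 1)) (i + 2) i

theorem eulerGrad_comp {F : Coord n → ℝ} {τ : Coord n → Coord n} {z : Coord n}
    (hF : DifferentiableAt ℝ F (τ z)) (hτ : ∀ b, DifferentiableAt ℝ (fun w => τ w b) z)
    {J : ZMod n ⊕ ZMod n → Coord n} (hJ : ∀ b, eulerGrad (fun w => τ w b) z = τ z b • J b) :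
    eulerGrad (F ∘ τ) z = ∑ b, eulerGrad F (τ z) b • J b := by
  funext a
  have hτ' : DifferentiableAt ℝ τ z := differentiableAt_pi.2 hτ
  rw [eulerGrad, fderiv_comp z hF hτ', ContinuousLinearMap.comp_apply,
    pi_eq_sum_univ' (fderiv ℝ τ z (Pi.single a 1)), map_sum, Finset.mul_sum, Finset.sum_apply]
  refine Finset.sum_congr rfl fun b _ => ?_
  have e := congrFun (hJ b) a
  rw [eulerGrad, Pi.smul_apply, smul_eq_mul] at e
  have e2 : fderiv ℝ τ z (Pi.single a 1) b = fderiv ℝ (fun w => τ w b) z (Pi.single a 1) := by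
    rw [fderiv_pi hτ]
    rfl
  rw [map_smul, smul_eq_mul, e2, Pi.smul_apply, smul_eq_mul, eulerGrad, ← mul_assoc, e]
  ring

theorem bracket_comp_T (hn : 3 ≤ n) {f g : PolygonSpace n → ℝ} (hf : IsSmooth f) (hg : IsSmooth g)
    {p : PolygonSpace n} (hp : p ∈ domT n) :
    bracket (f ∘ T n) (g ∘ T n) p = bracket f g (T n p) := by
  have h0 := corner_ne_zero hp.1
  have h1 := (mem_domT_iff hp.1).1 hp
  -- Openness of the domain makes `f ∘ T` and its coordinate expression agree as germs, so their
  -- gradients agree.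
  have hopen : IsOpen {z : Coord n | (∀ a, z a ≠ 0) ∧ ∀ i, z (.inl i) * z (.inr i) ≠ 1} := by
    refine IsOpen.inter isOpen_regular ?_
    change IsOpen {z : Coord n | ∀ i, z (.inl i) * z (.inr i) ≠ 1}
    simp only [Set.ofPred_forall]
    exact isOpen_iInter_of_finite fun i => isOpen_ne_fun (by fun_prop) continuous_const
  have e : ∀ f : PolygonSpace n → ℝ,
      coordRep (f ∘ T n) =ᶠ[𝓝 (corner n p)] coordRep f ∘ pentagramCoord := by
    intro f
    filter_upwards [hopen.mem_nhds ⟨h0, h1⟩] with w hw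
    obtain ⟨q, hq, rfl⟩ : w ∈ corner n '' domT n := by
      rw [corner_image_domT]
      exact hw
    rw [coordRep_corner hq.1, Function.comp_apply, Function.comp_apply, ← corner_T hq,
      coordRep_corner hq.2.2]
  have hd : ∀ {f : PolygonSpace n → ℝ}, IsSmooth f →
      DifferentiableAt ℝ (coordRep f) (pentagramCoord (corner n p)) := fun hf => by
    rw [← corner_T hp]
    exact (hf.contDiffAt (corner_ne_zero hp.2.2)).differentiableAt (by simp)
  have hτ := eulerGrad_pentagramCoord h0 h1
  rw [bracket_eq, bracket_eq, eulerGrad_congr (e f), eulerGrad_congr (e g),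
    eulerGrad_comp (hd hf) (fun b => (hτ b).1) (fun b => (hτ b).2.2),
    eulerGrad_comp (hd hg) (fun b => (hτ b).1) (fun b => (hτ b).2.2), logForm_sum_left,
    corner_T hp]
  refine Finset.sum_congr rfl fun a _ => ?_
  rw [logForm_sum_right hn, Finset.mul_sum]
  refine Finset.sum_congr rfl fun b _ => ?_
  rw [logForm_pentagramLog hn]
  ring

end Invariance

/-! ### Corank and Casimirs -/

section Corank

open Filter Topology

variable {n : ℕ} [NeZero n]

theorem hasFDerivAt_eval (F : CornerPoly n) (z : Coord n) :
    HasFDerivAt (fun w : Coord n => MvPolynomial.eval w F)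
      (∑ a, MvPolynomial.eval z (MvPolynomial.pderiv a F) •
        ContinuousLinearMap.proj (R := ℝ) (φ := fun _ : ZMod n ⊕ ZMod n => ℝ) a) z := by
  induction F using MvPolynomial.induction_on with
  | C r => simpa using hasFDerivAt_const r z
  | add F G hF hG =>
    simpa only [map_add, add_smul, Finset.sum_add_distrib] using hF.fun_add hG
  | mul_X F a hF =>
    have h1 : HasFDerivAt (fun w : Coord n => w a)
      (ContinuousLinearMap.proj (R := ℝ) (φ := fun _ => ℝ) a) z :=
      (ContinuousLinearMap.proj (R := ℝ) (φ := fun _ => ℝ) a).hasFDerivAt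
    have h := hF.fun_mul h1
    simp only [map_mul, MvPolynomial.eval_X]
    refine h.congr_fderiv ?_
    ext v
    simp only [Derivation.leibniz, smul_eq_mul, map_add, map_mul, MvPolynomial.eval_X, add_smul,
      Finset.sum_add_distrib, MvPolynomial.pderiv_X]
    simp [Finset.mul_sum, Pi.single_apply, mul_assoc]

theorem eulerGrad_eval (F : CornerPoly n) (z : Coord n) :
    eulerGrad (fun w => MvPolynomial.eval w F) z = logGrad z F := by
  funext a
  rw [eulerGrad, logGrad, (hasFDerivAt_eval F z).fderiv, eval_euler]
  congr 1
  simp only [_root_.sum_apply, _root_.smul_apply, ContinuousLinearMap.proj_apply]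
  rw [Finset.sum_eq_single a] <;> simp +contextual

theorem contDiff_eval (F : CornerPoly n) :
    ContDiff ℝ ∞ (fun w : Coord n => MvPolynomial.eval w F) := by
  induction F using MvPolynomial.induction_on with
  | C r => simpa using contDiff_const
  | add F G hF hG => simpa only [map_add] using hF.add hG
  | mul_X F a hF =>
    simpa only [map_mul, MvPolynomial.eval_X] using hF.mul (contDiff_apply ℝ ℝ a)

theorem isSmooth_toFun (F : CornerPoly n) : IsSmooth F.toFun :=
  isSmooth_of_eq (fun z => MvPolynomial.eval z F) (fun _ _ => rfl)
    fun _ _ => (contDiff_eval F).contDiffAt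

theorem eulerGrad_coordRep_toFun (F : CornerPoly n) {z : Coord n} (hz : z ∈ regular n) :
    eulerGrad (coordRep F.toFun) z = logGrad z F := by
  rw [← eulerGrad_eval]
  exact eulerGrad_congr (coordRep_eventuallyEq (F := fun w => MvPolynomial.eval w F)
    (fun _ _ => rfl) hz)

theorem poissonCommute_toFun {F G : CornerPoly n}
    (h : ∀ z, logForm (logGrad z F) (logGrad z G) = 0) : PoissonCommute F.toFun G.toFun := by
  intro p hp
  rw [bracket_eq, eulerGrad_coordRep_toFun _ (corner_ne_zero hp),
    eulerGrad_coordRep_toFun _ (corner_ne_zero hp), h]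

theorem bracket_coord (hn : 3 ≤ n) (f : PolygonSpace n → ℝ) {p : PolygonSpace n}
    (hp : p ∈ generic n) (a : ZMod n ⊕ ZMod n) :
    bracket f (fun q => corner n q a) p =
      -(corner n p a * (coeffMatrix n *ᵥ eulerGrad (coordRep f) (corner n p)) a) := by
  have e : coordRep (fun q => corner n q a) =ᶠ[𝓝 (corner n p)] fun w => w a :=
    coordRep_eventuallyEq (F := fun w => w a) (fun _ _ => rfl) (corner_ne_zero hp)
  rw [bracket_eq, eulerGrad_congr e, eulerGrad_coord, logForm_swap hn, logForm_smul_left,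
    logForm_eq_dotProduct, single_dotProduct, one_mul]

/-- Linear functions with coefficients `u a / z a` already realise every covector, so the
Hamiltonian vectors fill the image of the Poisson tensor. -/
theorem exists_eulerGrad_eq {p : PolygonSpace n} (hp : p ∈ generic n) (u : Coord n) :
    ∃ f, IsSmooth f ∧ eulerGrad (coordRep f) (corner n p) = u := by
  let F : CornerPoly n := ∑ a, MvPolynomial.C (u a / corner n p a) * MvPolynomial.X a
  refine ⟨F.toFun, isSmooth_toFun F, ?_⟩
  rw [eulerGrad_coordRep_toFun _ (corner_ne_zero hp)]
  funext a
  simp only [logGrad, F, map_sum, Derivation.leibniz, euler_X, euler_C, add_zero,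
    smul_eq_mul, mul_ite, mul_zero, Finset.sum_ite_eq, Finset.mem_univ, if_true, map_mul,
    MvPolynomial.eval_C, MvPolynomial.eval_X]
  exact div_mul_cancel₀ _ (corner_ne_zero hp a)

theorem isCasimir_iff (hn : 3 ≤ n) {f : PolygonSpace n → ℝ} (hf : IsSmooth f) :
    IsCasimir f ↔
      ∀ p ∈ generic n, coeffMatrix n *ᵥ eulerGrad (coordRep f) (corner n p) = 0 := by
  constructor
  · intro h p hp
    funext a
    have h1 := h.2 (fun q => corner n q a) (isSmooth_of_eq (fun w => w a) (fun _ _ => rfl)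
      fun z _ => (contDiff_apply ℝ ℝ a).contDiffAt) p hp
    rw [bracket_coord hn f hp, neg_eq_zero] at h1
    exact (mul_eq_zero.1 h1).resolve_left (corner_ne_zero hp a)
  · intro h
    refine ⟨hf, fun g _ p hp => ?_⟩
    rw [bracket_eq, logForm_swap hn, logForm_eq_dotProduct, h p hp, dotProduct_zero, neg_zero]

theorem coeffMatrix_mulVec_eq_zero_iff (hn : 3 ≤ n) (u : Coord n) :
    coeffMatrix n *ᵥ u = 0 ↔ (∀ i, u (.inl (i - 1)) = u (.inl (i + 1))) ∧
      ∀ i, u (.inr (i - 1)) = u (.inr (i + 1)) := by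
  constructor
  · intro h
    constructor
    · intro i
      exact sub_eq_zero.1 ((sum_bracketCoeff hn u i).1.symm.trans (congrFun h (.inl i)))
    · intro i
      exact (sub_eq_zero.1 ((sum_bracketCoeff hn u i).2.symm.trans (congrFun h (.inr i)))).symm
  · rintro ⟨h1, h2⟩
    funext a
    rcases a with i | i
    · exact (sum_bracketCoeff hn u i).1.trans (by rw [h1, sub_self]; rfl)
    · exact (sum_bracketCoeff hn u i).2.trans (by rw [h2, sub_self]; rfl)

/-- The kernel of the Poisson tensor in logarithmic coordinates. -/
def casimirSpace (n : ℕ) [NeZero n] : Submodule ℝ (Coord n) :=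
  LinearMap.ker (coeffMatrix n).mulVecLin

/-- The tensor at a point is the constant matrix followed by multiplication with the nonzero
coordinates, so its kernel is the same at every generic point; rank-nullity gives the codimension.
-/
theorem hasCorank_of_finrank (hn : 3 ≤ n) {c : ℕ}
    (hc : Module.finrank ℝ (casimirSpace n) = c) : HasCorank n c := by
  intro p hp
  have h0 := corner_ne_zero hp
  let D : Coord n →ₗ[ℝ] Coord n := LinearMap.pi fun a =>
    (-corner n p a) • LinearMap.proj (R := ℝ) (φ := fun _ => ℝ) a
  let L : Coord n →ₗ[ℝ] Coord n := D ∘ₗ (coeffMatrix n).mulVecLin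
  have hL : ∀ u a, L u a = -(corner n p a * (coeffMatrix n *ᵥ u) a) := by
    intro u a
    simp [L, D]
  have h1 : leafTangent p = LinearMap.range L := by
    rw [leafTangent, ← Submodule.span_eq (LinearMap.range L)]
    congr 1
    ext w
    constructor
    · rintro ⟨f, _, rfl⟩
      refine ⟨eulerGrad (coordRep f) (corner n p), ?_⟩
      funext a
      rw [hL, bracket_coord hn f hp]
    · rintro ⟨u, rfl⟩
      obtain ⟨f, hf, rfl⟩ := exists_eulerGrad_eq hp u
      refine ⟨f, hf, ?_⟩
      funext a
      rw [hL, bracket_coord hn f hp]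
  have h2 : LinearMap.ker L = casimirSpace n := by
    refine LinearMap.ker_comp_of_ker_eq_bot _ (LinearMap.ker_eq_bot'.2 fun u hu => ?_)
    funext a
    have := congrFun hu a
    simp only [D, LinearMap.pi_apply, LinearMap.smul_apply, LinearMap.proj_apply, smul_eq_mul,
      Pi.zero_apply, mul_eq_zero, neg_eq_zero, h0 a, false_or] at this
    exact this
  rw [h1, ← hc, ← h2, LinearMap.finrank_range_add_finrank_ker, Module.finrank_fintype_fun_eq_card,
    Fintype.card_sum, ZMod.card]
  ring

/-- The `x`-part and the `y`-part decouple, and `e` parametrizes the 2-periodic sequences in either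
of them. -/
theorem finrank_casimirSpace (hn : 3 ≤ n) {V : Type*} [AddCommGroup V] [Module ℝ V]
    [Module.Finite ℝ V] (e : V →ₗ[ℝ] (ZMod n → ℝ)) (he : Function.Injective e)
    (hr : ∀ w : ZMod n → ℝ, (∀ i, w (i - 1) = w (i + 1)) ↔ ∃ v, e v = w) :
    Module.finrank ℝ (casimirSpace n) = 2 * Module.finrank ℝ V := by
  let L : V × V →ₗ[ℝ] Coord n := LinearMap.pi
    (Sum.elim (fun i => LinearMap.proj (R := ℝ) (φ := fun _ => ℝ) i ∘ₗ e ∘ₗ LinearMap.fst ℝ V V)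
      (fun i => LinearMap.proj (R := ℝ) (φ := fun _ => ℝ) i ∘ₗ e ∘ₗ LinearMap.snd ℝ V V))
  have hl : ∀ v i, L v (.inl i) = e v.1 i := fun v i => rfl
  have hr' : ∀ v i, L v (.inr i) = e v.2 i := fun v i => rfl
  have h1 : casimirSpace n = LinearMap.range L := by
    ext u
    rw [casimirSpace, LinearMap.mem_ker, Matrix.mulVecLin_apply,
      coeffMatrix_mulVec_eq_zero_iff hn, hr (fun i => u (.inl i)), hr (fun i => u (.inr i))]
    constructor
    · rintro ⟨⟨v, hv⟩, ⟨v', hv'⟩⟩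
      refine ⟨(v, v'), ?_⟩
      funext a
      rcases a with i | i
      · exact congrFun hv i
      · exact congrFun hv' i
    · rintro ⟨v, rfl⟩
      exact ⟨⟨v.1, rfl⟩, ⟨v.2, rfl⟩⟩
  have h2 : Function.Injective L := by
    intro v v' h
    refine Prod.ext (he ?_) (he ?_)
    · funext i
      exact congrFun h (.inl i)
    · funext i
      exact congrFun h (.inr i)
  rw [h1, LinearMap.finrank_range_of_inj h2, Module.finrank_prod]
  ring

theorem apply_add_two_mul {w : ZMod n → ℝ} (h : ∀ i, w (i - 1) = w (i + 1)) (i : ZMod n) (k : ℕ) :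
    w (i + 2 * k) = w i := by
  induction k with
  | zero => simp
  | succ k ih =>
    rw [← ih]
    have := h (i + 2 * k + 1)
    rw [show i + 2 * k + 1 - 1 = i + 2 * k by ring] at this
    rw [this]
    congr 1
    push_cast
    ring

theorem even_val_add_one (hn : 3 ≤ n) (he : Even n) (i : ZMod n) :
    Even (i + 1).val ↔ ¬ Even i.val := by
  have h2 : 2 ∣ n := he.two_dvd
  have h1 : (1 : ZMod n).val = 1 := by
    rw [ZMod.val_one_eq_one_mod]
    exact Nat.mod_eq_of_lt (by omega)
  rw [ZMod.val_add, h1, Nat.even_iff, Nat.mod_mod_of_dvd _ h2, Nat.even_iff]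
  omega

theorem even_val_sub_one (hn : 3 ≤ n) (he : Even n) (i : ZMod n) :
    Even (i - 1).val ↔ ¬ Even i.val := by
  have := even_val_add_one hn he (i - 1)
  rw [sub_add_cancel] at this
  tauto

theorem finrank_casimirSpace_odd (hn : 3 ≤ n) (ho : Odd n) :
    Module.finrank ℝ (casimirSpace n) = 2 := by
  let e : ℝ →ₗ[ℝ] (ZMod n → ℝ) := LinearMap.pi fun _ => LinearMap.id
  rw [finrank_casimirSpace hn e (fun a b h => congrFun h 0), Module.finrank_self]
  intro w
  constructor
  · intro h
    refine ⟨w 0, ?_⟩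
    funext i
    obtain ⟨m, hm⟩ := ho
    -- For `n = 2m + 1` the inverse of `2` modulo `n` is `m + 1`, so steps of length two reach every
    -- index and the sequence is constant.
    have := apply_add_two_mul h 0 ((m + 1) * i.val)
    rw [← this]
    change w _ = w i
    congr 1
    have h1 : (2 * (m + 1) : ZMod n) = 1 := by
      have : ((2 * m + 1 : ℕ) : ZMod n) = 0 := by rw [← hm, ZMod.natCast_self]
      push_cast at this
      linear_combination this
    push_cast
    rw [ZMod.natCast_rightInverse i]
    linear_combination i * h1
  · rintro ⟨v, rfl⟩ i
    rfl

theorem finrank_casimirSpace_even (hn : 3 ≤ n) (he : Even n) :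
    Module.finrank ℝ (casimirSpace n) = 4 := by
  let e : ℝ × ℝ →ₗ[ℝ] (ZMod n → ℝ) := LinearMap.pi fun i =>
    if Even i.val then LinearMap.fst ℝ ℝ ℝ else LinearMap.snd ℝ ℝ ℝ
  have h1 : ¬ Even (1 : ZMod n).val := by
    have := even_val_add_one hn he 0
    simp only [zero_add, ZMod.val_zero, Even.zero, not_true, iff_false] at this
    exact this
  have hv : ∀ v i, e v i = if Even i.val then v.1 else v.2 := by
    intro v i
    simp only [e, LinearMap.pi_apply]
    split_ifs <;> rfl
  rw [finrank_casimirSpace hn e, Module.finrank_prod, Module.finrank_self]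
  · intro v v' h
    refine Prod.ext ?_ ?_
    · simpa [hv] using congrFun h 0
    · simpa only [hv, if_neg h1] using congrFun h 1
  · intro w
    constructor
    · intro h
      refine ⟨(w 0, w 1), ?_⟩
      funext i
      rw [hv]
      split_ifs with hi
      · obtain ⟨k, hk⟩ := hi
        have h2 := apply_add_two_mul h 0 k
        rw [show (0 : ZMod n) + 2 * k = i by
          rw [← ZMod.natCast_rightInverse i, hk]
          push_cast
          ring] at h2
        exact h2.symm
      · obtain ⟨k, hk⟩ := Nat.not_even_iff_odd.1 hi
        have h2 := apply_add_two_mul h 1 k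
        rw [show (1 : ZMod n) + 2 * k = i by
          rw [← ZMod.natCast_rightInverse i, hk]
          push_cast
          ring] at h2
        exact h2.symm
    · rintro ⟨v, rfl⟩ i
      rw [hv, hv, if_congr (even_val_sub_one hn he i) rfl rfl,
        if_congr (even_val_add_one hn he i) rfl rfl]

theorem isCasimir_toFun (hn : 3 ≤ n) {F : CornerPoly n}
    (h : ∀ z, z ∈ regular n → logGrad z F ∈ casimirSpace n) : IsCasimir F.toFun := by
  rw [isCasimir_iff hn (isSmooth_toFun F)]
  intro p hp
  rw [eulerGrad_coordRep_toFun _ (corner_ne_zero hp)]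
  exact h _ (corner_ne_zero hp)

theorem mem_casimirSpace (hn : 3 ≤ n) {u : Coord n} : u ∈ casimirSpace n ↔
    (∀ i, u (.inl (i - 1)) = u (.inl (i + 1))) ∧ ∀ i, u (.inr (i - 1)) = u (.inr (i + 1)) := by
  rw [casimirSpace, LinearMap.mem_ker, Matrix.mulVecLin_apply, coeffMatrix_mulVec_eq_zero_iff hn]

/-! ### The explicit Casimirs. -/

theorem euler_prod {σ ι : Type*} [DecidableEq σ] [DecidableEq ι] (s : Finset ι) (f : ι → σ)
    (hf : Function.Injective f) (a : σ) :
    euler a (∏ i ∈ s, MvPolynomial.X (f i) : MvPolynomial σ ℝ) =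
      if ∃ i ∈ s, f i = a then ∏ i ∈ s, MvPolynomial.X (f i) else 0 := by
  induction s using Finset.induction_on with
  | empty => simp [euler]
  | insert j s hj ih =>
    rw [Finset.prod_insert hj, Derivation.leibniz, ih, euler_X, smul_eq_mul, smul_eq_mul]
    by_cases h : a = f j
    · subst h
      rw [if_neg, if_pos rfl, if_pos ⟨j, by simp, rfl⟩]
      · ring
      · rintro ⟨i, hi, h⟩
        exact hj (hf h ▸ hi)
    · rw [if_neg h]
      by_cases h' : ∃ i ∈ s, f i = a
      · rw [if_pos h', if_pos]
        · ring
        · obtain ⟨i, hi, h⟩ := h'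
          exact ⟨i, Finset.mem_insert_of_mem hi, h⟩
      · rw [if_neg h', if_neg]
        · ring
        · rintro ⟨i, hi, hi'⟩
          rcases Finset.mem_insert.1 hi with rfl | hi
          · exact h hi'.symm
          · exact h' ⟨i, hi, hi'⟩

theorem logGrad_O_self (z : Coord n) : logGrad z (O n n) =
    (∏ i, z (.inl i)) • Sum.elim (fun _ => 1) (fun _ => 0) := by
  funext a
  have h := euler_prod (Finset.univ : Finset (ZMod n)) (Sum.inl : ZMod n → ZMod n ⊕ ZMod n)
    Sum.inl_injective a
  rw [logGrad, O, if_pos rfl]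
  simp only [xVar]
  rw [h]
  rcases a with i | i <;> simp [map_prod]

theorem logGrad_E_self (z : Coord n) : logGrad z (E n n) =
    (∏ i, z (.inr i)) • Sum.elim (fun _ => 0) (fun _ => 1) := by
  funext a
  have h := euler_prod (Finset.univ : Finset (ZMod n)) (Sum.inr : ZMod n → ZMod n ⊕ ZMod n)
    Sum.inr_injective a
  rw [logGrad, E, if_pos rfl]
  simp only [yVar]
  rw [h]
  rcases a with i | i <;> simp [map_prod]

theorem logGrad_O_self_mem (hn : 3 ≤ n) (z : Coord n) :
    logGrad z (O n n) ∈ casimirSpace n := by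
  rw [mem_casimirSpace hn, logGrad_O_self]
  exact ⟨fun i => rfl, fun i => rfl⟩

theorem logGrad_E_self_mem (hn : 3 ≤ n) (z : Coord n) :
    logGrad z (E n n) ∈ casimirSpace n := by
  rw [mem_casimirSpace hn, logGrad_E_self]
  exact ⟨fun i => rfl, fun i => rfl⟩

theorem casimirSpace_flip (hn : 3 ≤ n) {u : Coord n} (hu : u ∈ casimirSpace n) :
    u ∘ flip ∈ casimirSpace n := by
  rw [mem_casimirSpace hn] at hu ⊢
  refine ⟨fun i => ?_, fun i => ?_⟩
  · simp only [Function.comp_apply, flip, Sum.elim_inl]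
    rw [show -(i - 1) = -i + 1 by ring, show -(i + 1) = -i - 1 by ring, hu.2]
  · simp only [Function.comp_apply, flip, Sum.elim_inr]
    rw [show -(i - 1) = -i + 1 by ring, show -(i + 1) = -i - 1 by ring, hu.1]

theorem eq_filter_of_alternating (hn : 3 ≤ n) (he : Even n) {J : Finset (ZMod n)}
    (h : ∀ i ∈ J, i + 1 ∉ J) (hc : n / 2 ≤ J.card) :
    J = ({i | Even i.val} : Finset (ZMod n)) ∨ J = ({i | Odd i.val} : Finset (ZMod n)) := by
  have hfull : ∀ i, i ∉ J → i + 1 ∈ J := by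
    intro i hi
    by_contra hi'
    -- If `i` and `i + 1` are both missing, then `J` and `J + 1` are disjoint and both avoid `i +
    -- 1`, so `2 |J| ≤ n - 1`, which contradicts the size of `J`. Membership thus alternates around
    -- the cycle.
    have hsub : J ∪ J.map (Equiv.addRight (1 : ZMod n)).toEmbedding ⊆ Finset.univ.erase (i + 1) := by
      intro j hj
      refine Finset.mem_erase.2 ⟨?_, Finset.mem_univ _⟩
      rintro rfl
      rcases Finset.mem_union.1 hj with hj | hj
      · exact hi' hj
      · rw [Finset.mem_map_equiv] at hj
        exact hi (by simpa using hj)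
    have hdisj : Disjoint J (J.map (Equiv.addRight (1 : ZMod n)).toEmbedding) := by
      rw [Finset.disjoint_left]
      intro j hj hj'
      rw [Finset.mem_map_equiv] at hj'
      have := h _ hj'
      simp only [Equiv.addRight_symm, Equiv.coe_addRight, neg_add_cancel_right] at this
      exact this hj
    have := Finset.card_le_card hsub
    rw [Finset.card_union_of_disjoint hdisj, Finset.card_map,
      Finset.card_erase_of_mem (Finset.mem_univ _), Finset.card_univ, ZMod.card] at this
    have := he.two_dvd
    omega
  have hiff : ∀ i, i + 1 ∈ J ↔ i ∉ J := fun i => ⟨fun h1 h2 => h i h2 h1, hfull i⟩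
  have hnat : ∀ k : ℕ, ((k : ZMod n) ∈ J ↔ ((0 : ZMod n) ∈ J ↔ Even k)) := by
    intro k
    induction k with
    | zero => simp
    | succ k ih =>
      rw [Nat.cast_succ, hiff, ih, Nat.even_add_one]
      tauto
  have hval : ∀ i : ZMod n, (i ∈ J ↔ ((0 : ZMod n) ∈ J ↔ Even i.val)) := by
    intro i
    rw [← hnat, ZMod.natCast_rightInverse i]
  by_cases h0 : (0 : ZMod n) ∈ J
  · left
    ext i
    simp [hval i, h0]
  · right
    ext i
    simp [hval i, h0]

theorem card_filter_even (hn : 3 ≤ n) (he : Even n) :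
    (({i | Even i.val} : Finset (ZMod n)).card = n / 2) ∧
      (({i | Odd i.val} : Finset (ZMod n)).card = n / 2) := by
  have h1 : ({i | Odd i.val} : Finset (ZMod n)) =
      ({i | Even i.val} : Finset (ZMod n)).map (Equiv.addRight (1 : ZMod n)).toEmbedding := by
    ext i
    rw [Finset.mem_map_equiv]
    simp only [Finset.mem_filter, Finset.mem_univ, true_and, Equiv.addRight_symm,
      Equiv.coe_addRight, ← sub_eq_add_neg]
    rw [even_val_sub_one hn he, Nat.not_even_iff_odd]
  have h2 : (({i | Even i.val} : Finset (ZMod n)).card) +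
      (({i | Odd i.val} : Finset (ZMod n)).card) = n := by
    have := Finset.card_filter_add_card_filter_not (s := (Finset.univ : Finset (ZMod n)))
      (fun i => Even i.val)
    simp only [Nat.not_even_iff_odd, Finset.card_univ, ZMod.card] at this
    exact this
  rw [h1, Finset.card_map] at *
  omega

/-- From `3 |I| + 2 |J| ≤ n = 2 (|I| + |J|)` it follows that `I` is empty; then `J` has maximal size
without neighbours and is one of the two parity classes. -/
theorem admissibleSum_half (hn : 3 ≤ n) (he : Even n) (X u : ZMod n → CornerPoly n) :
    admissibleSum X u (n / 2) = (-1) ^ (n / 2) *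
      ((∏ i with Even i.val, u i) + ∏ i with Odd i.val, u i) := by
  classical
  have h2 := he.two_dvd
  have hcard := card_filter_even hn he
  set A : Finset (ZMod n) := {i | Even i.val} with hA
  set B : Finset (ZMod n) := {i | Odd i.val} with hB
  have hAB : A ≠ B := by
    intro h
    have : (0 : ZMod n) ∈ A := by simp [hA]
    rw [h] at this
    simp [hB] at this
  have key : ∀ I J : Finset (ZMod n), (Admissible I J ∧ I.card + J.card = n / 2) ↔
      (I = ∅ ∧ (J = A ∨ J = B)) := by
    intro I J
    constructor
    · rintro ⟨h, hc⟩
      have := h.card_le hn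
      have hI : I.card = 0 := by omega
      exact ⟨Finset.card_eq_zero.1 hI, eq_filter_of_alternating hn he h.2.2 (by omega)⟩
    · rintro ⟨rfl, hJ⟩
      rcases hJ with rfl | rfl
      · refine ⟨⟨by simp, by simp, fun i hi => ?_⟩, by simpa using hcard.1⟩
        simp only [hA, Finset.mem_filter, Finset.mem_univ, true_and] at hi ⊢
        rw [even_val_add_one hn he]
        tauto
      · refine ⟨⟨by simp, by simp, fun i hi => ?_⟩, by simpa using hcard.2⟩
        simp only [hB, Finset.mem_filter, Finset.mem_univ, true_and, ← Nat.not_even_iff_odd]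
          at hi ⊢
        rw [even_val_add_one hn he]
        tauto
  rw [admissibleSum, Fintype.sum_prod_type, Finset.sum_eq_single ∅]
  · simp only [key, true_and, Finset.prod_empty, mul_one]
    rw [Finset.sum_ite, Finset.sum_const_zero, add_zero,
      show (Finset.univ.filter fun J => J = A ∨ J = B) = {A, B} by ext J; simp,
      Finset.sum_pair hAB, hcard.1, hcard.2]
    ring
  · intro I _ hI
    refine Finset.sum_eq_zero fun J _ => ?_
    rw [if_neg]
    rw [key]
    tauto
  · simp

theorem O_half (hn : 3 ≤ n) (he : Even n) : O n (n / 2) = (-1) ^ (n / 2) *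
    ((∏ i with Even i.val, xVar i) + (∏ i with Odd i.val, xVar i)) := by
  rw [O, if_neg (by omega), admissibleSum_half hn he]

theorem E_half (hn : 3 ≤ n) (he : Even n) : E n (n / 2) = (-1) ^ (n / 2) *
    ((∏ i with Even i.val, yVar i) + (∏ i with Odd i.val, yVar i)) := by
  rw [E, if_neg (by omega), admissibleSum_half hn he]

theorem logGrad_O_half_mem (hn : 3 ≤ n) (he : Even n) (z : Coord n) :
    logGrad z (O n (n / 2)) ∈ casimirSpace n := by
  have h := fun s : Finset (ZMod n) => euler_prod s
    (Sum.inl : ZMod n → ZMod n ⊕ ZMod n) Sum.inl_injective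
  have hs : O n (n / 2) = ((-1 : ℝ) ^ (n / 2)) •
      ((∏ i with Even i.val, xVar i) + (∏ i with Odd i.val, xVar i)) := by
    rw [O_half hn he, MvPolynomial.smul_eq_C_mul]
    simp
  have hg : ∀ a, logGrad z (O n (n / 2)) a = (-1 : ℝ) ^ (n / 2) * MvPolynomial.eval z
      ((if ∃ i ∈ ({i | Even i.val} : Finset (ZMod n)), Sum.inl i = a then
        ∏ i with Even i.val, xVar i else 0) +
      if ∃ i ∈ ({i | Odd i.val} : Finset (ZMod n)), Sum.inl i = a then
        ∏ i with Odd i.val, xVar i else 0) := by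
    intro a
    rw [logGrad, hs, Derivation.map_smul, map_add, MvPolynomial.smul_eval]
    simp only [xVar]
    rw [h, h]
  rw [mem_casimirSpace hn]
  refine ⟨fun i => ?_, fun i => ?_⟩
  · rw [hg, hg]
    simp only [Finset.mem_filter, Finset.mem_univ, true_and, Sum.inl.injEq, exists_eq_right,
      ← Nat.not_even_iff_odd, even_val_sub_one hn he, even_val_add_one hn he]
  · rw [hg, hg]
    simp

theorem logGrad_E_half_mem (hn : 3 ≤ n) (he : Even n) (z : Coord n) :
    logGrad z (E n (n / 2)) ∈ casimirSpace n := by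
  rw [← rename_flip_O, logGrad_rename_flip]
  exact casimirSpace_flip hn (logGrad_O_half_mem hn he _)

theorem poissonCommute_monodromyInvariant (hn : 3 ≤ n) (i j : InvIndex n ⊕ InvIndex n) :
    PoissonCommute (monodromyInvariant n i).toFun (monodromyInvariant n j).toFun := by
  have h1 : ∀ {u v : Coord n}, u ∈ casimirSpace n → logForm v u = 0 := fun hu =>
    logForm_left_of_period hn ((mem_casimirSpace hn).1 hu).1 ((mem_casimirSpace hn).1 hu).2 _
  have h2 : ∀ {u v : Coord n}, u ∈ casimirSpace n → logForm u v = 0 := fun hu => by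
    rw [logForm_swap hn, h1 hu, neg_zero]
  refine poissonCommute_toFun fun z => ?_
  rcases i with ⟨k, hk | rfl⟩ | ⟨k, hk | rfl⟩
  · rcases j with ⟨l, hl | rfl⟩ | ⟨l, hl | rfl⟩
    · exact logForm_O_O hn z (Finset.mem_Icc.2 hk) (Finset.mem_Icc.2 hl)
    · exact h1 (logGrad_O_self_mem hn z)
    · rw [logForm_swap hn, neg_eq_zero]
      exact logForm_E_O hn z (Finset.mem_Icc.2 hl) (Finset.mem_Icc.2 hk)
    · exact h1 (logGrad_E_self_mem hn z)
  · exact h2 (logGrad_O_self_mem hn z)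
  · rcases j with ⟨l, hl | rfl⟩ | ⟨l, hl | rfl⟩
    · exact logForm_E_O hn z (Finset.mem_Icc.2 hk) (Finset.mem_Icc.2 hl)
    · exact h1 (logGrad_O_self_mem hn z)
    · exact logForm_E_E hn z (Finset.mem_Icc.2 hk) (Finset.mem_Icc.2 hl)
    · exact h1 (logGrad_E_self_mem hn z)
  · exact h2 (logGrad_E_self_mem hn z)

end Corank

/-! ### Independence at a degenerate point -/

section BasePoint

open MvPolynomial

variable {n : ℕ} [NeZero n]

/-- The indices with odd representative. -/
def oddIndices (n : ℕ) [NeZero n] : Finset (ZMod n) := {i | Odd i.val}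

theorem mem_oddIndices {i : ZMod n} : i ∈ oddIndices n ↔ Odd i.val := by simp [oddIndices]

/-- This also holds for odd `n`: the only step at which parity may fail to alternate is from `n - 1`
to `0`, and `0` is not odd. -/
theorem add_one_notMem_oddIndices (hn : 3 ≤ n) {i : ZMod n} (hi : i ∈ oddIndices n) :
    i + 1 ∉ oddIndices n := by
  rw [mem_oddIndices] at *
  have h1 : (1 : ZMod n).val = 1 := by
    rw [ZMod.val_one_eq_one_mod]
    exact Nat.mod_eq_of_lt (by omega)
  rw [ZMod.val_add, h1]
  rcases (Nat.succ_le_of_lt i.val_lt).lt_or_eq with h | h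
  · rw [Nat.mod_eq_of_lt h]
    simpa [Nat.odd_add_one] using hi
  · rw [show i.val + 1 = n from h, Nat.mod_self]
    simp

theorem le_card_oddIndices : n / 2 ≤ (oddIndices n).card := by
  have := Finset.card_le_card_of_injOn (s := Finset.range (n / 2)) (t := oddIndices n)
    (fun j => ((2 * j + 1 : ℕ) : ZMod n)) ?_ ?_
  · simpa using this
  · intro j hj
    have hj := Finset.mem_range.1 hj
    simp only [Finset.mem_coe, mem_oddIndices]
    rw [ZMod.val_cast_of_lt (by omega)]
    exact odd_two_mul_add_one j
  · intro j hj k hk h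
    have hj := Finset.mem_range.1 hj
    have hk := Finset.mem_range.1 hk
    have := congrArg ZMod.val h
    simp only at this
    rw [ZMod.val_cast_of_lt (by omega), ZMod.val_cast_of_lt (by omega)] at this
    omega

/-- The index of a coordinate. -/
def coordIndex : ZMod n ⊕ ZMod n → ZMod n := Sum.elim id id

/-- A point at which the coordinates with even index vanish. -/
def basePoint (n : ℕ) [NeZero n] : Coord n :=
  fun a => if coordIndex a ∈ oddIndices n then ((coordIndex a).val : ℝ) else 0

/-- The substitution of `0` for the coordinates with even index. -/
def restrictOdd : CornerPoly n →ₐ[ℝ] CornerPoly n :=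
  aeval fun a => if coordIndex a ∈ oddIndices n then X a else 0

theorem restrictOdd_X (a : ZMod n ⊕ ZMod n) : restrictOdd (X a : CornerPoly n) =
    if coordIndex a ∈ oddIndices n then X a else 0 := by
  rw [restrictOdd, aeval_X]

theorem restrictOdd_C (r : ℝ) : restrictOdd (C r : CornerPoly n) = C r := by
  rw [restrictOdd, aeval_C]
  rfl

theorem eval_restrictOdd (F : CornerPoly n) :
    eval (basePoint n) (restrictOdd F) = eval (basePoint n) F := by
  induction F using MvPolynomial.induction_on with
  | C r => rw [restrictOdd_C]
  | add F G hF hG => simp only [map_add, hF, hG]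
  | mul_X F a hF =>
    rw [map_mul, map_mul, map_mul, hF, restrictOdd_X, eval_X, basePoint]
    split_ifs with h
    · simp [h, basePoint]
    · simp

theorem euler_restrictOdd (a : ZMod n ⊕ ZMod n) (F : CornerPoly n) :
    euler a (restrictOdd F) =
      if coordIndex a ∈ oddIndices n then restrictOdd (euler a F) else 0 := by
  induction F using MvPolynomial.induction_on with
  | C r => simp [euler_C]
  | add F G hF hG =>
    simp only [map_add, hF, hG]
    split_ifs <;> simp
  | mul_X F b hF =>
    simp only [map_mul, Derivation.leibniz, hF, restrictOdd_X, smul_eq_mul, map_add, euler_X]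
    by_cases h : a = b
    · subst h
      split_ifs <;> simp_all [restrictOdd_X, euler_X]
    · split_ifs <;> simp_all [euler_X]

/-- At the base point `z_a ∂_a` vanishes for the coordinates set to zero, so restricting before
taking the logarithmic gradient loses nothing. -/
theorem logGrad_restrictOdd (F : CornerPoly n) :
    logGrad (basePoint n) (restrictOdd F) = logGrad (basePoint n) F := by
  funext a
  rw [logGrad, logGrad, euler_restrictOdd]
  split_ifs with h
  · exact eval_restrictOdd _
  · rw [map_zero, eval_euler, basePoint, if_neg h, zero_mul]

/-- Without long arcs, and with weights supported on pairwise non-neighbouring sites, every subset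
of the support is admissible, so the sum factors. -/
theorem admissibleGen_zero {R : Type*} [CommRing R] (hn : 3 ≤ n) {f : ZMod n → R}
    (hf : ∀ i, i ∉ oddIndices n → f i = 0) :
    admissibleGen f 0 = ∏ i ∈ oddIndices n, (1 + f i) := by
  classical
  rw [admissibleGen, Fintype.sum_prod_type, Finset.sum_eq_single ∅]
  · rw [Finset.prod_one_add, ← Finset.sum_subset (Finset.subset_univ (oddIndices n).powerset)]
    · refine Finset.sum_congr rfl fun J hJ => ?_
      rw [Finset.mem_powerset] at hJ
      rw [if_pos, Finset.prod_empty, one_mul]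
      exact ⟨by simp, by simp, fun i hi h => add_one_notMem_oddIndices hn (hJ hi) (hJ h)⟩
    · intro J _ hJ
      rw [Finset.mem_powerset, Finset.not_subset] at hJ
      obtain ⟨i, hi, hi'⟩ := hJ
      rw [Finset.prod_eq_zero hi (hf i hi'), mul_zero, ite_self]
  · intro I _ hI
    obtain ⟨i, hi⟩ := Finset.nonempty_iff_ne_empty.2 hI
    refine Finset.sum_eq_zero fun J _ => ?_
    rw [Finset.prod_eq_zero hi rfl, zero_mul, ite_self]
  · simp

/-- Each `X_i` contains `x_i` and `x_{i+1}`, at least one of which is set to zero. Hence the `O_k`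
restrict to signed elementary symmetric polynomials. -/
theorem restrictOdd_generating_O (hn : 3 ≤ n) (r : ℝ) :
    restrictOdd (1 + ∑ k ∈ Finset.Icc 1 (n / 2), C (r ^ k) * O n k) =
      ∏ i ∈ oddIndices n, (1 - C r * X (.inl i)) := by
  have h := admissibleGen_eq_sum_O hn
    (restrictOdd (n := n) : CornerPoly n →+* CornerPoly n) (C r)
  simp only [RingHom.coe_coe] at h
  have h0 : (fun i : ZMod n => (C r : CornerPoly n) *
      restrictOdd (xVar i * yVar i * xVar (i + 1))) = 0 := by
    funext i
    rw [map_mul, map_mul, xVar, xVar, restrictOdd_X, restrictOdd_X]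
    by_cases hi : i ∈ oddIndices n
    · have := add_one_notMem_oddIndices hn hi
      simp [coordIndex, this]
    · simp [coordIndex, hi]
  rw [h0, admissibleGen_zero hn] at h
  · simp only [map_add, map_one, map_sum, map_mul, map_pow, restrictOdd_C]
    rw [← h]
    refine Finset.prod_congr rfl fun i hi => ?_
    rw [xVar, restrictOdd_X, if_pos (show coordIndex (.inl i) ∈ oddIndices n from hi),
       sub_eq_add_neg]
  · intro i hi
    rw [xVar, restrictOdd_X, if_neg (show coordIndex (.inl i) ∉ oddIndices n from hi),
      mul_zero, neg_zero]

theorem restrictOdd_generating_E (hn : 3 ≤ n) (r : ℝ) :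
    restrictOdd (1 + ∑ k ∈ Finset.Icc 1 (n / 2), C (r ^ k) * E n k) =
      ∏ i ∈ oddIndices n, (1 - C r * X (.inr i)) := by
  have h := admissibleGen_eq_sum_E hn
    (restrictOdd (n := n) : CornerPoly n →+* CornerPoly n) (C r)
  simp only [RingHom.coe_coe] at h
  have h0 : (fun i : ZMod n => (C r : CornerPoly n) *
      restrictOdd (yVar i * xVar (i + 1) * yVar (i + 1))) = 0 := by
    funext i
    rw [map_mul, map_mul, yVar, yVar, restrictOdd_X, restrictOdd_X]
    by_cases hi : i ∈ oddIndices n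
    · have := add_one_notMem_oddIndices hn hi
      simp [coordIndex, this]
    · simp [coordIndex, hi]
  rw [h0, admissibleGen_zero hn] at h
  · simp only [map_add, map_one, map_sum, map_mul, map_pow, restrictOdd_C]
    rw [← h]
    refine Finset.prod_congr rfl fun i hi => ?_
    rw [yVar, restrictOdd_X, if_pos (show coordIndex (.inr i) ∈ oddIndices n from hi),
       sub_eq_add_neg]
  · intro i hi
    rw [yVar, restrictOdd_X, if_neg (show coordIndex (.inr i) ∉ oddIndices n from hi),
      mul_zero, neg_zero]

theorem euler_prod_eq_zero {σ ι : Type*} (s : Finset ι) (f : ι → MvPolynomial σ ℝ) {a : σ}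
    (h : ∀ i ∈ s, euler a (f i) = 0) : euler a (∏ i ∈ s, f i) = 0 := by
  classical
  induction s using Finset.induction_on with
  | empty => simp [euler]
  | insert j s hj ih =>
    rw [Finset.prod_insert hj, Derivation.leibniz, ih fun i hi => h i (Finset.mem_insert_of_mem hi),
      h j (Finset.mem_insert_self j s), smul_zero, smul_zero, add_zero]

section Family

variable {F : ℕ → CornerPoly n} {ι : ZMod n → ZMod n ⊕ ZMod n} (hι : Function.Injective ι)
  (hF : ∀ r : ℝ, restrictOdd (1 + ∑ k ∈ Finset.Icc 1 (n / 2), C (r ^ k) * F k) =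
    ∏ i ∈ oddIndices n, (1 - C r * X (ι i)))
include hF

theorem sum_logGrad_basePoint (r : ℝ) (a : ZMod n ⊕ ZMod n) :
    ∑ k ∈ Finset.Icc 1 (n / 2), r ^ k * logGrad (basePoint n) (F k) a =
      eval (basePoint n) (euler a (∏ i ∈ oddIndices n, (1 - C r * X (ι i)))) := by
  have h := logGrad_one_add_sum (basePoint n) (Finset.Icc 1 (n / 2)) (fun k => r ^ k) F
  rw [← logGrad_restrictOdd, hF] at h
  have h := congrFun h a
  rw [logGrad] at h
  rw [h]
  simp [Finset.sum_apply]

theorem logGrad_basePoint_eq_zero {a : ZMod n ⊕ ZMod n} (ha : ∀ i ∈ oddIndices n, ι i ≠ a)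
    {k : ℕ} (hk : k ∈ Finset.Icc 1 (n / 2)) : logGrad (basePoint n) (F k) a = 0 := by
  refine eq_of_sum_pow_eq (a := fun k => logGrad (basePoint n) (F k) a) (b := fun _ => 0)
    infinite_ne_zero (fun s _ => ?_) hk
  rw [sum_logGrad_basePoint hF, euler_prod_eq_zero]
  · simp
  · intro i hi
    simp [Derivation.leibniz, euler_X, (ha i hi).symm]

include hι in
theorem sum_logGrad_basePoint_odd (hι' : ∀ i, coordIndex (ι i) = i) (r : ℝ) {b : ZMod n}
    (hb : b ∈ oddIndices n) :
    ∑ k ∈ Finset.Icc 1 (n / 2), r ^ k * logGrad (basePoint n) (F k) (ι b) =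
      -(r * b.val) * ∏ i ∈ (oddIndices n).erase b, (1 - r * i.val) := by
  have hv : ∀ i ∈ oddIndices n, basePoint n (ι i) = i.val := by
    intro i hi
    rw [basePoint, hι', if_pos hi]
  rw [sum_logGrad_basePoint hF, ← Finset.mul_prod_erase _ _ hb, Derivation.leibniz,
    euler_prod_eq_zero]
  · simp only [zero_add, map_sub, Derivation.leibniz, euler_C, euler_X,
      if_true, smul_eq_mul, mul_zero, add_zero, Derivation.map_one_eq_zero, zero_sub, map_mul,
      map_neg, eval_C, eval_X, map_prod, map_one, hv b hb]
    rw [mul_comm]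
    congr 1
    refine Finset.prod_congr rfl fun i hi => ?_
    rw [hv i (Finset.mem_of_mem_erase hi)]
  · intro i hi
    have : ι b ≠ ι i := fun h => Finset.ne_of_mem_erase hi (hι h).symm
    simp [Derivation.leibniz, euler_X, this]

-- The gradients of elementary symmetric polynomials at distinct nonzero points are independent. The
-- `q b` are, up to scale, the Lagrange basis for the nodes `1 / b`; expanding a power of the
-- variable in them gives a combination of coordinates that detects the index `k` alone.
include hι in
theorem eq_zero_of_sum_logGrad (hι' : ∀ i, coordIndex (ι i) = i) {c : ℕ → ℝ}
    (hc : ∀ b ∈ oddIndices n,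
      ∑ k ∈ Finset.Icc 1 (n / 2), c k * logGrad (basePoint n) (F k) (ι b) = 0)
    {k : ℕ} (hk : k ∈ Finset.Icc 1 (n / 2)) : c k = 0 := by
  obtain ⟨hk1, hk2⟩ := Finset.mem_Icc.1 hk
  set S := oddIndices n with hS
  have hcard : n / 2 ≤ S.card := le_card_oddIndices
  have h0 : ∀ i ∈ S, (i.val : ℝ) ≠ 0 := by
    intro i hi h
    rw [Nat.cast_eq_zero] at h
    rw [hS, mem_oddIndices, h] at hi
    simp at hi
  let q : ZMod n → Polynomial ℝ := fun b =>
    ∏ i ∈ S.erase b, (1 - Polynomial.C (i.val : ℝ) * Polynomial.X)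
  have hq : ∀ b r, (q b).eval r = ∏ i ∈ S.erase b, (1 - r * i.val) := by
    intro b r
    simp only [q, Polynomial.eval_prod, Polynomial.eval_sub, Polynomial.eval_one,
      Polynomial.eval_mul, Polynomial.eval_C, Polynomial.eval_X]
    exact Finset.prod_congr rfl fun i _ => by ring
  have hqd : ∀ b ∈ S, (q b).degree < S.card := by
    intro b hb
    refine lt_of_le_of_lt (b := ((S.erase b).card : WithBot ℕ)) ?_ ?_
    · refine (Polynomial.degree_prod_le _ _).trans ?_
      refine (Finset.sum_le_card_nsmul _ _ 1 fun i _ => ?_).trans ?_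
      · refine (Polynomial.degree_sub_le _ _).trans (max_le ?_ ?_)
        · exact Polynomial.degree_one_le.trans zero_le_one
        · exact Polynomial.degree_C_mul_X_le _
      · simp
    · exact_mod_cast Finset.card_erase_lt_of_mem hb
  let v : ZMod n → ℝ := fun b => (b.val : ℝ)⁻¹
  have hv : Set.InjOn v S := by
    intro i _ j _ h
    exact ZMod.val_injective n (Nat.cast_injective (inv_injective h))
  have hqv : ∀ b ∈ S, (q b).eval (v b) ≠ 0 := by
    intro b hb
    rw [hq, Finset.prod_ne_zero_iff]
    intro i hi h
    have hi' := Finset.mem_of_mem_erase hi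
    refine Finset.ne_of_mem_erase hi (hv hi' hb ?_)
    have := h0 b hb
    simp only [v] at h ⊢
    rw [inv_eq_iff_eq_inv, inv_inv]
    field_simp at h
    linarith
  let α : ZMod n → ℝ := fun b => v b ^ (k - 1) / (q b).eval (v b)
  -- The exponent is `k - 1` because the Euler derivative of `∏ (1 - r x_i)` contributes a further
  -- factor `r`.
  have hP : ∑ b ∈ S, Polynomial.C (α b) * q b = Polynomial.X ^ (k - 1) := by
    refine Polynomial.eq_of_degrees_lt_of_eval_index_eq S hv ?_ ?_ fun b hb => ?_
    · refine (Polynomial.degree_sum_le _ _).trans_lt ?_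
      rw [Finset.sup_lt_iff (WithBot.bot_lt_coe _)]
      intro b hb
      refine (Polynomial.degree_mul_le _ _).trans_lt (lt_of_le_of_lt ?_ (hqd b hb))
      calc _ ≤ 0 + (q b).degree := by gcongr; exact Polynomial.degree_C_le
        _ = _ := zero_add _
    · rw [Polynomial.degree_X_pow]
      exact_mod_cast (by omega : k - 1 < S.card)
    · rw [Polynomial.eval_finsetSum, Finset.sum_eq_single b]
      · simp only [Polynomial.eval_mul, Polynomial.eval_C, Polynomial.eval_pow, Polynomial.eval_X, α]
        exact div_mul_cancel₀ _ (hqv b hb)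
      · intro i hi hib
        rw [Polynomial.eval_mul, hq, Finset.prod_eq_zero (Finset.mem_erase.2 ⟨hib.symm, hb⟩),
          mul_zero]
        simp only [v]
        rw [inv_mul_cancel₀ (h0 b hb), sub_self]
      · exact fun h => absurd hb h
  have hN : ∀ l ∈ Finset.Icc 1 (n / 2), ∑ b ∈ S, (-(α b) / b.val) *
      logGrad (basePoint n) (F l) (ι b) = if l = k then 1 else 0 := by
    intro l hl
    refine eq_of_sum_pow_eq (a := fun l => ∑ b ∈ S, (-(α b) / b.val) *
      logGrad (basePoint n) (F l) (ι b)) (b := fun l => if l = k then 1 else 0)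
      infinite_ne_zero (fun s _ => ?_) hl
    have e1 : ∑ l ∈ Finset.Icc 1 (n / 2), s ^ l * (if l = k then (1 : ℝ) else 0) = s ^ k := by
      rw [Finset.sum_eq_single k]
      · simp
      · intro l _ h
        simp [h]
      · exact fun h => absurd hk h
    rw [e1]
    have e2 := congrArg (Polynomial.eval s) hP
    rw [Polynomial.eval_finsetSum, Polynomial.eval_pow, Polynomial.eval_X] at e2
    have e3 : s ^ k = s * s ^ (k - 1) := by
      rw [← pow_succ']
      congr 1
      omega
    rw [e3, ← e2, Finset.mul_sum]
    simp only [Finset.mul_sum]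
    rw [Finset.sum_comm]
    refine Finset.sum_congr rfl fun b hb => ?_
    have e4 := sum_logGrad_basePoint_odd hι hF hι' s hb
    rw [← hq] at e4
    calc _ = -(α b) / b.val * ∑ l ∈ Finset.Icc 1 (n / 2),
          s ^ l * logGrad (basePoint n) (F l) (ι b) := by
          rw [Finset.mul_sum]
          exact Finset.sum_congr rfl fun l _ => by ring
      _ = _ := by
          rw [e4, Polynomial.eval_mul, Polynomial.eval_C]
          have := h0 b hb
          field_simp
  calc c k = ∑ l ∈ Finset.Icc 1 (n / 2), c l * (if l = k then 1 else 0) := by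
        rw [Finset.sum_eq_single k]
        · simp
        · intro l _ h
          simp [h]
        · exact fun h => absurd hk h
    _ = ∑ l ∈ Finset.Icc 1 (n / 2), c l * ∑ b ∈ S, (-(α b) / b.val) *
          logGrad (basePoint n) (F l) (ι b) :=
        Finset.sum_congr rfl fun l hl => by rw [hN l hl]
    _ = ∑ b ∈ S, (-(α b) / b.val) * ∑ l ∈ Finset.Icc 1 (n / 2), c l *
          logGrad (basePoint n) (F l) (ι b) := by
        simp only [Finset.mul_sum]
        rw [Finset.sum_comm]
        exact Finset.sum_congr rfl fun b _ => Finset.sum_congr rfl fun l _ => by ring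
    _ = 0 := Finset.sum_eq_zero fun b hb => by rw [hc b hb, mul_zero]

end Family

end BasePoint

/-! ### Independence of the monodromy invariants -/

section Independence

open MvPolynomial

/-- If `v A Aᵀ = 0`, then `v A` has square length zero. This encodes independence as nonvanishing of
one polynomial. -/
theorem det_mul_transpose_ne_zero_iff {ι κ : Type*} [Fintype ι] [DecidableEq ι] [Fintype κ]
    (A : Matrix ι κ ℝ) : (A * Aᵀ).det ≠ 0 ↔ LinearIndependent ℝ (fun i => A i) := by
  rw [Fintype.linearIndependent_iff, ne_eq, ← Matrix.exists_vecMul_eq_zero_iff]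
  have h1 : ∀ v : ι → ℝ, ∑ i, v i • A i = v ᵥ* A := fun v => (Matrix.vecMul_eq_sum v A).symm
  simp only [h1]
  constructor
  · intro h v hv
    by_contra h0
    refine h ⟨v, fun h => h0 fun i => congrFun h i, ?_⟩
    rw [← Matrix.vecMul_vecMul, hv, Matrix.zero_vecMul]
  · rintro h ⟨v, hv, h0⟩
    refine hv (funext (h v (dotProduct_self_eq_zero.1 ?_)))
    rw [← Matrix.vecMul_vecMul, Matrix.vecMul_transpose] at h0
    have := congrArg (fun w => v ⬝ᵥ w) h0
    simp only [dotProduct_zero] at this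
    rw [Matrix.dotProduct_mulVec] at this
    exact this

variable {n : ℕ} [NeZero n]

theorem mem_invIndex {k : ℕ} :
    k ∈ insert n (Finset.Icc 1 (n / 2)) ↔ (1 ≤ k ∧ k ≤ n / 2) ∨ k = n := by
  rw [Finset.mem_insert, Finset.mem_Icc, or_comm]

instance : Fintype (InvIndex n) := Fintype.subtype _ fun _ => mem_invIndex

theorem card_invIndex (hn : 3 ≤ n) : Fintype.card (InvIndex n) = n / 2 + 1 := by
  refine (Fintype.card_of_subtype _ fun _ => mem_invIndex).trans ?_
  rw [Finset.card_insert_of_notMem, Nat.card_Icc, Nat.add_sub_cancel]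
  rw [Finset.mem_Icc]
  omega

/-- The logarithmic gradients of the monodromy invariants, up to nonzero factors. -/
def invGrad : InvIndex n ⊕ InvIndex n → ZMod n ⊕ ZMod n → CornerPoly n :=
  Sum.elim
    (fun k => if (k : ℕ) = n then Sum.elim (fun _ => 1) (fun _ => 0) else
      fun a => euler a (O n k))
    (fun k => if (k : ℕ) = n then Sum.elim (fun _ => 0) (fun _ => 1) else
      fun a => euler a (E n k))

/-- The value of `invGrad` at a point. -/
def invGradAt (z : Coord n) : Matrix (InvIndex n ⊕ InvIndex n) (ZMod n ⊕ ZMod n) ℝ :=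
  fun i a => eval z (invGrad i a)

/-- The gradients of `O_n` and `E_n` carry the full products as factors, which vanish at the base
point. `invGrad` divides them out, and on regular points this is harmless. -/
theorem exists_logGrad_eq {z : Coord n} (hz : z ∈ regular n) (i : InvIndex n ⊕ InvIndex n) :
    ∃ c : ℝˣ, logGrad z (monodromyInvariant n i) = c • invGradAt z i := by
  rcases i with ⟨k, hk⟩ | ⟨k, hk⟩
  · by_cases h : k = n
    · subst h
      refine ⟨Units.mk0 (∏ i, z (.inl i)) (Finset.prod_ne_zero_iff.2 fun i _ => hz _), ?_⟩
      refine (logGrad_O_self z).trans ?_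
      funext a
      rcases a with a | a <;> simp [invGradAt, invGrad, Units.smul_def]
    · refine ⟨1, ?_⟩
      funext a
      simp [invGradAt, invGrad, h, logGrad, monodromyInvariant]
  · by_cases h : k = n
    · subst h
      refine ⟨Units.mk0 (∏ i, z (.inr i)) (Finset.prod_ne_zero_iff.2 fun i _ => hz _), ?_⟩
      refine (logGrad_E_self z).trans ?_
      funext a
      rcases a with a | a <;> simp [invGradAt, invGrad, Units.smul_def]
    · refine ⟨1, ?_⟩
      funext a
      simp [invGradAt, invGrad, h, logGrad, monodromyInvariant]

/-- The coordinates of index `0` see only the constant gradients belonging to `O_n` and `E_n`, whose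
coefficients therefore vanish. After that the odd `x`-coordinates see only the `O_k` and the odd
`y`-coordinates only the `E_k`. -/
theorem linearIndependent_invGradAt_basePoint (hn : 3 ≤ n) :
    LinearIndependent ℝ (fun i => invGradAt (basePoint n) i) := by
  rw [Fintype.linearIndependent_iff]
  intro g hg
  let c : ℕ → ℝ := fun k => if h : (1 ≤ k ∧ k ≤ n / 2) ∨ k = n then g (.inl ⟨k, h⟩) else 0
  let d : ℕ → ℝ := fun k => if h : (1 ≤ k ∧ k ≤ n / 2) ∨ k = n then g (.inr ⟨k, h⟩) else 0
  have hc : ∀ k : InvIndex n, c k = g (.inl k) := fun k => dif_pos k.2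
  have hd : ∀ k : InvIndex n, d k = g (.inr k) := fun k => dif_pos k.2
  have hnn : n ∉ Finset.Icc 1 (n / 2) := by
    rw [Finset.mem_Icc]
    omega
  have hsum : ∀ a, (∑ k ∈ Finset.Icc 1 (n / 2), c k * logGrad (basePoint n) (O n k) a +
      c n * Sum.elim (fun _ => 1) (fun _ => 0) a) +
      (∑ k ∈ Finset.Icc 1 (n / 2), d k * logGrad (basePoint n) (E n k) a +
      d n * Sum.elim (fun _ => 0) (fun _ => 1) a) = 0 := by
    intro a
    have h := congrFun hg a
    rw [Finset.sum_apply, Fintype.sum_sum_type, Pi.zero_apply] at h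
    refine Eq.trans ?_ h
    congr 1
    · have e := Finset.sum_subtype (F := (inferInstance : Fintype (InvIndex n))) (insert n (Finset.Icc 1 (n / 2))) (fun k => mem_invIndex (n := n))
        (fun k => c k * if k = n then Sum.elim (fun _ => (1 : ℝ)) (fun _ => 0) a else
          logGrad (basePoint n) (O n k) a)
      rw [Finset.sum_insert hnn, if_pos rfl, add_comm] at e
      refine Eq.trans ?_ (e.trans ?_)
      · congr 1
        refine Finset.sum_congr rfl fun k hk => ?_
        rw [if_neg (fun h : k = n => hnn (h ▸ hk))]
      refine Finset.sum_congr rfl fun k _ => ?_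
      rw [hc, Pi.smul_apply, smul_eq_mul]
      congr 1
      simp only [invGradAt, invGrad, Sum.elim_inl]
      split_ifs
      · rcases a with a | a <;> simp
      · rfl
    · have e := Finset.sum_subtype (F := (inferInstance : Fintype (InvIndex n))) (insert n (Finset.Icc 1 (n / 2))) (fun k => mem_invIndex (n := n))
        (fun k => d k * if k = n then Sum.elim (fun _ => (0 : ℝ)) (fun _ => 1) a else
          logGrad (basePoint n) (E n k) a)
      rw [Finset.sum_insert hnn, if_pos rfl, add_comm] at e
      refine Eq.trans ?_ (e.trans ?_)
      · congr 1
        refine Finset.sum_congr rfl fun k hk => ?_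
        rw [if_neg (fun h : k = n => hnn (h ▸ hk))]
      refine Finset.sum_congr rfl fun k _ => ?_
      rw [hd, Pi.smul_apply, smul_eq_mul]
      congr 1
      simp only [invGradAt, invGrad, Sum.elim_inr]
      split_ifs
      · rcases a with a | a <;> simp
      · rfl
  have hO0 := fun (a : ZMod n ⊕ ZMod n) (ha : ∀ i ∈ oddIndices n, (Sum.inl i : ZMod n ⊕ ZMod n) ≠ a)
    (c : ℕ → ℝ) => Finset.sum_eq_zero (s := Finset.Icc 1 (n / 2))
      (f := fun k => c k * logGrad (basePoint n) (O n k) a) fun k hk => by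
        rw [logGrad_basePoint_eq_zero (restrictOdd_generating_O hn) ha hk, mul_zero]
  have hE0 := fun (a : ZMod n ⊕ ZMod n) (ha : ∀ i ∈ oddIndices n, (Sum.inr i : ZMod n ⊕ ZMod n) ≠ a)
    (c : ℕ → ℝ) => Finset.sum_eq_zero (s := Finset.Icc 1 (n / 2))
      (f := fun k => c k * logGrad (basePoint n) (E n k) a) fun k hk => by
        rw [logGrad_basePoint_eq_zero (restrictOdd_generating_E hn) ha hk, mul_zero]
  have h0 : (0 : ZMod n) ∉ oddIndices n := by
    rw [mem_oddIndices]
    simp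
  have hcn : c n = 0 := by
    have h := hsum (.inl 0)
    rw [hO0 _ (fun i hi h => h0 ((Sum.inl_injective h : i = 0) ▸ hi)), hE0 _ (fun i _ => by simp)] at h
    simpa using h
  have hdn : d n = 0 := by
    have h := hsum (.inr 0)
    rw [hO0 _ (fun i _ => by simp), hE0 _ (fun i hi h => h0 ((Sum.inr_injective h : i = 0) ▸ hi))] at h
    simpa using h
  have hck := fun k hk => eq_zero_of_sum_logGrad (F := O n) (c := c) Sum.inl_injective
    (restrictOdd_generating_O hn) (fun _ => rfl) (fun b _ => by
      have h := hsum (.inl b)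
      rw [hE0 _ (fun i _ => by simp), hcn] at h
      simpa using h) (k := k) hk
  have hdk := fun k hk => eq_zero_of_sum_logGrad (F := E n) (c := d) Sum.inr_injective
    (restrictOdd_generating_E hn) (fun _ => rfl) (fun b _ => by
      have h := hsum (.inr b)
      rw [hO0 _ (fun i _ => by simp), hdn] at h
      simpa using h) (k := k) hk
  rintro (⟨k, hk⟩ | ⟨k, hk⟩)
  · rw [← hc]
    rcases hk with hk | rfl
    · exact hck k (Finset.mem_Icc.2 hk)
    · exact hcn
  · rw [← hd]
    rcases hk with hk | rfl
    · exact hdk k (Finset.mem_Icc.2 hk)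
    · exact hdn

/-! ### The Gram determinant and independence on a dense open set. -/

/-- The Gram determinant of the logarithmic gradients of the monodromy invariants. -/
def gram (n : ℕ) [NeZero n] : CornerPoly n :=
  (Matrix.of (invGrad (n := n)) * (Matrix.of (invGrad (n := n)))ᵀ).det

theorem eval_gram (z : Coord n) : eval z (gram n) = (invGradAt z * (invGradAt z)ᵀ).det := by
  rw [gram, RingHom.map_det, RingHom.mapMatrix_apply, Matrix.map_mul, Matrix.transpose_map]
  rfl

theorem gram_ne_zero (hn : 3 ≤ n) : gram n ≠ 0 := by
  intro h
  have h1 := (det_mul_transpose_ne_zero_iff _).2 (linearIndependent_invGradAt_basePoint hn)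
  rw [← eval_gram, h, map_zero] at h1
  exact h1 rfl

theorem linearIndependent_logGrad_iff {z : Coord n} (hz : z ∈ regular n) :
    LinearIndependent ℝ (fun i => logGrad z (monodromyInvariant n i)) ↔ eval z (gram n) ≠ 0 := by
  choose c hc using exists_logGrad_eq hz
  rw [eval_gram, det_mul_transpose_ne_zero_iff, funext hc]
  exact LinearIndependent.units_smul_iff (fun i => invGradAt z i) c

theorem linearIndependent_differential_iff {p : PolygonSpace n} (hp : p ∈ generic n) :
    LinearIndependent ℝ (fun i => differential (monodromyInvariant n i).toFun p) ↔
      eval (corner n p) (gram n) ≠ 0 := by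
  have h0 := corner_ne_zero hp
  rw [← linearIndependent_logGrad_iff h0]
  let Φ : (Coord n →L[ℝ] ℝ) →ₗ[ℝ] Coord n :=
    { toFun := fun L a => corner n p a * L (Pi.single a 1)
      map_add' := fun L L' => by
        funext a
        exact mul_add _ _ _
      map_smul' := fun r L => by
        funext a
        exact mul_left_comm _ _ _ }
  have hΦ : LinearMap.ker Φ = ⊥ := by
    refine LinearMap.ker_eq_bot'.2 fun L hL => ?_
    have h1 : ∀ a, L (Pi.single a 1) = 0 := fun a =>
      (mul_eq_zero.1 (congrFun hL a)).resolve_left (h0 a)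
    refine ContinuousLinearMap.coe_injective (LinearMap.pi_ext' fun a => LinearMap.ext_ring ?_)
    exact h1 a
  rw [← LinearMap.linearIndependent_iff Φ hΦ]
  have e : Φ ∘ (fun i => differential (monodromyInvariant n i).toFun p) =
      fun i => logGrad (corner n p) (monodromyInvariant n i) :=
    funext fun i => eulerGrad_coordRep_toFun _ h0
  rw [e]

theorem image_independent : corner n '' {p ∈ generic n | LinearIndependent ℝ fun i =>
    differential (monodromyInvariant n i).toFun p} =
      regular n ∩ {z | eval z (gram n) ≠ 0} := by
  ext z
  constructor
  · rintro ⟨p, ⟨hp, h⟩, rfl⟩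
    exact ⟨corner_ne_zero hp, (linearIndependent_differential_iff hp).1 h⟩
  · rintro ⟨hz, h⟩
    obtain ⟨p, hp, rfl⟩ := exists_generic hz
    exact ⟨p, ⟨hp, (linearIndependent_differential_iff hp).2 h⟩, rfl⟩

/-- A ball for the supremum distance is a product of infinite sets, and a polynomial vanishing on
such a product is zero. -/
theorem dense_eval_ne_zero {G : CornerPoly n} (hG : G ≠ 0) :
    Dense {z : Coord n | eval z G ≠ 0} := by
  rw [Metric.dense_iff]
  intro z r hr
  by_contra h
  rw [Set.not_nonempty_iff_eq_empty, Set.eq_empty_iff_forall_notMem] at h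
  refine hG (funext_set (fun a => Metric.ball (z a) r) (fun a => ?_) fun w hw => ?_)
  · rw [Real.ball_eq_Ioo]
    exact Set.Ioo_infinite (by linarith)
  · rw [map_zero]
    by_contra h0
    refine h w ⟨?_, h0⟩
    rw [Metric.mem_ball, dist_pi_lt_iff hr]
    exact fun a => hw a (Set.mem_univ a)

theorem isOpen_eval_ne_zero (G : CornerPoly n) : IsOpen {z : Coord n | eval z G ≠ 0} :=
  isOpen_ne_fun (contDiff_eval G).continuous continuous_const

theorem isOpen_independent : IsOpen (corner n '' {p ∈ generic n | LinearIndependent ℝ fun i =>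
    differential (monodromyInvariant n i).toFun p}) := by
  rw [image_independent]
  exact isOpen_regular.inter (isOpen_eval_ne_zero _)

theorem dense_independent (hn : 3 ≤ n) : corner n '' generic n ⊆
    closure (corner n '' {p ∈ generic n | LinearIndependent ℝ fun i =>
      differential (monodromyInvariant n i).toFun p}) := by
  rw [image_independent, corner_image]
  exact (dense_eval_ne_zero (gram_ne_zero hn)).open_subset_closure_inter isOpen_regular

theorem exists_independent (hn : 3 ≤ n) : ∃ p ∈ generic n,
    LinearIndependent ℝ fun i => logGrad (corner n p) (monodromyInvariant n i) := by
  obtain ⟨z, hz, hz'⟩ := (dense_eval_ne_zero (gram_ne_zero hn)).inter_open_nonempty _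
    isOpen_regular ⟨fun _ => (1 : ℝ), fun _ => one_ne_zero⟩
  obtain ⟨p, hp, rfl⟩ := exists_generic hz
  exact ⟨p, hp, (linearIndependent_logGrad_iff hz).2 hz'⟩

/-! ### Algebraic independence from independent gradients. -/

theorem euler_aeval {ι : Type*} [Fintype ι] (F : ι → CornerPoly n) (P : MvPolynomial ι ℝ)
    (a : ZMod n ⊕ ZMod n) :
    euler a (aeval F P) = ∑ i, aeval F (pderiv i P) * euler a (F i) := by
  classical
  induction P using MvPolynomial.induction_on with
  | C r => simp [euler, algebraMap_eq]
  | add P Q hP hQ => simp only [map_add, hP, hQ, add_mul, Finset.sum_add_distrib]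
  | mul_X P j hP =>
    simp only [map_mul, Derivation.leibniz, hP, aeval_X, smul_eq_mul, map_add, add_mul,
      Finset.sum_add_distrib, pderiv_X, Finset.mul_sum]
    congr 1
    · rw [Finset.sum_eq_single j] <;> simp +contextual [Pi.single_apply, eq_comm]
    · exact Finset.sum_congr rfl fun i _ => by ring

theorem totalDegree_pderiv_le {ι : Type*} {P : MvPolynomial ι ℝ} {d : ℕ}
    (h : P.totalDegree ≤ d + 1) (i : ι) : (pderiv i P).totalDegree ≤ d := by
  refine Finset.sup_le fun m hm => ?_
  have h1 : m + Finsupp.single i 1 ∈ P.support := by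
    rw [mem_support_iff] at hm ⊢
    intro h0
    rw [coeff_pderiv, h0, zero_mul] at hm
    exact hm rfl
  have h2 := (le_totalDegree h1).trans h
  rw [Finsupp.sum_add_index' (fun _ => rfl) (fun _ _ _ => rfl), Finsupp.sum_single_index rfl] at h2
  omega

theorem eq_C_of_pderiv_eq_zero {ι : Type*} {P : MvPolynomial ι ℝ} (h : ∀ i, pderiv i P = 0) :
    P = C (P.coeff 0) := by
  classical
  ext m
  rw [coeff_C]
  split_ifs with hm
  · rw [hm]
  · obtain ⟨i, hi⟩ := Finsupp.ne_iff.1 (Ne.symm hm)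
    have hm' : m - Finsupp.single i 1 + Finsupp.single i 1 = m := by
      refine tsub_add_cancel_of_le ?_
      rw [Finsupp.single_le_iff]
      exact Nat.one_le_iff_ne_zero.2 hi
    have := coeff_pderiv (i := i) P (m - Finsupp.single i 1)
    rw [h i, hm', coeff_zero] at this
    exact (mul_eq_zero.1 this.symm).resolve_right (by positivity)

/-- Differentiating a relation `P` gives a linear relation between the gradients, so each partial
derivative of `P` is again a relation, of smaller degree. By induction these derivatives vanish, and
a constant relation is zero. -/
theorem algebraicIndependent_monodromyInvariant (hn : 3 ≤ n) :
    AlgebraicIndependent ℝ (monodromyInvariant n) := by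
  have key : ∀ (d : ℕ) (P : MvPolynomial (InvIndex n ⊕ InvIndex n) ℝ), P.totalDegree ≤ d →
      aeval (monodromyInvariant n) P = 0 → P = 0 := by
    intro d
    have hconst : ∀ P : MvPolynomial (InvIndex n ⊕ InvIndex n) ℝ, P = C (P.coeff 0) →
        aeval (monodromyInvariant n) P = 0 → P = 0 := by
      intro P hP h0
      rw [hP, aeval_C] at h0
      rw [hP]
      have : C (P.coeff 0) = (0 : CornerPoly n) := h0
      rw [C_eq_zero] at this
      rw [this, C_0]
    induction d with
    | zero =>
      intro P hP h0
      exact hconst P (totalDegree_eq_zero_iff_eq_C.1 (Nat.le_zero.1 hP)) h0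
    | succ d ih =>
      intro P hP h0
      refine hconst P (eq_C_of_pderiv_eq_zero fun i => ih _ (totalDegree_pderiv_le hP i) ?_) h0
      -- The extra factors vanish at the points where the gradients are dependent or a coordinate is
      -- zero, so the product vanishes everywhere; being nonzero polynomials, they can be cancelled.
      have hprod : aeval (monodromyInvariant n) (pderiv i P) * (gram n * ∏ a, X a) = 0 := by
        refine MvPolynomial.funext fun z => ?_
        rw [map_zero, map_mul, map_mul, map_prod]
        by_cases hz : z ∈ regular n
        · by_cases hg : eval z (gram n) = 0
          · rw [hg, zero_mul, mul_zero]
          · have hli := Fintype.linearIndependent_iff.1 ((linearIndependent_logGrad_iff hz).2 hg)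
              (fun i => eval z (aeval (monodromyInvariant n) (pderiv i P))) ?_ i
            · rw [hli, zero_mul]
            · funext a
              have := congrArg (eval z) (euler_aeval (monodromyInvariant n) P a)
              rw [h0, map_zero, map_zero, map_sum] at this
              rw [Finset.sum_apply, Pi.zero_apply, this]
              simp [logGrad]
        · simp only [regular, Set.mem_ofPred_eq, not_forall, not_not] at hz
          obtain ⟨a, ha⟩ := hz
          rw [Finset.prod_eq_zero (Finset.mem_univ a), mul_zero, mul_zero]
          rw [eval_X, ha]
      refine (mul_eq_zero.1 hprod).resolve_right (mul_ne_zero (gram_ne_zero hn) ?_)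
      exact Finset.prod_ne_zero_iff.2 fun a _ => X_ne_zero a
  exact algebraicIndependent_iff.2 fun P h0 => key _ P le_rfl h0

/-! ### Counting the Casimirs. -/

theorem ncard_isCasimir_le (hn : 3 ≤ n) :
    {i | IsCasimir (monodromyInvariant n i).toFun}.ncard ≤
      Module.finrank ℝ (casimirSpace n) := by
  -- At one point of independence the gradients of the Casimirs in the family are independent
  -- vectors in the kernel of the tensor.
  obtain ⟨p, hp, hli⟩ := exists_independent hn
  set S := {i | IsCasimir (monodromyInvariant n i).toFun} with hS
  have hmem : ∀ i : S, logGrad (corner n p) (monodromyInvariant n i) ∈ casimirSpace n := by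
    intro i
    have h := (isCasimir_iff hn (isSmooth_toFun _)).1 i.2 p hp
    rw [eulerGrad_coordRep_toFun _ (corner_ne_zero hp)] at h
    exact h
  let v : S → casimirSpace n := fun i => ⟨_, hmem i⟩
  have hv : LinearIndependent ℝ v :=
    LinearIndependent.of_comp (casimirSpace n).subtype
      (hli.comp (Subtype.val : S → _) Subtype.val_injective)
  have := Fintype.ofFinite S
  rw [← Nat.card_coe_set_eq, Nat.card_eq_fintype_card]
  exact hv.fintype_card_le_finrank

/-- The kernel dimension bounds the number from above and the explicit Casimirs from below; `n / 2 ≠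
n` keeps the four of the even case distinct. -/
theorem ncard_isCasimir (hn : 3 ≤ n) :
    {i | IsCasimir (monodromyInvariant n i).toFun}.ncard = if Odd n then 2 else 4 := by
  have hle := ncard_isCasimir_le hn
  have hO : IsCasimir (monodromyInvariant n (.inl ⟨n, .inr rfl⟩)).toFun :=
    isCasimir_toFun hn fun z _ => logGrad_O_self_mem hn z
  have hE : IsCasimir (monodromyInvariant n (.inr ⟨n, .inr rfl⟩)).toFun :=
    isCasimir_toFun hn fun z _ => logGrad_E_self_mem hn z
  classical
  split_ifs with ho
  · rw [finrank_casimirSpace_odd hn ho] at hle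
    refine le_antisymm hle ?_
    have hsub : ((({.inl ⟨n, .inr rfl⟩, .inr ⟨n, .inr rfl⟩} :
        Finset (InvIndex n ⊕ InvIndex n)) : Set (InvIndex n ⊕ InvIndex n)) ⊆
        {i | IsCasimir (monodromyInvariant n i).toFun}) := by
      intro i hi
      simp only [Finset.coe_insert, Finset.coe_singleton, Set.mem_insert_iff,
        Set.mem_singleton_iff] at hi
      rcases hi with rfl | rfl
      · exact hO
      · exact hE
    have := Set.ncard_le_ncard hsub (Set.toFinite _)
    rw [Set.ncard_coe_finset] at this
    simpa using this
  · have he := Nat.not_odd_iff_even.1 ho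
    rw [finrank_casimirSpace_even hn he] at hle
    refine le_antisymm hle ?_
    have hm : 1 ≤ n / 2 ∧ n / 2 ≤ n / 2 := by omega
    have hO' : IsCasimir (monodromyInvariant n (.inl ⟨n / 2, .inl hm⟩)).toFun :=
      isCasimir_toFun hn fun z _ => logGrad_O_half_mem hn he z
    have hE' : IsCasimir (monodromyInvariant n (.inr ⟨n / 2, .inl hm⟩)).toFun :=
      isCasimir_toFun hn fun z _ => logGrad_E_half_mem hn he z
    have hsub : ((({.inl ⟨n, .inr rfl⟩, .inr ⟨n, .inr rfl⟩, .inl ⟨n / 2, .inl hm⟩,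
        .inr ⟨n / 2, .inl hm⟩} :
        Finset (InvIndex n ⊕ InvIndex n)) : Set (InvIndex n ⊕ InvIndex n)) ⊆
        {i | IsCasimir (monodromyInvariant n i).toFun}) := by
      intro i hi
      simp only [Finset.coe_insert, Finset.coe_singleton, Set.mem_insert_iff,
        Set.mem_singleton_iff] at hi
      rcases hi with rfl | rfl | rfl | rfl
      · exact hO
      · exact hE
      · exact hO'
      · exact hE'
    have := Set.ncard_le_ncard hsub (Set.toFinite _)
    rw [Set.ncard_coe_finset] at this
    have hne : n ≠ n / 2 := by omega
    simpa [Finset.card_insert_of_notMem, hne] using this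

theorem two_mul_ncard_not_isCasimir (hn : 3 ≤ n) :
    2 * {i | ¬ IsCasimir (monodromyInvariant n i).toFun}.ncard + (if Odd n then 2 else 4) =
      2 * n := by
  have h := Set.ncard_add_ncard_compl {i | IsCasimir (monodromyInvariant n i).toFun}
  rw [ncard_isCasimir hn, Nat.card_eq_fintype_card, Fintype.card_sum, card_invIndex hn] at h
  have e : {i | ¬ IsCasimir (monodromyInvariant n i).toFun} =
    {i | IsCasimir (monodromyInvariant n i).toFun}ᶜ := rfl
  rw [e]
  split_ifs at h ⊢ with ho
  · obtain ⟨m, hm⟩ := ho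
    omega
  · obtain ⟨m, hm⟩ := Nat.not_odd_iff_even.1 ho
    omega

end Independence

end Pentagram

end

theorem mainTheorem2 (n : ℕ) [NeZero n] (hn : 3 ≤ n) :
    -- the corner invariants are coordinates on the generic part of the space of twisted n-gons
    (Set.InjOn (Pentagram.corner n) (Pentagram.generic n) ∧
      Pentagram.corner n '' Pentagram.generic n = {z | ∀ a, z a ≠ 0}) ∧
    -- the pentagram map in these coordinates, and its domain
    (Pentagram.corner n '' Pentagram.domT n =
        {z | (∀ a, z a ≠ 0) ∧ ∀ i, z (.inl i) * z (.inr i) ≠ 1} ∧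
      ∀ p ∈ Pentagram.domT n,
        Pentagram.corner n (Pentagram.T n p) =
          Pentagram.pentagramCoord (Pentagram.corner n p)) ∧
    -- the bracket is a Poisson bracket preserved by the pentagram map
    Pentagram.IsPoissonBracket (n := n) Pentagram.bracket ∧
    (∀ f g : Pentagram.PolygonSpace n → ℝ, Pentagram.IsSmooth f → Pentagram.IsSmooth g →
      ∀ p ∈ Pentagram.domT n,
        Pentagram.bracket (f ∘ Pentagram.T n) (g ∘ Pentagram.T n) p =
          Pentagram.bracket f g (Pentagram.T n p)) ∧
    -- its corank
    (Odd n → Pentagram.HasCorank n 2) ∧ (Even n → Pentagram.HasCorank n 4) ∧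
    -- its Casimirs
    (Pentagram.IsCasimir (Pentagram.O n n).toFun ∧
      Pentagram.IsCasimir (Pentagram.E n n).toFun) ∧
    (Even n →
      Pentagram.IsCasimir (Pentagram.O n (n / 2)).toFun ∧
      Pentagram.IsCasimir (Pentagram.E n (n / 2)).toFun ∧
      Pentagram.O n (n / 2) = (-1) ^ (n / 2) *
        ((∏ i with Even i.val, Pentagram.xVar i) + (∏ i with Odd i.val, Pentagram.xVar i)) ∧
      Pentagram.E n (n / 2) = (-1) ^ (n / 2) *
        ((∏ i with Even i.val, Pentagram.yVar i) + (∏ i with Odd i.val, Pentagram.yVar i))) ∧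
    -- the invariants `O_k`, `E_k` are the weighted homogeneous parts of the normalized traces
    -- of the monodromy
    (∀ (φ : Pentagram.TwistedPolygon n) (M : GL (Fin 3) ℝ),
      Pentagram.IsGenericPolygon φ.vertex → φ.HasMonodromy (Matrix.ProjGenLinGroup.mk M) →
      (Pentagram.O n n).toFun φ.toSpace ^ 2 * (Pentagram.E n n).toFun φ.toSpace *
          ((M⁻¹).val.trace ^ 3 / (M⁻¹).val.det) =
        (1 + ∑ k ∈ Finset.Icc 1 (n / 2), (Pentagram.O n k).toFun φ.toSpace) ^ 3 ∧
      (Pentagram.O n n).toFun φ.toSpace * (Pentagram.E n n).toFun φ.toSpace ^ 2 *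
          (M.val.trace ^ 3 / M.val.det) =
        (1 + ∑ k ∈ Finset.Icc 1 (n / 2), (Pentagram.E n k).toFun φ.toSpace) ^ 3) ∧
    (∀ (k : Pentagram.InvIndex n) (t : ℝ) (z : Pentagram.Coord n), t ≠ 0 →
      MvPolynomial.eval (Pentagram.rescale t z) (Pentagram.O n k) =
        t ^ (k : ℕ) * MvPolynomial.eval z (Pentagram.O n k) ∧
      MvPolynomial.eval (Pentagram.rescale t z) (Pentagram.E n k) =
        t⁻¹ ^ (k : ℕ) * MvPolynomial.eval z (Pentagram.E n k)) ∧
    -- they are invariant, Poisson commute and are algebraically independent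
    (∀ i, Pentagram.IsInvariant (Pentagram.monodromyInvariant n i).toFun) ∧
    (∀ i j, Pentagram.PoissonCommute (Pentagram.monodromyInvariant n i).toFun
      (Pentagram.monodromyInvariant n j).toFun) ∧
    AlgebraicIndependent ℝ (Pentagram.monodromyInvariant n) ∧
    -- Arnold–Liouville integrability
    Pentagram.IsArnoldLiouvilleIntegrable n (if Odd n then 2 else 4)
      (fun i => (Pentagram.monodromyInvariant n i).toFun) := by
  refine ⟨⟨Pentagram.corner_injOn n, Pentagram.corner_image n⟩,
    ⟨Pentagram.corner_image_domT n, fun p hp => Pentagram.corner_T hp⟩,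
    Pentagram.isPoissonBracket_bracket hn, fun f g hf hg p hp => Pentagram.bracket_comp_T hn hf hg hp,
    fun ho => Pentagram.hasCorank_of_finrank hn (Pentagram.finrank_casimirSpace_odd hn ho),
    fun he => Pentagram.hasCorank_of_finrank hn (Pentagram.finrank_casimirSpace_even hn he),
    ⟨Pentagram.isCasimir_toFun hn fun z _ => Pentagram.logGrad_O_self_mem hn z,
      Pentagram.isCasimir_toFun hn fun z _ => Pentagram.logGrad_E_self_mem hn z⟩,
    fun he => ⟨Pentagram.isCasimir_toFun hn fun z _ => Pentagram.logGrad_O_half_mem hn he z,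
      Pentagram.isCasimir_toFun hn fun z _ => Pentagram.logGrad_E_half_mem hn he z,
      Pentagram.O_half hn he, Pentagram.E_half hn he⟩,
    fun φ M hg hM =>
      ⟨Pentagram.trace_monodromy_inv hn hg hM, Pentagram.trace_monodromy hn hg hM⟩,
    fun k t z ht => ⟨Pentagram.eval_rescale_O t z k ht, Pentagram.eval_rescale_E t z k ht⟩,
    Pentagram.isInvariant_monodromyInvariant hn, Pentagram.poissonCommute_monodromyInvariant hn,
    Pentagram.algebraicIndependent_monodromyInvariant hn, ?_⟩
  exact
    { hasCorank := by
        split_ifs with ho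
        · exact Pentagram.hasCorank_of_finrank hn (Pentagram.finrank_casimirSpace_odd hn ho)
        · exact Pentagram.hasCorank_of_finrank hn
            (Pentagram.finrank_casimirSpace_even hn (Nat.not_odd_iff_even.1 ho))
      smooth := fun i => Pentagram.isSmooth_toFun _
      invariant := Pentagram.isInvariant_monodromyInvariant hn
      commute := Pentagram.poissonCommute_monodromyInvariant hn
      ncard_casimir := Pentagram.ncard_isCasimir hn
      two_mul_ncard_add := Pentagram.two_mul_ncard_not_isCasimir hn
      isOpen_independent := Pentagram.isOpen_independent
      dense_independent := Pentagram.dense_independent hn }
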